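/- Let $k \ge 2$ be an integer and let $p \ge 0$ be a real number. For $n \ge 1$ let $\mu_k(n) = 1$ if there is no integer $d > 1$ with $d^k \mid n$, and $\mu_k(n) = 0$ otherwise. For an integer $N \ge 2$ and real $\alpha$ put $$S_k(\alpha) = \sum_{1 \le n \le N} \mu_k(n)\, e^{2\pi i \alpha n}, \qquad I_k(p) = \int_0^1 |S_k(\alpha)|^p \, d\alpha .$$ Then there are constants $c, C > 0$, depending only on $k$ and $p$, such that for all integers $N \ge 2$: - if $p > 1 + 1/k$, then $c\, N^{p-1} \le I_k(p) \le C\, N^{p-1}$; - if $p = 1 + 1/k$, then $c\, N^{1/k} \log N \le I_k(p) \le C\, N^{1/k} (\log N)^2$; - if $p < 1 + 1/k$, then $c\, N^{p/(k+1)} \le I_k(p) \le C\, N^{p/(k+1)}$. -/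

import Mathlib

noncomputable section

/-- The indicator function `μ_k` of the `k`-free numbers: it is `1` at `n` if there is no
integer `d > 1` with `d ^ k ∣ n`, and `0` otherwise. -/
def kFreeIndicator (k n : ℕ) : ℂ :=
  open Classical in if ∃ d : ℕ, 1 < d ∧ d ^ k ∣ n then 0 else 1

/-- `e(x) = exp(2πix)`. -/
def expTwoPiI (x : ℝ) : ℂ :=
  Complex.exp (2 * (Real.pi : ℂ) * Complex.I * (x : ℂ))

/-- The exponential sum `S_k(α) = ∑_{1 ≤ n ≤ N} μ_k(n) e(αn)`. -/
def kFreeExpSum (k N : ℕ) (α : ℝ) : ℂ :=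
  ∑ n ∈ Finset.Icc 1 N, kFreeIndicator k n * expTwoPiI (α * (n : ℝ))

/-- The `p`-th moment `I_k(p) = ∫_0^1 |S_k(α)|^p dα`. For `p ≥ 0` the integrand is
continuous, hence integrable. -/
def kFreeMoment (k N : ℕ) (p : ℝ) : ℝ :=
  ∫ α in (0 : ℝ)..1, ‖kFreeExpSum k N α‖ ^ p

end

/-!
Write `μ_k(n) = ∑ μ(d)` over `d ^ k ∣ n`, so that the exponential sum is a combination of the sums
over the multiples of the powers `d ^ k`. Such a sum has peaks of height `N / d ^ k` and width
`1 / N` at the fractions with denominator `d ^ k`, so the moduli of size `D` should contribute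
`D ^ (k + 1) N⁻¹ (N / D ^ k) ^ p` to the moment of order `p`, as long as `D ^ (k + 1) ≤ N`. The
exponent of `D` here is `k + 1 - k p`: it is negative, zero or positive according as `p` is above,
at or below `1 + 1 / k`, and `D = 1`, all dyadic `D`, or `D = N ^ (1 / (k + 1))` dominate.

*Upper bounds.* The moduli above `N ^ (1 / (k + 1))` are small in mean square
(`integral_norm_sq_powerSum_Icc_le`), by Parseval's identity and an estimate for
`∑ lcm(d, e) ^ (-k)`. For a dyadic block of smaller moduli the moment of order `1 < p < 2` is
obtained by interpolating between mean square and mean (`lpNorm_powerSum_le`). The mean of a sum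
over an interval would cost a logarithm; to avoid it the interval `[1, N]` is cut into smooth
pieces that become shorter towards its ends (`endPiece`), whose means are bounded by
`IsBump.integral_norm_le`, and the `L^p` norms of the pieces decrease geometrically. Summing over
the pieces and blocks gives `exists_lpNorm_kFreeExpSum_le`. The bounds for `p ≥ 2` and `p ≤ 1`
follow from the trivial bound and from Hölder's inequality.

*Lower bounds.* The neighbourhood of `0` alone gives `N ^ (p - 1)` (`kFreeMoment_ge`). For the
other two regimes it is shown that `|S(α)|` exceeds a multiple of `N / D ^ k` on a set of measure
at least a multiple of `D ^ (k + 1) / N` (`exists_integral_levelIndicator_ge`); the moments are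
then bounded below by Chebyshev's inequality at a single height, or at about `log N` heights when
`p = 1 + 1 / k`. For the level sets, `S` is replaced by the sum with the weight `sin (π n / N)`, a
combination of two translates of `S`, for which the sums over multiples decay quadratically off
their peaks. To the right of a fraction `a / d ^ k` with `d` squarefree and `a` not divisible by
the `k`-th power of any prime factor of `d`, the multiples of `d` among the moduli give a main
term (`le_norm_sum_multiples`); the other moduli up to a multiple of `D` are small on average over
the fractions (`sum_arcError_le`), and the remaining ones in mean square. Most of these fractions
are at distance at least `1 / (20 N)` from each other (`card_isolatedPoints_ge`), so that the arcs
to their right are disjoint.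
-/

namespace KFree

open Finset MeasureTheory Real

/-! ### Trigonometric polynomials -/

lemma expTwoPiI_add (x y : ℝ) : expTwoPiI (x + y) = expTwoPiI x * expTwoPiI y := by
  simp only [expTwoPiI, ← Complex.exp_add]
  congr 1
  push_cast
  ring

lemma expTwoPiI_int (n : ℤ) : expTwoPiI n = 1 := by
  have := Complex.exp_int_mul_two_pi_mul_I n
  rw [expTwoPiI, ← this]
  congr 1
  push_cast
  ring

@[simp] lemma expTwoPiI_zero : expTwoPiI 0 = 1 := by simp [expTwoPiI]

lemma expTwoPiI_nat (n : ℕ) : expTwoPiI n = 1 := by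
  simpa using expTwoPiI_int n

lemma expTwoPiI_eq (x : ℝ) :
    expTwoPiI x = ((Real.cos (2 * π * x) : ℝ) : ℂ) +
      ((Real.sin (2 * π * x) : ℝ) : ℂ) * Complex.I := by
  rw [expTwoPiI, show 2 * (π : ℂ) * Complex.I * (x : ℂ) = ((2 * π * x : ℝ) : ℂ) * Complex.I by
    push_cast; ring, Complex.exp_mul_I]
  push_cast
  rfl

@[simp] lemma norm_expTwoPiI (x : ℝ) : ‖expTwoPiI x‖ = 1 := by
  rw [expTwoPiI, show 2 * (π : ℂ) * Complex.I * (x : ℂ) = ((2 * π * x : ℝ) : ℂ) * Complex.I by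
    push_cast; ring, Complex.norm_exp_ofReal_mul_I]

lemma re_expTwoPiI (x : ℝ) : (expTwoPiI x).re = Real.cos (2 * π * x) := by
  rw [expTwoPiI_eq, ← Complex.mk_eq_add_mul_I]

lemma conj_expTwoPiI (x : ℝ) : (starRingEnd ℂ) (expTwoPiI x) = expTwoPiI (-x) := by
  rw [expTwoPiI_eq, expTwoPiI_eq, ← Complex.mk_eq_add_mul_I, ← Complex.mk_eq_add_mul_I]
  apply Complex.ext <;> simp

@[fun_prop] lemma continuous_expTwoPiI : Continuous expTwoPiI := by
  unfold expTwoPiI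
  fun_prop

lemma expTwoPiI_mul_nat (x : ℝ) (n : ℕ) : expTwoPiI (x * n) = expTwoPiI x ^ n := by
  rw [expTwoPiI, expTwoPiI, ← Complex.exp_nat_mul]
  congr 1
  push_cast
  ring

lemma norm_one_sub_expTwoPiI (x : ℝ) : ‖1 - expTwoPiI x‖ = 2 * |Real.sin (π * x)| := by
  have h : ‖1 - expTwoPiI x‖ ^ 2 = (2 * |Real.sin (π * x)|) ^ 2 := by
    rw [← Complex.normSq_eq_norm_sq, expTwoPiI_eq, mul_pow, sq_abs, Complex.normSq_apply]
    simp only [Complex.sub_re, Complex.one_re, Complex.add_re, Complex.ofReal_re, Complex.mul_re,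
      Complex.I_re, mul_zero, Complex.ofReal_im, Complex.I_im, Complex.sub_im,
      Complex.one_im, Complex.add_im, Complex.mul_im]
    have h1 : Real.cos (2 * π * x) = 1 - 2 * Real.sin (π * x) ^ 2 := by
      rw [show 2 * π * x = 2 * (π * x) by ring, Real.cos_two_mul]
      have := Real.sin_sq_add_cos_sq (π * x)
      linarith
    have h2 := Real.sin_sq_add_cos_sq (2 * π * x)
    nlinarith
  exact (pow_left_inj₀ (norm_nonneg _) (by positivity) two_ne_zero).1 h

lemma four_mul_abs_le_norm_one_sub {x : ℝ} (hx : |x| ≤ 1 / 2) : 4 * |x| ≤ ‖1 - expTwoPiI x‖ := by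
  rw [norm_one_sub_expTwoPiI]
  have h := Real.mul_abs_le_abs_sin (x := π * x)
    (by rw [abs_mul, abs_of_pos pi_pos]; nlinarith [pi_pos])
  rw [abs_mul, abs_of_pos pi_pos] at h
  have : 2 / π * (π * |x|) = 2 * |x| := by field_simp
  linarith

lemma norm_one_sub_expTwoPiI_le (x : ℝ) : ‖1 - expTwoPiI x‖ ≤ 2 * π * |x| := by
  rw [norm_one_sub_expTwoPiI]
  have h := Real.abs_sin_le_abs (x := π * x)
  rw [abs_mul, abs_of_pos pi_pos] at h
  linarith

lemma integral_expTwoPiI_int (m : ℤ) :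
    ∫ α in (0 : ℝ)..1, expTwoPiI (α * m) = if m = 0 then 1 else 0 := by
  split_ifs with h
  · simp [h]
  · have hc : (2 * (π : ℂ) * Complex.I * m) ≠ 0 := by
      simp [h, pi_ne_zero]
    have h1 : ∀ α : ℝ, expTwoPiI (α * m) = Complex.exp ((2 * (π : ℂ) * Complex.I * m) * α) := by
      intro α
      rw [expTwoPiI]
      congr 1
      push_cast
      ring
    simp_rw [h1]
    rw [integral_exp_mul_complex hc]
    have := expTwoPiI_int m
    rw [expTwoPiI] at this
    simp only [Complex.ofReal_one, mul_one, Complex.ofReal_zero, mul_zero, Complex.exp_zero]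
    push_cast at this
    rw [this]
    simp

/-- The trigonometric polynomial `∑_{n ∈ A} c_n e(αn)`. -/
noncomputable def trigPoly (A : Finset ℕ) (c : ℕ → ℂ) (α : ℝ) : ℂ :=
  ∑ n ∈ A, c n * expTwoPiI (α * n)

@[fun_prop] lemma continuous_trigPoly (A : Finset ℕ) (c : ℕ → ℂ) : Continuous (trigPoly A c) := by
  unfold trigPoly
  fun_prop

lemma trigPoly_add_one (A : Finset ℕ) (c : ℕ → ℂ) (α : ℝ) :
    trigPoly A c (α + 1) = trigPoly A c α := by
  refine Finset.sum_congr rfl fun n _ => ?_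
  rw [add_mul, one_mul, expTwoPiI_add, expTwoPiI_nat, mul_one]

lemma periodic_trigPoly (A : Finset ℕ) (c : ℕ → ℂ) : Function.Periodic (trigPoly A c) 1 :=
  trigPoly_add_one A c

/-- Parseval's identity. -/
lemma integral_norm_sq_trigPoly (A : Finset ℕ) (c : ℕ → ℂ) :
    ∫ α in (0 : ℝ)..1, ‖trigPoly A c α‖ ^ 2 = ∑ n ∈ A, ‖c n‖ ^ 2 := by
  have h : ∀ α : ℝ, ((‖trigPoly A c α‖ ^ 2 : ℝ) : ℂ) =
      ∑ n ∈ A, ∑ m ∈ A, c n * (starRingEnd ℂ) (c m) * expTwoPiI (α * ((n - m : ℤ) : ℝ)) := by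
    intro α
    rw [← Complex.normSq_eq_norm_sq, ← Complex.mul_conj, trigPoly, map_sum, Finset.sum_mul_sum]
    refine Finset.sum_congr rfl fun n _ => Finset.sum_congr rfl fun m _ => ?_
    rw [map_mul, conj_expTwoPiI]
    push_cast
    rw [mul_sub, sub_eq_add_neg, expTwoPiI_add]
    ring
  have h2 : ((∫ α in (0 : ℝ)..1, ‖trigPoly A c α‖ ^ 2 : ℝ) : ℂ) =
      ((∑ n ∈ A, ‖c n‖ ^ 2 : ℝ) : ℂ) := by
    rw [← intervalIntegral.integral_ofReal]
    simp_rw [h]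
    rw [intervalIntegral.integral_finsetSum]
    · push_cast
      refine Finset.sum_congr rfl fun n hn => ?_
      rw [intervalIntegral.integral_finsetSum]
      · rw [Finset.sum_eq_single n]
        · rw [intervalIntegral.integral_const_mul]
          simp [Complex.mul_conj, Complex.normSq_eq_norm_sq]
        · intro m _ hm
          have := integral_expTwoPiI_int (n - m : ℤ)
          rw [if_neg (by omega)] at this
          push_cast at this
          rw [intervalIntegral.integral_const_mul]
          rw [this, mul_zero]
        · intro h
          exact absurd hn h
      · intro m _
        exact Continuous.intervalIntegrable (by fun_prop) _ _
    · intro m _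
      exact Continuous.intervalIntegrable (by fun_prop) _ _
  exact_mod_cast h2

/-- Dilation by a positive integer does not change the mean of a periodic function. -/
lemma integral_periodic_comp_nat_mul {f : ℝ → ℝ} (hf : Function.Periodic f 1)
    (hc : Continuous f) {s : ℕ} (hs : 0 < s) :
    ∫ α in (0 : ℝ)..1, f (s * α) = ∫ α in (0 : ℝ)..1, f α := by
  have hs' : (s : ℝ) ≠ 0 := by positivity
  rw [intervalIntegral.integral_comp_mul_left f hs']
  have h := hf.intervalIntegral_add_zsmul_eq (s : ℤ) 0 fun _ _ => hc.intervalIntegrable _ _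
  simp only [zero_add, zsmul_eq_mul, Int.cast_natCast, mul_one] at h
  rw [mul_zero, mul_one, h, smul_eq_mul, ← mul_assoc, inv_mul_cancel₀ hs', one_mul]

lemma integral_periodic_add {f : ℝ → ℝ} (hf : Function.Periodic f 1) (θ : ℝ) :
    ∫ α in (0 : ℝ)..1, f (α + θ) = ∫ α in (0 : ℝ)..1, f α := by
  rw [intervalIntegral.integral_comp_add_right, zero_add, add_comm 1 θ]
  have := hf.intervalIntegral_add_eq θ 0
  rwa [zero_add] at this

/-- Comparison with a Cauchy density, since `|1 - e(α)| ≥ 4 |α|` for `|α| ≤ 1 / 2`. -/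
lemma integral_inv_one_add_sq_mul_norm_sq_le {K : ℝ} (hK : 0 < K) :
    ∫ α in (0 : ℝ)..1, (1 + K ^ 2 * ‖1 - expTwoPiI α‖ ^ 2)⁻¹ ≤ 1 / K := by
  have hper : Function.Periodic (fun α : ℝ => (1 + K ^ 2 * ‖1 - expTwoPiI α‖ ^ 2)⁻¹) 1 := by
    intro α
    have : expTwoPiI (α + 1) = expTwoPiI α := by
      rw [expTwoPiI_add, show (1 : ℝ) = ((1 : ℕ) : ℝ) by simp, expTwoPiI_nat, mul_one]
    simp only [this]
  have h0 := hper.intervalIntegral_add_eq 0 (-1 / 2)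
  rw [zero_add] at h0
  rw [h0, show (-1 / 2 + 1 : ℝ) = 1 / 2 by norm_num]
  have hle : ∫ α in (-1 / 2 : ℝ)..(1 / 2), (1 + K ^ 2 * ‖1 - expTwoPiI α‖ ^ 2)⁻¹ ≤
      ∫ α in (-1 / 2 : ℝ)..(1 / 2), (1 + (4 * K * α) ^ 2)⁻¹ := by
    refine intervalIntegral.integral_mono_on (by norm_num) ?_ ?_ ?_
    · refine Continuous.intervalIntegrable ?_ _ _
      refine Continuous.inv₀ (by fun_prop) fun α => by positivity
    · refine Continuous.intervalIntegrable ?_ _ _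
      refine Continuous.inv₀ (by fun_prop) fun α => by positivity
    · intro α hα
      have h1 := four_mul_abs_le_norm_one_sub (x := α) (abs_le.2 ⟨by linarith [hα.1], hα.2⟩)
      have h2 : (4 * |α|) ^ 2 ≤ ‖1 - expTwoPiI α‖ ^ 2 := by gcongr
      rw [mul_pow, sq_abs] at h2
      gcongr
      nlinarith [sq_nonneg K]
  refine hle.trans ?_
  have := intervalIntegral.integral_comp_mul_left (a := -1 / 2) (b := 1 / 2)
    (fun x : ℝ => (1 + x ^ 2)⁻¹) (c := 4 * K) (by positivity)
  rw [this, integral_inv_one_add_sq, smul_eq_mul]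
  have h1 := Real.arctan_lt_pi_div_two (4 * K * (1 / 2))
  have h2 := Real.neg_pi_div_two_lt_arctan (4 * K * (-1 / 2))
  have h3 := Real.pi_le_four
  calc (4 * K)⁻¹ * (arctan (4 * K * (1 / 2)) - arctan (4 * K * (-1 / 2)))
      ≤ (4 * K)⁻¹ * 4 := by gcongr; linarith
    _ = 1 / K := by field_simp

/-- Summation by parts; the boundary terms vanish as `a` is zero at both ends. -/
lemma one_sub_mul_trigPoly {n : ℕ} {a : ℕ → ℂ} (h0 : a 0 = 0) (hn : a n = 0) (α : ℝ) :
    (1 - expTwoPiI α) * trigPoly (range n) a α =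
      trigPoly (range (n + 1)) (fun m => a m - a (m - 1)) α := by
  simp only [trigPoly]
  have e1 : ∑ m ∈ range (n + 1), a m * expTwoPiI (α * m) =
      ∑ m ∈ range n, a m * expTwoPiI (α * m) := by
    rw [sum_range_succ, hn]
    simp
  have e2 : ∑ m ∈ range (n + 1), a (m - 1) * expTwoPiI (α * m) =
      expTwoPiI α * ∑ m ∈ range n, a m * expTwoPiI (α * m) := by
    rw [sum_range_succ', mul_sum]
    simp only [Nat.add_sub_cancel, Nat.zero_sub, h0, zero_mul, add_zero]
    refine sum_congr rfl fun m _ => ?_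
    push_cast
    rw [mul_add, expTwoPiI_add, mul_one]
    ring
  simp_rw [sub_mul, sum_sub_distrib]
  rw [e1, e2]
  ring

/-- An `L¹` bound from the sizes of the coefficients and of their first differences: on the
scale `1 / K` the square function is balanced against the weight `1 + K² |1 - e(α)|²`. -/
lemma integral_norm_trigPoly_le {n : ℕ} {a : ℕ → ℂ} (h0 : a 0 = 0) (hn : a n = 0)
    {K A B : ℝ} (hK : 0 < K) (hA : ∑ m ∈ range n, ‖a m‖ ^ 2 ≤ A * K)
    (hB : ∑ m ∈ range (n + 1), ‖a m - a (m - 1)‖ ^ 2 ≤ B / K) :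
    ∫ α in (0 : ℝ)..1, ‖trigPoly (range n) a α‖ ≤ A + B + 1 := by
  have hpt : ∀ α : ℝ, ‖trigPoly (range n) a α‖ ≤
      (1 / K) * ‖trigPoly (range n) a α‖ ^ 2 +
      K * ‖trigPoly (range (n + 1)) (fun m => a m - a (m - 1)) α‖ ^ 2 +
      K * (1 + K ^ 2 * ‖1 - expTwoPiI α‖ ^ 2)⁻¹ := by
    intro α
    rw [← one_sub_mul_trigPoly h0 hn, norm_mul]
    -- `x ≤ x² u / K + K / u` with `u = 1 + K² y²`
    set x := ‖trigPoly (range n) a α‖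
    set y := ‖1 - expTwoPiI α‖
    have hx : 0 ≤ x := norm_nonneg _
    have hu : 0 < 1 + K ^ 2 * y ^ 2 := by positivity
    have h1 : x ≤ (1 / K) * x ^ 2 * (1 + K ^ 2 * y ^ 2) + K * (1 + K ^ 2 * y ^ 2)⁻¹ := by
      rw [← sub_nonneg]
      have : (1 / K) * x ^ 2 * (1 + K ^ 2 * y ^ 2) + K * (1 + K ^ 2 * y ^ 2)⁻¹ - x =
          ((x * (1 + K ^ 2 * y ^ 2) - K) ^ 2 + K * (x * (1 + K ^ 2 * y ^ 2))) /
            (K * (1 + K ^ 2 * y ^ 2)) := by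
        field_simp
        ring
      rw [this]
      positivity
    have h2 : (1 / K) * x ^ 2 * (1 + K ^ 2 * y ^ 2) =
        (1 / K) * x ^ 2 + K * (y * x) ^ 2 := by
      field_simp
    linarith
  have hc : Continuous fun α : ℝ => (1 + K ^ 2 * ‖1 - expTwoPiI α‖ ^ 2)⁻¹ :=
    Continuous.inv₀ (by fun_prop) fun α => by positivity
  calc ∫ α in (0 : ℝ)..1, ‖trigPoly (range n) a α‖
      ≤ ∫ α in (0 : ℝ)..1, ((1 / K) * ‖trigPoly (range n) a α‖ ^ 2 +
      K * ‖trigPoly (range (n + 1)) (fun m => a m - a (m - 1)) α‖ ^ 2 +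
      K * (1 + K ^ 2 * ‖1 - expTwoPiI α‖ ^ 2)⁻¹) := by
        refine intervalIntegral.integral_mono_on (by norm_num)
          (Continuous.intervalIntegrable (by fun_prop) _ _)
          (Continuous.intervalIntegrable (by fun_prop) _ _) fun α _ => hpt α
    _ = (1 / K) * ∑ m ∈ range n, ‖a m‖ ^ 2 + K * ∑ m ∈ range (n + 1), ‖a m - a (m - 1)‖ ^ 2 +
      K * ∫ α in (0 : ℝ)..1, (1 + K ^ 2 * ‖1 - expTwoPiI α‖ ^ 2)⁻¹ := by
        rw [intervalIntegral.integral_add, intervalIntegral.integral_add,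
          intervalIntegral.integral_const_mul, intervalIntegral.integral_const_mul,
          intervalIntegral.integral_const_mul, integral_norm_sq_trigPoly,
          integral_norm_sq_trigPoly]
        all_goals exact Continuous.intervalIntegrable (by fun_prop) _ _
    _ ≤ (1 / K) * (A * K) + K * (B / K) + K * (1 / K) := by
        gcongr
        exact integral_inv_one_add_sq_mul_norm_sq_le hK
    _ = A + B + 1 := by field_simp

/-! ### Moments of continuous functions -/

/-- Interpolation of the moment of order `p ∈ (1, 2)` between those of order `1` and `2`. -/
lemma integral_rpow_le_of_integral_le {f : ℝ → ℂ} (hf : Continuous f) {p A B : ℝ} (hp1 : 1 < p)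
    (hp2 : p < 2) (hA : 0 < A) (hB : 0 < B) (h1 : ∫ α in (0 : ℝ)..1, ‖f α‖ ≤ A)
    (h2 : ∫ α in (0 : ℝ)..1, ‖f α‖ ^ 2 ≤ B) :
    ∫ α in (0 : ℝ)..1, ‖f α‖ ^ p ≤ A ^ (2 - p) * B ^ (p - 1) := by
  have hpt : ∀ α : ℝ, ‖f α‖ ^ p ≤ A ^ (2 - p) * B ^ (p - 1) *
      ((2 - p) / A * ‖f α‖ + (p - 1) / B * ‖f α‖ ^ 2) := by
    intro α
    have hx : 0 ≤ ‖f α‖ := norm_nonneg _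
    have h := Real.geom_mean_le_arith_mean2_weighted (w₁ := 2 - p) (w₂ := p - 1)
      (p₁ := ‖f α‖ / A) (p₂ := ‖f α‖ ^ 2 / B) (by linarith) (by linarith) (by positivity)
      (by positivity) (by ring)
    rw [div_rpow hx hA.le, div_rpow (by positivity) hB.le] at h
    have e : ‖f α‖ ^ p = ‖f α‖ ^ (2 - p) * (‖f α‖ ^ 2) ^ (p - 1) := by
      rw [← rpow_natCast, ← rpow_mul hx, ← rpow_add' hx]
      · congr 1
        push_cast
        ring
      · push_cast
        linarith
    have hA' : 0 < A ^ (2 - p) := by positivity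
    have hB' : 0 < B ^ (p - 1) := by positivity
    calc ‖f α‖ ^ p = A ^ (2 - p) * B ^ (p - 1) *
          (‖f α‖ ^ (2 - p) / A ^ (2 - p) * ((‖f α‖ ^ 2) ^ (p - 1) / B ^ (p - 1))) := by
          rw [e]; field_simp
      _ ≤ A ^ (2 - p) * B ^ (p - 1) * ((2 - p) * (‖f α‖ / A) + (p - 1) * (‖f α‖ ^ 2 / B)) := by
          gcongr
      _ = _ := by ring
  have hc : Continuous fun α => ‖f α‖ ^ p := hf.norm.rpow_const fun _ => Or.inr (by linarith)
  calc ∫ α in (0 : ℝ)..1, ‖f α‖ ^ p ≤ ∫ α in (0 : ℝ)..1, A ^ (2 - p) * B ^ (p - 1) *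
      ((2 - p) / A * ‖f α‖ + (p - 1) / B * ‖f α‖ ^ 2) := by
        refine intervalIntegral.integral_mono_on (by norm_num)
          (hc.intervalIntegrable _ _)
          (Continuous.intervalIntegrable (by fun_prop) _ _) fun α _ => hpt α
    _ = A ^ (2 - p) * B ^ (p - 1) * ((2 - p) / A * (∫ α in (0 : ℝ)..1, ‖f α‖) +
        (p - 1) / B * ∫ α in (0 : ℝ)..1, ‖f α‖ ^ 2) := by
        rw [intervalIntegral.integral_const_mul, intervalIntegral.integral_add,
          intervalIntegral.integral_const_mul, intervalIntegral.integral_const_mul]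
        all_goals exact Continuous.intervalIntegrable (by fun_prop) _ _
    _ ≤ A ^ (2 - p) * B ^ (p - 1) * ((2 - p) / A * A + (p - 1) / B * B) := by
        gcongr
    _ = A ^ (2 - p) * B ^ (p - 1) := by
        field_simp
        ring

/-- Monotonicity of normalized moments on the unit interval. -/
lemma integral_rpow_le_of_le {f : ℝ → ℂ} (hf : Continuous f) {p q B : ℝ} (hp : 0 ≤ p)
    (hpq : p ≤ q) (hq : 0 < q) (hB : 0 < B) (h : ∫ α in (0 : ℝ)..1, ‖f α‖ ^ q ≤ B) :
    ∫ α in (0 : ℝ)..1, ‖f α‖ ^ p ≤ B ^ (p / q) := by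
  have hw : p / q ≤ 1 := (div_le_one hq).2 hpq
  have hw0 : 0 ≤ p / q := by positivity
  have hpt : ∀ α : ℝ, ‖f α‖ ^ p ≤ B ^ (p / q) * (p / q / B * ‖f α‖ ^ q + (1 - p / q)) := by
    intro α
    have hx : 0 ≤ ‖f α‖ := norm_nonneg _
    have h := Real.geom_mean_le_arith_mean2_weighted (w₁ := p / q) (w₂ := 1 - p / q)
      (p₁ := ‖f α‖ ^ q / B) (p₂ := 1) hw0 (by linarith) (by positivity)
      (by positivity) (by ring)
    rw [div_rpow (by positivity) hB.le, one_rpow, mul_one, ← rpow_mul hx,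
      mul_div_cancel₀ _ hq.ne'] at h
    have hB' : 0 < B ^ (p / q) := by positivity
    rw [div_le_iff₀ hB'] at h
    refine h.trans (le_of_eq ?_)
    ring
  have hc : Continuous fun α => ‖f α‖ ^ p := hf.norm.rpow_const fun _ => Or.inr hp
  have hc' : Continuous fun α => ‖f α‖ ^ q := hf.norm.rpow_const fun _ => Or.inr hq.le
  calc ∫ α in (0 : ℝ)..1, ‖f α‖ ^ p ≤ ∫ α in (0 : ℝ)..1,
      B ^ (p / q) * (p / q / B * ‖f α‖ ^ q + (1 - p / q)) := by
        refine intervalIntegral.integral_mono_on (by norm_num)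
          (hc.intervalIntegrable _ _)
          (Continuous.intervalIntegrable (by fun_prop) _ _) fun α _ => hpt α
    _ = B ^ (p / q) * (p / q / B * (∫ α in (0 : ℝ)..1, ‖f α‖ ^ q) + (1 - p / q)) := by
        rw [intervalIntegral.integral_const_mul, intervalIntegral.integral_add,
          intervalIntegral.integral_const_mul]
        · simp
        all_goals exact Continuous.intervalIntegrable (by fun_prop) _ _
    _ ≤ B ^ (p / q) * (p / q / B * B + (1 - p / q)) := by
        gcongr
    _ = B ^ (p / q) := by
        field_simp
        ring

/-- The `L^p` norm over a period, as a real number. It is meaningful for `p > 0` and continuous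
`f`. -/
noncomputable def lpNorm (p : ℝ) (f : ℝ → ℂ) : ℝ := (∫ α in (0 : ℝ)..1, ‖f α‖ ^ p) ^ (1 / p)

lemma lpNorm_nonneg (p : ℝ) (f : ℝ → ℂ) : 0 ≤ lpNorm p f :=
  rpow_nonneg (intervalIntegral.integral_nonneg (by norm_num) fun _ _ => by positivity) _

lemma eLpNorm_eq_lpNorm {p : ℝ} (hp : 1 ≤ p) {f : ℝ → ℂ} (hf : Continuous f) :
    eLpNorm f (ENNReal.ofReal p) (volume.restrict (Set.Ioc 0 1)) =
      ENNReal.ofReal (lpNorm p f) := by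
  have hp0 : 0 < p := by linarith
  have hm : MemLp f (ENNReal.ofReal p) (volume.restrict (Set.Ioc (0 : ℝ) 1)) := by
    obtain ⟨C, hC⟩ := isCompact_Icc.exists_bound_of_continuousOn (s := Set.Icc (0 : ℝ) 1)
      hf.continuousOn
    refine MemLp.of_bound hf.aestronglyMeasurable C ?_
    refine (ae_restrict_iff' measurableSet_Ioc).2 (Filter.Eventually.of_forall fun x hx => ?_)
    exact hC x ⟨hx.1.le, hx.2⟩
  rw [hm.eLpNorm_eq_integral_rpow_norm (by simpa using hp0) ENNReal.ofReal_ne_top,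
    ENNReal.toReal_ofReal hp0.le, lpNorm, intervalIntegral.integral_of_le zero_le_one, one_div]

lemma lpNorm_sum_le {ι : Type*} (s : Finset ι) {p : ℝ} (hp : 1 ≤ p) {f : ι → ℝ → ℂ}
    (hf : ∀ i ∈ s, Continuous (f i)) :
    lpNorm p (fun α => ∑ i ∈ s, f i α) ≤ ∑ i ∈ s, lpNorm p (f i) := by
  have h := eLpNorm_sum_le (μ := volume.restrict (Set.Ioc (0 : ℝ) 1)) (s := s) (f := f)
    (p := ENNReal.ofReal p) (fun i hi => (hf i hi).aestronglyMeasurable)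
    (by simpa using hp)
  have hc : Continuous (∑ i ∈ s, f i) := by
    have := continuous_finsetSum s hf
    convert this using 1
    ext; simp
  rw [eLpNorm_eq_lpNorm hp hc, sum_congr rfl fun i hi => eLpNorm_eq_lpNorm hp (hf i hi),
    ← ENNReal.ofReal_sum_of_nonneg fun i _ => lpNorm_nonneg _ _] at h
  rw [ENNReal.ofReal_le_ofReal_iff (sum_nonneg fun i _ => lpNorm_nonneg _ _)] at h
  convert h using 2
  ext; simp

/-! ### Divisors and `k`-free numbers -/

/-- Möbius inversion: the `d` with `d ^ k ∣ n` are the divisors of the largest such `d`, which is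
`Nat.floorRoot k n`. -/
lemma kFreeIndicator_eq_sum {k n X : ℕ} (hk : k ≠ 0) (hn : 1 ≤ n) (hX : n ≤ X) :
    kFreeIndicator k n = ∑ d ∈ Icc 1 X with d ^ k ∣ n, (ArithmeticFunction.moebius d : ℂ) := by
  set m := Nat.floorRoot k n
  have hm : m ≠ 0 := Nat.floorRoot_ne_zero.2 ⟨hk, by omega⟩
  have hset : {d ∈ Icc 1 X | d ^ k ∣ n} = m.divisors := by
    ext d
    simp only [mem_filter, mem_Icc, Nat.mem_divisors, Nat.pow_dvd_iff_dvd_floorRoot]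
    refine ⟨fun h => ⟨h.2, hm⟩, fun h => ⟨⟨Nat.pos_of_dvd_of_pos h.1 (by omega), ?_⟩, h.1⟩⟩
    have h1 : d ^ k ∣ n := Nat.pow_dvd_iff_dvd_floorRoot.2 h.1
    exact (Nat.le_self_pow hk d).trans ((Nat.le_of_dvd (by omega) h1).trans hX)
  have hmu : ∑ d ∈ m.divisors, ArithmeticFunction.moebius d = if m = 1 then 1 else 0 := by
    have := ArithmeticFunction.coe_zeta_mul_apply (f := ArithmeticFunction.moebius) (x := m)
    rw [← this, ArithmeticFunction.coe_zeta_mul_moebius, ArithmeticFunction.one_apply]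
  rw [hset]
  have hc : ∑ d ∈ m.divisors, (ArithmeticFunction.moebius d : ℂ) =
      ((∑ d ∈ m.divisors, ArithmeticFunction.moebius d : ℤ) : ℂ) := by push_cast; rfl
  rw [hc, hmu, kFreeIndicator]
  have hiff : (∃ d : ℕ, 1 < d ∧ d ^ k ∣ n) ↔ m ≠ 1 := by
    constructor
    · rintro ⟨d, hd, hdn⟩ h1
      rw [Nat.pow_dvd_iff_dvd_floorRoot] at hdn
      have : d ∣ 1 := h1 ▸ hdn
      have := Nat.le_of_dvd one_pos this
      omega
    · intro h1
      exact ⟨m, by omega, Nat.floorRoot_pow_dvd⟩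
  by_cases h : m = 1
  · rw [if_neg (by rw [hiff]; simpa using h), if_pos h]
    simp
  · rw [if_pos (by rw [hiff]; exact h), if_neg h]
    simp

lemma pow_dvd_and_pow_dvd_iff {k d e n : ℕ} :
    d ^ k ∣ n ∧ e ^ k ∣ n ↔ Nat.lcm d e ^ k ∣ n := by
  rw [← Nat.pow_lcm_pow, Nat.lcm_dvd_iff]

lemma card_le_of_forall_mem {A : Finset ℕ} {x y : ℝ} (hxy : x ≤ y)
    (hA : ∀ m ∈ A, x ≤ m ∧ (m : ℝ) ≤ y) : (A.card : ℝ) ≤ y - x + 1 := by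
  rcases A.eq_empty_or_nonempty with rfl | hne
  · simp only [card_empty, Nat.cast_zero]
    linarith
  · set a := A.min' hne
    set b := A.max' hne
    have hsub : A ⊆ Icc a b := fun m hm => mem_Icc.2 ⟨A.min'_le m hm, A.le_max' m hm⟩
    have h1 := card_le_card hsub
    rw [Nat.card_Icc] at h1
    have hab : a ≤ b := A.min'_le _ (A.max'_mem hne)
    have h2 : (A.card : ℝ) ≤ ((b + 1 - a : ℕ) : ℝ) := by exact_mod_cast h1
    rw [Nat.cast_sub (by omega)] at h2
    push_cast at h2
    have h3 := (hA a (A.min'_mem hne)).1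
    have h4 := (hA b (A.max'_mem hne)).2
    linarith

lemma card_le_of_forall_mem_pos {A : Finset ℕ} {y : ℝ} (hy : 0 ≤ y)
    (hA : ∀ m ∈ A, 1 ≤ m ∧ (m : ℝ) ≤ y) : (A.card : ℝ) ≤ y := by
  have hsub : A ⊆ Icc 1 ⌊y⌋₊ := fun m hm => mem_Icc.2 ⟨(hA m hm).1, Nat.le_floor (hA m hm).2⟩
  have h1 := card_le_card hsub
  rw [Nat.card_Icc, Nat.add_sub_cancel] at h1
  calc (A.card : ℝ) ≤ (⌊y⌋₊ : ℝ) := by exact_mod_cast h1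
    _ ≤ y := Nat.floor_le hy

lemma card_multiples_le_pos {A : Finset ℕ} {q : ℕ} (hq : 0 < q) (hqA : ∀ m ∈ A, q ∣ m) {y : ℝ}
    (hy : 0 ≤ y) (hA : ∀ m ∈ A, 1 ≤ m ∧ (m : ℝ) ≤ y) : (A.card : ℝ) ≤ y / q := by
  have hq' : (0 : ℝ) < q := by exact_mod_cast hq
  have hcard : (A.image (· / q)).card = A.card := by
    refine card_image_of_injOn fun a ha b hb h => ?_
    obtain ⟨a', rfl⟩ := hqA a ha
    obtain ⟨b', rfl⟩ := hqA b hb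
    simp only [Nat.mul_div_cancel_left _ hq] at h
    rw [h]
  rw [← hcard]
  refine card_le_of_forall_mem_pos (by positivity) fun m hm => ?_
  obtain ⟨a, ha, rfl⟩ := mem_image.1 hm
  have := hA a ha
  refine ⟨Nat.div_pos (Nat.le_of_dvd (by omega) (hqA a ha)) hq, ?_⟩
  rw [Nat.cast_div (hqA a ha) hq'.ne']
  gcongr
  exact this.2

lemma sum_inv_pow_le {k : ℕ} (hk : 2 ≤ k) {D : ℕ} (hD : 1 ≤ D) (X : ℕ) :
    ∑ a ∈ Icc D X, ((a : ℝ) ^ k)⁻¹ ≤ 2 / (D : ℝ) ^ (k - 1) := by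
  obtain ⟨r, rfl⟩ := Nat.exists_eq_add_of_le hk
  have hD' : (0 : ℝ) < D := by exact_mod_cast hD
  have h := sum_Ioo_inv_sq_le (α := ℝ) (D - 1) (X + 1)
  have hs : Ioo (D - 1) (X + 1) = Icc D X := by
    ext a
    simp only [mem_Ioo, mem_Icc]
    omega
  rw [hs, Nat.cast_sub hD] at h
  push_cast at h
  rw [sub_add_cancel] at h
  calc ∑ a ∈ Icc D X, ((a : ℝ) ^ (2 + r))⁻¹
      ≤ ∑ a ∈ Icc D X, ((D : ℝ) ^ r)⁻¹ * ((a : ℝ) ^ 2)⁻¹ := by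
        refine sum_le_sum fun a ha => ?_
        have h1 : (D : ℝ) ≤ a := by exact_mod_cast (mem_Icc.1 ha).1
        have h2 : (0 : ℝ) < a := hD'.trans_le h1
        rw [← mul_inv, pow_add, mul_comm]
        gcongr
    _ = ((D : ℝ) ^ r)⁻¹ * ∑ a ∈ Icc D X, ((a : ℝ) ^ 2)⁻¹ := by rw [mul_sum]
    _ ≤ ((D : ℝ) ^ r)⁻¹ * (2 / D) := by gcongr
    _ = 2 / (D : ℝ) ^ (2 + r - 1) := by
        rw [show 2 + r - 1 = r + 1 by omega, pow_succ]
        field_simp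

lemma sum_inv_pow_two_le {k : ℕ} (hk : 2 ≤ k) (X : ℕ) :
    ∑ a ∈ Icc 2 X, ((a : ℝ) ^ k)⁻¹ ≤ 3 / 4 := by
  have h1 : ∑ a ∈ Icc 2 X, ((a : ℝ) ^ k)⁻¹ ≤ ∑ a ∈ Icc 2 X, ((a : ℝ) ^ 2)⁻¹ := by
    refine sum_le_sum fun a ha => ?_
    have h1 : (1 : ℝ) ≤ a := by
      have := (mem_Icc.1 ha).1
      exact_mod_cast (by omega : 1 ≤ a)
    gcongr
  refine h1.trans ?_
  by_cases hX : 2 ≤ X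
  · have h2 := sum_Ioc_inv_sq_le_sub (α := ℝ) (k := 2) (n := X) (by norm_num) hX
    have h3 : Icc 2 X = insert 2 (Ioc 2 X) := by
      ext a
      simp only [mem_Icc, mem_insert, mem_Ioc]
      omega
    rw [h3, sum_insert (by simp)]
    have : (0 : ℝ) ≤ (X : ℝ)⁻¹ := by positivity
    norm_num at h2 ⊢
    linarith
  · rw [Icc_eq_empty (by omega), sum_empty]
    norm_num

lemma sum_multiples_inv_pow_le {k : ℕ} (hk : 2 ≤ k) {D g : ℕ} (hD : 1 ≤ D) (hg : 1 ≤ g)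
    (X : ℕ) : ∑ d ∈ Icc D X with g ∣ d, ((d : ℝ) ^ k)⁻¹ ≤ 2 / (g : ℝ) ^ k ∧
      ∑ d ∈ Icc D X with g ∣ d, ((d : ℝ) ^ k)⁻¹ ≤ 2 / (g * (D : ℝ) ^ (k - 1)) := by
  obtain ⟨r, rfl⟩ := Nat.exists_eq_add_of_le hk
  have hg' : (0 : ℝ) < g := by exact_mod_cast hg
  have hD' : (0 : ℝ) < D := by exact_mod_cast hD
  set Q := (D + g - 1) / g
  have hQ : 1 ≤ Q := (Nat.one_le_div_iff (by omega)).2 (by omega)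
  have hQD : D ≤ Q * g := by
    have h1 := Nat.div_add_mod (D + g - 1) g
    have h2 := Nat.mod_lt (D + g - 1) (show 0 < g by omega)
    have h3 : g * Q = g * ((D + g - 1) / g) := rfl
    rw [mul_comm Q g]
    omega
  have hQD' : (D : ℝ) ≤ Q * g := by exact_mod_cast hQD
  have hQ' : (1 : ℝ) ≤ Q := by exact_mod_cast hQ
  have hmain : ∑ d ∈ Icc D X with g ∣ d, ((d : ℝ) ^ (2 + r))⁻¹ ≤
      ((g : ℝ) ^ (2 + r))⁻¹ * (2 / (Q : ℝ) ^ (2 + r - 1)) := by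
    calc ∑ d ∈ Icc D X with g ∣ d, ((d : ℝ) ^ (2 + r))⁻¹
        ≤ ∑ d ∈ (Icc Q X).image (g * ·), ((d : ℝ) ^ (2 + r))⁻¹ := by
          refine sum_le_sum_of_subset_of_nonneg ?_ fun _ _ _ => by positivity
          intro d hd
          obtain ⟨hd1, a, rfl⟩ := mem_filter.1 hd
          rw [mem_Icc] at hd1
          refine mem_image.2 ⟨a, mem_Icc.2 ⟨?_, ?_⟩, rfl⟩
          · rw [← Nat.lt_add_one_iff, Nat.div_lt_iff_lt_mul (by omega)]
            have : (a + 1) * g = g * a + g := by ring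
            omega
          · exact (Nat.le_mul_of_pos_left a (by omega)).trans hd1.2
      _ = ∑ a ∈ Icc Q X, (((g * a : ℕ) : ℝ) ^ (2 + r))⁻¹ := by
          rw [sum_image fun a _ b _ h => Nat.eq_of_mul_eq_mul_left (by omega) h]
      _ = ((g : ℝ) ^ (2 + r))⁻¹ * ∑ a ∈ Icc Q X, ((a : ℝ) ^ (2 + r))⁻¹ := by
          rw [mul_sum]
          refine sum_congr rfl fun a _ => ?_
          push_cast
          rw [mul_pow, mul_inv]
      _ ≤ _ := by
          gcongr
          exact sum_inv_pow_le hk hQ X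
  constructor
  · refine hmain.trans ?_
    rw [inv_mul_eq_div]
    gcongr
    exact div_le_self (by norm_num) (one_le_pow₀ hQ')
  · refine hmain.trans ?_
    rw [show 2 + r - 1 = r + 1 by omega, inv_mul_eq_div, div_div]
    refine div_le_div_of_nonneg_left (by norm_num) (by positivity) ?_
    calc (g : ℝ) * (D : ℝ) ^ (r + 1) ≤ g * (Q * g) ^ (r + 1) := by gcongr
      _ = (Q : ℝ) ^ (r + 1) * (g : ℝ) ^ (2 + r) := by ring

/-- The mean square count of divisors: writing `lcm(d, e)⁻ᵏ` as `gcd(d, e)ᵏ (de)⁻ᵏ` and summing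
over common divisors `g` reduces to sums over multiples of `g`. -/
lemma sum_sum_inv_lcm_pow_le {k : ℕ} (hk : 2 ≤ k) {D : ℕ} (hD : 1 ≤ D) (X : ℕ) :
    ∑ d ∈ Icc D X, ∑ e ∈ Icc D X, ((Nat.lcm d e : ℝ) ^ k)⁻¹ ≤ 12 / (D : ℝ) ^ (k - 1) := by
  have hD' : (0 : ℝ) < D := by exact_mod_cast hD
  have hstep : ∑ d ∈ Icc D X, ∑ e ∈ Icc D X, ((Nat.lcm d e : ℝ) ^ k)⁻¹ ≤
      ∑ g ∈ Icc 1 X, (g : ℝ) ^ k * (∑ d ∈ Icc D X with g ∣ d, ((d : ℝ) ^ k)⁻¹) ^ 2 := by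
    calc ∑ d ∈ Icc D X, ∑ e ∈ Icc D X, ((Nat.lcm d e : ℝ) ^ k)⁻¹
        ≤ ∑ d ∈ Icc D X, ∑ e ∈ Icc D X, ∑ g ∈ Icc 1 X,
          (if g ∣ d then ((d : ℝ) ^ k)⁻¹ else 0) * (if g ∣ e then ((e : ℝ) ^ k)⁻¹ else 0) *
            (g : ℝ) ^ k := by
          refine sum_le_sum fun d hd => sum_le_sum fun e he => ?_
          rw [mem_Icc] at hd he
          have hg : Nat.gcd d e ∈ Icc 1 X := mem_Icc.2
            ⟨Nat.gcd_pos_of_pos_left _ (by omega), (Nat.gcd_le_left _ (by omega)).trans hd.2⟩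
          refine le_trans (le_of_eq ?_) (single_le_sum (f := fun g : ℕ =>
            (if g ∣ d then ((d : ℝ) ^ k)⁻¹ else 0) * (if g ∣ e then ((e : ℝ) ^ k)⁻¹ else 0) *
            (g : ℝ) ^ k) (fun g _ => by positivity) hg)
          simp only [Nat.gcd_dvd_left, Nat.gcd_dvd_right, if_true]
          have h1 : (Nat.gcd d e : ℝ) * Nat.lcm d e = d * e := by
            exact_mod_cast Nat.gcd_mul_lcm d e
          have hd0 : (0 : ℝ) < d := by exact_mod_cast (by omega : 0 < d)
          have he0 : (0 : ℝ) < e := by exact_mod_cast (by omega : 0 < e)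
          have hl0 : (0 : ℝ) < Nat.lcm d e := by
            exact_mod_cast Nat.lcm_pos (by omega) (by omega)
          rw [← mul_inv, ← mul_pow, ← h1, mul_pow]
          have hg0 : (0 : ℝ) < Nat.gcd d e := by
            exact_mod_cast Nat.gcd_pos_of_pos_left _ (by omega)
          field_simp
      _ = _ := by
          simp_rw [sum_filter, sq, sum_mul_sum, mul_sum]
          rw [sum_congr rfl fun d _ => sum_comm, sum_comm]
          refine sum_congr rfl fun g _ => sum_congr rfl fun d _ => sum_congr rfl fun e _ => ?_
          ring
  refine hstep.trans ?_
  have hb : ∀ g ∈ Icc 1 X, (g : ℝ) ^ k * (∑ d ∈ Icc D X with g ∣ d, ((d : ℝ) ^ k)⁻¹) ^ 2 ≤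
      (if g ≤ D then 4 / (D : ℝ) ^ k else 0) + (if D ≤ g then 4 * ((g : ℝ) ^ k)⁻¹ else 0) := by
    intro g hg
    have hg1 : 1 ≤ g := (mem_Icc.1 hg).1
    have hg' : (0 : ℝ) < g := by exact_mod_cast hg1
    obtain ⟨h1, h2⟩ := sum_multiples_inv_pow_le hk hD hg1 X
    have h0 : 0 ≤ ∑ d ∈ Icc D X with g ∣ d, ((d : ℝ) ^ k)⁻¹ :=
      sum_nonneg fun _ _ => by positivity
    rcases le_total g D with h | h
    · have h3 : (g : ℝ) ^ k * (∑ d ∈ Icc D X with g ∣ d, ((d : ℝ) ^ k)⁻¹) ^ 2 ≤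
          4 / (D : ℝ) ^ k := by
        calc _ ≤ (g : ℝ) ^ k * (2 / (g * (D : ℝ) ^ (k - 1))) ^ 2 := by gcongr
          _ ≤ 4 / (D : ℝ) ^ k := by
            obtain ⟨r, rfl⟩ := Nat.exists_eq_add_of_le hk
            have hgD : (g : ℝ) ≤ D := by exact_mod_cast h
            rw [show 2 + r - 1 = r + 1 by omega]
            have e1 : (g : ℝ) ^ (2 + r) * (2 / (g * (D : ℝ) ^ (r + 1))) ^ 2 =
                4 * (g : ℝ) ^ r / ((D : ℝ) ^ r * (D : ℝ) ^ (2 + r)) := by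
              field_simp
              ring
            rw [e1, div_le_div_iff₀ (by positivity) (by positivity)]
            have : (g : ℝ) ^ r ≤ (D : ℝ) ^ r := by gcongr
            have h5 : (0 : ℝ) < (D : ℝ) ^ (2 + r) := by positivity
            nlinarith
      rw [if_pos h]
      split_ifs
      · have : (0 : ℝ) ≤ 4 * ((g : ℝ) ^ k)⁻¹ := by positivity
        linarith
      · linarith
    · have h3 : (g : ℝ) ^ k * (∑ d ∈ Icc D X with g ∣ d, ((d : ℝ) ^ k)⁻¹) ^ 2 ≤
          4 * ((g : ℝ) ^ k)⁻¹ := by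
        calc _ ≤ (g : ℝ) ^ k * (2 / (g : ℝ) ^ k) ^ 2 := by gcongr
          _ = 4 * ((g : ℝ) ^ k)⁻¹ := by
            field_simp
            norm_num
      rw [if_pos h]
      split_ifs
      · have : (0 : ℝ) ≤ 4 / (D : ℝ) ^ k := by positivity
        linarith
      · linarith
  refine (sum_le_sum hb).trans ?_
  rw [sum_add_distrib, ← sum_filter, ← sum_filter]
  have h1 : ∑ g ∈ Icc 1 X with g ≤ D, 4 / (D : ℝ) ^ k ≤ 4 / (D : ℝ) ^ (k - 1) := by
    rw [sum_const, nsmul_eq_mul]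
    have hc : #{g ∈ Icc 1 X | g ≤ D} ≤ D := by
      have : {g ∈ Icc 1 X | g ≤ D} ⊆ Icc 1 D := by
        intro g hg
        simp only [mem_filter, mem_Icc] at hg ⊢
        omega
      simpa using card_le_card this
    have hc' : (#{g ∈ Icc 1 X | g ≤ D} : ℝ) ≤ D := by exact_mod_cast hc
    calc _ ≤ (D : ℝ) * (4 / (D : ℝ) ^ k) := by gcongr
      _ = 4 / (D : ℝ) ^ (k - 1) := by
        obtain ⟨r, rfl⟩ := Nat.exists_eq_add_of_le hk
        rw [show 2 + r - 1 = r + 1 by omega]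
        field_simp
        ring
  have h2 : ∑ g ∈ Icc 1 X with D ≤ g, 4 * ((g : ℝ) ^ k)⁻¹ ≤ 8 / (D : ℝ) ^ (k - 1) := by
    have hs : {g ∈ Icc 1 X | D ≤ g} = Icc D X := by
      ext g
      simp only [mem_filter, mem_Icc]
      omega
    rw [hs, ← mul_sum]
    calc _ ≤ 4 * (2 / (D : ℝ) ^ (k - 1)) := by
          gcongr
          exact sum_inv_pow_le hk hD X
      _ = _ := by ring
  calc _ ≤ 4 / (D : ℝ) ^ (k - 1) + 8 / (D : ℝ) ^ (k - 1) := add_le_add h1 h2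
    _ = _ := by ring

lemma sum_inv_le_one_add_log (X : ℕ) : ∑ g ∈ Icc 1 X, ((g : ℝ))⁻¹ ≤ 1 + Real.log X := by
  have h := harmonic_le_one_add_log X
  rw [harmonic_eq_sum_Icc] at h
  push_cast at h
  exact h

lemma sum_sum_inv_lcm_le {D : ℕ} (hD : 1 ≤ D) :
    ∑ d ∈ Ico D (2 * D), ∑ e ∈ Ico D (2 * D), ((Nat.lcm d e : ℝ))⁻¹ ≤
      4 * (1 + Real.log (2 * D)) := by
  have hD' : (0 : ℝ) < D := by exact_mod_cast hD
  have hstep : ∑ d ∈ Ico D (2 * D), ∑ e ∈ Ico D (2 * D), ((Nat.lcm d e : ℝ))⁻¹ ≤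
      ∑ g ∈ Icc 1 (2 * D), (g : ℝ) / (D : ℝ) ^ 2 * (#{d ∈ Ico D (2 * D) | g ∣ d} : ℝ) ^ 2 := by
    calc ∑ d ∈ Ico D (2 * D), ∑ e ∈ Ico D (2 * D), ((Nat.lcm d e : ℝ))⁻¹
        ≤ ∑ d ∈ Ico D (2 * D), ∑ e ∈ Ico D (2 * D), ∑ g ∈ Icc 1 (2 * D),
          (if g ∣ d then (1 : ℝ) else 0) * (if g ∣ e then (1 : ℝ) else 0) *
            ((g : ℝ) / (D : ℝ) ^ 2) := by
          refine sum_le_sum fun d hd => sum_le_sum fun e he => ?_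
          rw [mem_Ico] at hd he
          have hg : Nat.gcd d e ∈ Icc 1 (2 * D) := mem_Icc.2
            ⟨Nat.gcd_pos_of_pos_left _ (by omega),
              (Nat.gcd_le_left _ (by omega)).trans hd.2.le⟩
          refine le_trans ?_ (single_le_sum (f := fun g : ℕ =>
            (if g ∣ d then (1 : ℝ) else 0) * (if g ∣ e then (1 : ℝ) else 0) *
            ((g : ℝ) / (D : ℝ) ^ 2)) (fun g _ => by positivity) hg)
          simp only [Nat.gcd_dvd_left, Nat.gcd_dvd_right, if_true, one_mul]
          have h1 : (Nat.gcd d e : ℝ) * Nat.lcm d e = d * e := by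
            exact_mod_cast Nat.gcd_mul_lcm d e
          have hd0 : (D : ℝ) ≤ d := by exact_mod_cast hd.1
          have he0 : (D : ℝ) ≤ e := by exact_mod_cast he.1
          have hl0 : (0 : ℝ) < Nat.lcm d e := by
            exact_mod_cast Nat.lcm_pos (by omega) (by omega)
          rw [le_div_iff₀ (by positivity), inv_mul_le_iff₀ hl0, mul_comm, h1, sq]
          gcongr
      _ = _ := by
          simp_rw [← sum_boole, sq, sum_mul_sum, mul_sum]
          rw [sum_congr rfl fun d _ => sum_comm, sum_comm]
          refine sum_congr rfl fun g _ => sum_congr rfl fun d _ => sum_congr rfl fun e _ => ?_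
          ring
  refine hstep.trans ?_
  have hb : ∀ g ∈ Icc 1 (2 * D), (g : ℝ) / (D : ℝ) ^ 2 *
      (#{d ∈ Ico D (2 * D) | g ∣ d} : ℝ) ^ 2 ≤ 4 * (g : ℝ)⁻¹ := by
    intro g hg
    have hg1 : 1 ≤ g := (mem_Icc.1 hg).1
    have hg' : (0 : ℝ) < g := by exact_mod_cast hg1
    have hc : (#{d ∈ Ico D (2 * D) | g ∣ d} : ℝ) ≤ (2 * D) / g := by
      refine card_multiples_le_pos hg1 (fun m hm => (mem_filter.1 hm).2) (by positivity) ?_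
      intro m hm
      have := mem_Ico.1 (mem_filter.1 hm).1
      exact ⟨by omega, by exact_mod_cast this.2.le⟩
    calc _ ≤ (g : ℝ) / (D : ℝ) ^ 2 * ((2 * D) / g) ^ 2 := by gcongr
      _ = 4 * (g : ℝ)⁻¹ := by
        field_simp
        norm_num
  refine (sum_le_sum hb).trans ?_
  rw [← mul_sum]
  have := sum_inv_le_one_add_log (2 * D)
  push_cast at this
  gcongr

/-- Few pairs in a dyadic block have a least common multiple that is small. -/
lemma card_pairs_lcm_pow_le {k D N : ℕ} (hk : 2 ≤ k) (hD : 1 ≤ D) :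
    (#{x ∈ Ico D (2 * D) ×ˢ Ico D (2 * D) | Nat.lcm x.1 x.2 ^ k ≤ N} : ℝ) ≤
      (N : ℝ) ^ (1 / (k : ℝ)) * (4 * (1 + Real.log (2 * D))) := by
  have hk0 : (k : ℝ) ≠ 0 := by
    have : k ≠ 0 := by omega
    exact_mod_cast this
  calc (#{x ∈ Ico D (2 * D) ×ˢ Ico D (2 * D) | Nat.lcm x.1 x.2 ^ k ≤ N} : ℝ)
      = ∑ x ∈ Ico D (2 * D) ×ˢ Ico D (2 * D) with Nat.lcm x.1 x.2 ^ k ≤ N, (1 : ℝ) := by simp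
    _ ≤ ∑ x ∈ Ico D (2 * D) ×ˢ Ico D (2 * D) with Nat.lcm x.1 x.2 ^ k ≤ N,
          (N : ℝ) ^ (1 / (k : ℝ)) * (Nat.lcm x.1 x.2 : ℝ)⁻¹ := by
        refine sum_le_sum fun x hx => ?_
        obtain ⟨h1, h2⟩ := mem_filter.1 hx
        rw [mem_product, mem_Ico, mem_Ico] at h1
        have hl0 : (0 : ℝ) < Nat.lcm x.1 x.2 := by
          exact_mod_cast Nat.lcm_pos (by omega) (by omega)
        rw [← div_eq_mul_inv, le_div_iff₀ hl0, one_mul]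
        have h3 : ((Nat.lcm x.1 x.2 : ℝ)) ^ (k : ℝ) ≤ N := by
          rw [rpow_natCast]
          exact_mod_cast h2
        calc (Nat.lcm x.1 x.2 : ℝ) = ((Nat.lcm x.1 x.2 : ℝ) ^ (k : ℝ)) ^ (1 / (k : ℝ)) := by
              rw [← rpow_mul hl0.le, mul_one_div_cancel hk0, rpow_one]
          _ ≤ _ := by gcongr
    _ ≤ ∑ x ∈ Ico D (2 * D) ×ˢ Ico D (2 * D),
          (N : ℝ) ^ (1 / (k : ℝ)) * (Nat.lcm x.1 x.2 : ℝ)⁻¹ :=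
        sum_le_sum_of_subset_of_nonneg (filter_subset _ _) fun _ _ _ => by positivity
    _ = (N : ℝ) ^ (1 / (k : ℝ)) *
          ∑ d ∈ Ico D (2 * D), ∑ e ∈ Ico D (2 * D), ((Nat.lcm d e : ℝ))⁻¹ := by
        rw [← mul_sum, sum_product]
    _ ≤ _ := by
        gcongr
        exact sum_sum_inv_lcm_le hD

open scoped Classical in
/-- At least a quarter of the integers up to `N` are `k`-free. -/
lemma card_kFree_ge {k : ℕ} (hk : 2 ≤ k) (N : ℕ) :
    (N : ℝ) / 4 ≤ #{n ∈ Icc 1 N | ∀ d, 1 < d → ¬ d ^ k ∣ n} := by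
  have hk0 : k ≠ 0 := by omega
  set G := {n ∈ Icc 1 N | ∀ d, 1 < d → ¬ d ^ k ∣ n}
  have hcover : Icc 1 N ⊆ G ∪ (Icc 2 N).biUnion fun e => {n ∈ Icc 1 N | e ^ k ∣ n} := by
    intro n hn
    by_cases h : ∀ d, 1 < d → ¬ d ^ k ∣ n
    · exact mem_union_left _ (mem_filter.2 ⟨hn, h⟩)
    · push Not at h
      obtain ⟨d, hd, hdn⟩ := h
      rw [mem_Icc] at hn
      refine mem_union_right _ (mem_biUnion.2 ⟨d, mem_Icc.2 ⟨hd, ?_⟩,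
        mem_filter.2 ⟨mem_Icc.2 hn, hdn⟩⟩)
      exact (Nat.le_self_pow hk0 d).trans ((Nat.le_of_dvd (by omega) hdn).trans hn.2)
  have h1 := (card_le_card hcover).trans ((card_union_le _ _).trans
    (Nat.add_le_add_left card_biUnion_le _))
  rw [Nat.card_Icc, Nat.add_sub_cancel] at h1
  have h2 : (N : ℝ) ≤ #G + ∑ e ∈ Icc 2 N, (#{n ∈ Icc 1 N | e ^ k ∣ n} : ℝ) := by
    exact_mod_cast h1
  have h3 : ∑ e ∈ Icc 2 N, (#{n ∈ Icc 1 N | e ^ k ∣ n} : ℝ) ≤ N * (3 / 4) := by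
    calc _ ≤ ∑ e ∈ Icc 2 N, (N : ℝ) * ((e : ℝ) ^ k)⁻¹ := by
          refine sum_le_sum fun e he => ?_
          have he1 := (mem_Icc.1 he).1
          have := card_multiples_le_pos (A := {n ∈ Icc 1 N | e ^ k ∣ n}) (q := e ^ k) (y := N)
            (pow_pos (by omega) k) (fun m hm => (mem_filter.1 hm).2) (by positivity)
            (fun m hm => by
              have := mem_Icc.1 (mem_filter.1 hm).1
              exact ⟨this.1, by exact_mod_cast this.2⟩)
          push_cast at this
          rwa [div_eq_mul_inv] at this
      _ = N * ∑ e ∈ Icc 2 N, ((e : ℝ) ^ k)⁻¹ := by rw [mul_sum]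
      _ ≤ _ := by
          gcongr
          exact sum_inv_pow_two_le hk N
  linarith

/-- At least a quarter of the residues `a` modulo `d ^ k` are such that every `e ∣ d` with
`e ^ k ∣ a` is `1`. -/
lemma card_kFree_residues_ge {k : ℕ} (hk : 2 ≤ k) {d : ℕ} (hd : 1 ≤ d) :
    (d : ℝ) ^ k / 4 ≤ #{a ∈ range (d ^ k) | ∀ e ∈ d.divisors, 1 < e → ¬ e ^ k ∣ a} := by
  classical
  have hk0 : k ≠ 0 := by omega
  set G := {a ∈ range (d ^ k) | ∀ e ∈ d.divisors, 1 < e → ¬ e ^ k ∣ a}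
  have hcover : range (d ^ k) ⊆
      G ∪ {e ∈ Icc 2 d | e ∣ d}.biUnion fun e => {n ∈ range (d ^ k) | e ^ k ∣ n} := by
    intro n hn
    by_cases h : ∀ e ∈ d.divisors, 1 < e → ¬ e ^ k ∣ n
    · exact mem_union_left _ (mem_filter.2 ⟨hn, h⟩)
    · push Not at h
      obtain ⟨e, hed, he, hen⟩ := h
      refine mem_union_right _ (mem_biUnion.2 ⟨e, mem_filter.2 ⟨mem_Icc.2 ⟨he, ?_⟩,
        Nat.dvd_of_mem_divisors hed⟩, mem_filter.2 ⟨hn, hen⟩⟩)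
      exact Nat.divisor_le hed
  have h1 := (card_le_card hcover).trans ((card_union_le _ _).trans
    (Nat.add_le_add_left card_biUnion_le _))
  rw [card_range] at h1
  have h2 : (d : ℝ) ^ k ≤
      #G + ∑ e ∈ Icc 2 d with e ∣ d, (#{n ∈ range (d ^ k) | e ^ k ∣ n} : ℝ) := by
    exact_mod_cast h1
  have h3 : ∑ e ∈ Icc 2 d with e ∣ d, (#{n ∈ range (d ^ k) | e ^ k ∣ n} : ℝ) ≤
      (d : ℝ) ^ k * (3 / 4) := by
    calc _ ≤ ∑ e ∈ Icc 2 d with e ∣ d, (d : ℝ) ^ k * ((e : ℝ) ^ k)⁻¹ := by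
          refine sum_le_sum fun e he => ?_
          obtain ⟨he1, hed⟩ := mem_filter.1 he
          rw [mem_Icc] at he1
          have hsub : {n ∈ range (d ^ k) | e ^ k ∣ n} ⊆
              (range ((d / e) ^ k)).image (e ^ k * ·) := by
            intro n hn
            obtain ⟨hn1, a, rfl⟩ := mem_filter.1 hn
            refine mem_image.2 ⟨a, ?_, rfl⟩
            rw [mem_range] at hn1 ⊢
            have : d ^ k = e ^ k * (d / e) ^ k := by rw [← mul_pow, Nat.mul_div_cancel' hed]
            rw [this] at hn1
            exact Nat.lt_of_mul_lt_mul_left hn1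
          have hc := (card_le_card hsub).trans card_image_le
          rw [card_range] at hc
          have he0 : (e : ℝ) ≠ 0 := by
            have : e ≠ 0 := by omega
            exact_mod_cast this
          calc (#{n ∈ range (d ^ k) | e ^ k ∣ n} : ℝ) ≤ (((d / e) ^ k : ℕ) : ℝ) := by
                exact_mod_cast hc
            _ = (d : ℝ) ^ k * ((e : ℝ) ^ k)⁻¹ := by
                push_cast
                rw [Nat.cast_div hed he0, div_pow, div_eq_mul_inv]
      _ ≤ ∑ e ∈ Icc 2 d, (d : ℝ) ^ k * ((e : ℝ) ^ k)⁻¹ :=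
          sum_le_sum_of_subset_of_nonneg (filter_subset _ _) fun _ _ _ => by positivity
      _ = (d : ℝ) ^ k * ∑ e ∈ Icc 2 d, ((e : ℝ) ^ k)⁻¹ := by rw [mul_sum]
      _ ≤ _ := by
          gcongr
          exact sum_inv_pow_two_le hk d
  linarith

/-- For a numerator `a` that is not divisible by any `e ^ k` with `1 < e ∣ d`, the fraction
`a δ ^ k / d ^ k` is an integer only if `d ∣ δ`. -/
lemma dvd_of_pow_dvd_mul_pow {k d δ a : ℕ} (hd : 1 ≤ d)
    (ha : ∀ e ∈ d.divisors, 1 < e → ¬ e ^ k ∣ a) (h : d ^ k ∣ a * δ ^ k) : d ∣ δ := by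
  have hg : 0 < Nat.gcd d δ := Nat.gcd_pos_of_pos_left _ hd
  obtain ⟨g, e, f, hg0, hcop, he, hf⟩ := Nat.exists_coprime' hg
  rw [he, hf, mul_pow, mul_pow, ← mul_assoc] at h
  have h1 : e ^ k ∣ a * f ^ k := Nat.dvd_of_mul_dvd_mul_right (pow_pos hg0 k) h
  have h2 : e ^ k ∣ a := (Nat.Coprime.pow k k hcop).dvd_of_dvd_mul_right h1
  have h3 : e ∈ d.divisors := Nat.mem_divisors.2 ⟨⟨g, he⟩, by omega⟩
  have h4 : ¬ 1 < e := fun h5 => ha e h3 h5 h2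
  have h5 : e ≠ 0 := by
    rintro rfl
    omega
  have h6 : e = 1 := by omega
  rw [he, hf, h6, one_mul]
  exact dvd_mul_left g f

/-! ### Decomposition of the interval into smooth pieces -/

/-- The trapezoid function on `[0, L]` with sides of width `h`. -/
noncomputable def trapezoid (L h x : ℝ) : ℝ := max 0 (min 1 (min (x / h) ((L - x) / h)))

/-- `w` is a bump at scale `h` near the ends of `(0, L)`: it is bounded by `1`, is Lipschitz with
a constant of order `1 / h`, and vanishes outside `(0, h] ∪ [L - h, L)`. -/
structure IsBump (w : ℝ → ℝ) (L h : ℝ) : Prop where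
  abs_le_one : ∀ x, |w x| ≤ 1
  lipschitz : ∀ x y, |w x - w y| ≤ 3 / h * |x - y|
  supp : ∀ x, w x ≠ 0 → 0 < x ∧ x < L ∧ (x ≤ h ∨ L - h ≤ x)

lemma trapezoid_nonneg (L h x : ℝ) : 0 ≤ trapezoid L h x := le_max_left _ _

lemma trapezoid_le_one (L h x : ℝ) : trapezoid L h x ≤ 1 :=
  max_le zero_le_one (min_le_left _ _)

lemma trapezoid_lipschitz (L : ℝ) {h : ℝ} (hh : 0 < h) (x y : ℝ) :
    |trapezoid L h x - trapezoid L h y| ≤ 1 / h * |x - y| := by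
  have e1 : |x / h - y / h| = 1 / h * |x - y| := by
    rw [← sub_div, abs_div, abs_of_pos hh]
    ring
  have e2 : |(L - x) / h - (L - y) / h| = 1 / h * |x - y| := by
    rw [← sub_div, abs_div, abs_of_pos hh, sub_sub_sub_cancel_left, abs_sub_comm]
    ring
  unfold trapezoid
  refine (abs_max_sub_max_le_max _ _ _ _).trans (max_le (by simp; positivity) ?_)
  refine (abs_min_sub_min_le_max _ _ _ _).trans (max_le (by simp; positivity) ?_)
  exact (abs_min_sub_min_le_max _ _ _ _).trans (max_le e1.le e2.le)

lemma trapezoid_eq_zero {L h x : ℝ} (hh : 0 < h) (hx : x ≤ 0 ∨ L ≤ x) : trapezoid L h x = 0 := by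
  refine max_eq_left ((min_le_right _ _).trans ?_)
  rcases hx with hx | hx
  · exact (min_le_left _ _).trans (div_nonpos_of_nonpos_of_nonneg hx hh.le)
  · exact (min_le_right _ _).trans (div_nonpos_of_nonpos_of_nonneg (by linarith) hh.le)

lemma trapezoid_eq_one {L h x : ℝ} (hh : 0 < h) (h1 : h ≤ x) (h2 : x ≤ L - h) :
    trapezoid L h x = 1 := by
  have e1 : 1 ≤ x / h := (one_le_div hh).2 h1
  have e2 : 1 ≤ (L - x) / h := (one_le_div hh).2 (by linarith)
  unfold trapezoid
  rw [min_eq_left (le_min e1 e2), max_eq_right zero_le_one]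

/-- The `i`-th piece of the decomposition of the interval `(0, L)`: a trapezoid filling the middle
for `i = 0`, and otherwise the difference of two consecutive trapezoids, which lives at distance
about `L / 2 ^ i` from the end points. -/
noncomputable def endPiece (L : ℝ) : ℕ → ℝ → ℝ
  | 0, x => trapezoid L (L / 2) x
  | i + 1, x => trapezoid L (L / 2 ^ (i + 2)) x - trapezoid L (L / 2 ^ (i + 1)) x

lemma sum_endPiece (L : ℝ) (I : ℕ) (x : ℝ) :
    ∑ i ∈ range (I + 1), endPiece L i x = trapezoid L (L / 2 ^ (I + 1)) x := by
  induction I with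
  | zero => simp [endPiece]
  | succ I ih =>
    rw [sum_range_succ, ih, endPiece]
    ring

lemma isBump_endPiece {L : ℝ} (hL : 0 < L) (i : ℕ) : IsBump (endPiece L i) L (L / 2 ^ i) := by
  cases i with
  | zero =>
    refine ⟨fun x => ?_, fun x y => ?_, fun x hx => ?_⟩
    · rw [endPiece, abs_of_nonneg (trapezoid_nonneg _ _ _)]
      exact trapezoid_le_one _ _ _
    · refine (trapezoid_lipschitz L (half_pos hL) x y).trans ?_
      gcongr ?_ * _
      rw [pow_zero, div_le_div_iff₀ (by positivity) (by positivity)]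
      linarith
    · have : ¬ (x ≤ 0 ∨ L ≤ x) := fun h => hx (trapezoid_eq_zero (half_pos hL) h)
      push Not at this
      refine ⟨this.1, this.2, Or.inl ?_⟩
      simpa using this.2.le
  | succ i =>
    set h := L / 2 ^ (i + 1) with hh
    have hh0 : 0 < h := by positivity
    have hh2 : L / 2 ^ (i + 2) = h / 2 := by rw [hh, pow_succ 2 (i + 1), div_div]
    refine ⟨fun x => ?_, fun x y => ?_, fun x hx => ?_⟩
    · rw [endPiece]
      exact abs_sub_le_of_nonneg_of_le (trapezoid_nonneg _ _ _) (trapezoid_le_one _ _ _)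
        (trapezoid_nonneg _ _ _) (trapezoid_le_one _ _ _)
    · rw [endPiece, endPiece, hh2]
      have h1 := trapezoid_lipschitz L (half_pos hh0) x y
      have h2 := trapezoid_lipschitz L hh0 x y
      rw [sub_sub_sub_comm]
      refine (abs_sub _ _).trans ((add_le_add h1 h2).trans (le_of_eq ?_))
      field_simp
      norm_num
    · rw [endPiece, hh2] at hx
      have h1 : ¬ (x ≤ 0 ∨ L ≤ x) := fun h => hx (by
        rw [trapezoid_eq_zero (half_pos hh0) h, trapezoid_eq_zero hh0 h, sub_zero])
      push Not at h1
      refine ⟨h1.1, h1.2, ?_⟩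
      by_contra h2
      push Not at h2
      exact hx (by
        rw [trapezoid_eq_one (half_pos hh0) (by linarith) (by linarith),
          trapezoid_eq_one hh0 h2.1.le h2.2.le, sub_self])

/-- A bump has at most `2 h / s + 1` multiples of `s` in its support: one of the two end zones
is half-open at `0`, which saves the other `+ 1`. -/
lemma IsBump.card_le {w : ℝ → ℝ} {L h : ℝ} (hw : IsBump w L h) (hh : 0 < h) (n : ℕ)
    {s : ℕ} (hs : 0 < s) : (#{m ∈ range n | w ((s * m : ℕ) : ℝ) ≠ 0} : ℝ) ≤ 2 * (h / s) + 1 := by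
  have hs' : (0 : ℝ) < s := by exact_mod_cast hs
  set A := {m ∈ range n | w ((s * m : ℕ) : ℝ) ≠ 0}
  have hsub : A ⊆ {m ∈ A | ((s * m : ℕ) : ℝ) ≤ h} ∪ {m ∈ A | L - h ≤ ((s * m : ℕ) : ℝ)} := by
    intro m hm
    rcases (hw.supp _ (mem_filter.1 hm).2).2.2 with h1 | h1
    · exact mem_union_left _ (mem_filter.2 ⟨hm, h1⟩)
    · exact mem_union_right _ (mem_filter.2 ⟨hm, h1⟩)
  have h1 : (#A : ℝ) ≤ #{m ∈ A | ((s * m : ℕ) : ℝ) ≤ h} +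
      #{m ∈ A | L - h ≤ ((s * m : ℕ) : ℝ)} := by
    exact_mod_cast (card_le_card hsub).trans (card_union_le _ _)
  have h2 : (#{m ∈ A | ((s * m : ℕ) : ℝ) ≤ h} : ℝ) ≤ h / s := by
    refine card_le_of_forall_mem_pos (by positivity) fun m hm => ?_
    obtain ⟨hm1, hm2⟩ := mem_filter.1 hm
    have h3 := (hw.supp _ (mem_filter.1 hm1).2).1
    refine ⟨?_, ?_⟩
    · rcases Nat.eq_zero_or_pos m with rfl | h4
      · simp at h3
      · exact h4
    · rw [le_div_iff₀ hs', mul_comm]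
      exact_mod_cast hm2
  have h3 : (#{m ∈ A | L - h ≤ ((s * m : ℕ) : ℝ)} : ℝ) ≤ L / s - (L - h) / s + 1 := by
    refine card_le_of_forall_mem (by gcongr; linarith) fun m hm => ?_
    obtain ⟨hm1, hm2⟩ := mem_filter.1 hm
    have h3 := (hw.supp _ (mem_filter.1 hm1).2).2.1
    push_cast at hm2 h3
    rw [div_le_iff₀ hs', le_div_iff₀ hs', mul_comm (m : ℝ)]
    exact ⟨hm2, h3.le⟩
  have h4 : L / s - (L - h) / s = h / s := by ring
  linarith

/-- The `L¹` norm of a bump sampled at the multiples of `s` is bounded by an absolute constant. -/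
lemma IsBump.integral_norm_le {w : ℝ → ℝ} {h : ℝ} {N : ℕ} (hw : IsBump w (N + 1) h) (hh : 0 < h)
    {s : ℕ} (hs : 0 < s) :
    ∫ α in (0 : ℝ)..1, ‖trigPoly (range (N + 1)) (fun m => (w ((s * m : ℕ) : ℝ) : ℂ)) α‖ ≤ 58 := by
  have hs' : (0 : ℝ) < s := by exact_mod_cast hs
  -- the number of samples in the support, and the inverse of the size of their differences
  set K := max (h / s) 1
  have hK1 : 1 ≤ K := le_max_right _ _
  have hK : 0 < K := by linarith
  set a : ℕ → ℂ := fun m => (w ((s * m : ℕ) : ℝ) : ℂ)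
  have ha1 : ∀ m, ‖a m‖ ≤ 1 := fun m => by
    rw [Complex.norm_real]
    exact hw.abs_le_one _
  have h0 : a 0 = 0 := by
    simp only [a, mul_zero, Nat.cast_zero, Complex.ofReal_eq_zero]
    by_contra h1
    exact lt_irrefl _ (hw.supp _ h1).1
  have hn : ∀ m, N + 1 ≤ m → a m = 0 := by
    intro m hm
    simp only [a, Complex.ofReal_eq_zero]
    by_contra h1
    have h2 := (hw.supp _ h1).2.1
    have h3 : s * m < N + 1 := by exact_mod_cast h2
    have : m ≤ s * m := Nat.le_mul_of_pos_left m hs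
    omega
  have hiff : ∀ m, a m ≠ 0 ↔ w ((s * m : ℕ) : ℝ) ≠ 0 := fun m => by simp [a]
  have hcard : ∀ n, (#{m ∈ range n | a m ≠ 0} : ℝ) ≤ 3 * K := by
    intro n
    have := hw.card_le hh n hs
    simp_rw [hiff]
    have h1 : h / s ≤ K := le_max_left _ _
    linarith
  have hA : ∑ m ∈ range (N + 1), ‖a m‖ ^ 2 ≤ 3 * K := by
    calc ∑ m ∈ range (N + 1), ‖a m‖ ^ 2
        ≤ ∑ m ∈ range (N + 1), if a m ≠ 0 then (1 : ℝ) else 0 := by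
          refine sum_le_sum fun m _ => ?_
          split_ifs with h
          · exact pow_le_one₀ (norm_nonneg _) (ha1 m)
          · simp only [ne_eq, not_not] at h
            simp [h]
      _ ≤ 3 * K := by
          rw [sum_boole]
          exact hcard _
  have hd : ∀ m, ‖a m - a (m - 1)‖ ≤ 3 / K := by
    intro m
    rcases le_total (h / s) 1 with h1 | h1
    · have : K = 1 := max_eq_right h1
      rw [this]
      refine (norm_sub_le _ _).trans ?_
      linarith [ha1 m, ha1 (m - 1)]
    · have hKe : K = h / s := max_eq_left h1
      rw [hKe, ← Complex.ofReal_sub, Complex.norm_real]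
      refine (hw.lipschitz _ _).trans ?_
      have : |((s * m : ℕ) : ℝ) - ((s * (m - 1) : ℕ) : ℝ)| ≤ s := by
        rcases Nat.eq_zero_or_pos m with rfl | hm
        · simp
        · push_cast [Nat.cast_sub hm]
          rw [show (s : ℝ) * m - s * (m - 1) = s by ring, abs_of_pos hs']
      calc 3 / h * |((s * m : ℕ) : ℝ) - ((s * (m - 1) : ℕ) : ℝ)| ≤ 3 / h * s := by gcongr
        _ = 3 / (h / s) := by field_simp
  have hB : ∑ m ∈ range (N + 1 + 1), ‖a m - a (m - 1)‖ ^ 2 ≤ 54 / K := by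
    calc ∑ m ∈ range (N + 1 + 1), ‖a m - a (m - 1)‖ ^ 2
        ≤ ∑ m ∈ range (N + 1 + 1), ((if a m ≠ 0 then (9 / K ^ 2 : ℝ) else 0) +
          if a (m - 1) ≠ 0 then (9 / K ^ 2 : ℝ) else 0) := by
          refine sum_le_sum fun m _ => ?_
          have h9 : ‖a m - a (m - 1)‖ ^ 2 ≤ 9 / K ^ 2 := by
            calc _ ≤ (3 / K) ^ 2 := by gcongr; exact hd m
              _ = _ := by rw [div_pow]; norm_num
          have h90 : 0 ≤ 9 / K ^ 2 := by positivity
          by_cases e1 : a m = 0 <;> by_cases e2 : a (m - 1) = 0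
          · simp [e1, e2]
          · rw [if_pos e2]; simp only [e1, ne_eq, not_true_eq_false, if_false, zero_add]
            simpa [e1] using h9
          · rw [if_pos e1]; simp only [e2, ne_eq, not_true_eq_false, if_false, add_zero]
            simpa [e2] using h9
          · rw [if_pos e1, if_pos e2]
            linarith
      _ = (9 / K ^ 2) * #{m ∈ range (N + 1 + 1) | a m ≠ 0} +
          (9 / K ^ 2) * #{m ∈ range (N + 1) | a m ≠ 0} := by
          rw [sum_add_distrib,
            sum_range_succ' (fun m => if a (m - 1) ≠ 0 then (9 / K ^ 2 : ℝ) else 0)]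
          simp only [Nat.add_sub_cancel, Nat.zero_sub, h0, ne_eq, not_true_eq_false, if_false,
            add_zero]
          rw [← sum_filter, ← sum_filter, sum_const, sum_const, nsmul_eq_mul, nsmul_eq_mul]
          ring
      _ ≤ (9 / K ^ 2) * (3 * K) + (9 / K ^ 2) * (3 * K) := by
          gcongr
          · exact hcard _
          · exact hcard _
      _ = 54 / K := by
          field_simp
          norm_num
  have := integral_norm_trigPoly_le h0 (hn _ le_rfl) hK hA hB
  linarith

/-! ### Mean values of the sums over powers of moduli -/

/-- The part of the exponential sum with weight `w` that comes from the `k`-th powers of the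
elements of `𝒟`. -/
noncomputable def powerSum (k N : ℕ) (w : ℝ → ℝ) (𝒟 : Finset ℕ) : ℝ → ℂ :=
  trigPoly (Icc 1 N) fun n =>
    (w n : ℂ) * ∑ d ∈ 𝒟 with d ^ k ∣ n, (ArithmeticFunction.moebius d : ℂ)

lemma norm_moebius_le (d : ℕ) : ‖(ArithmeticFunction.moebius d : ℂ)‖ ≤ 1 := by
  have := ArithmeticFunction.abs_moebius_le_one (n := d)
  rw [Complex.norm_intCast]
  exact_mod_cast this

@[fun_prop] lemma continuous_powerSum (k N : ℕ) (w : ℝ → ℝ) (𝒟 : Finset ℕ) :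
    Continuous (powerSum k N w 𝒟) := continuous_trigPoly _ _

lemma powerSum_eq {k N : ℕ} (w : ℝ → ℝ) (𝒟 : Finset ℕ) (α : ℝ) :
    powerSum k N w 𝒟 α = ∑ d ∈ 𝒟, (ArithmeticFunction.moebius d : ℂ) *
      ∑ n ∈ Icc 1 N with d ^ k ∣ n, (w n : ℂ) * expTwoPiI (α * n) := by
  simp only [powerSum, trigPoly, sum_filter, mul_sum, sum_mul]
  rw [sum_comm]
  refine sum_congr rfl fun d _ => sum_congr rfl fun n _ => ?_
  split_ifs <;> ring

lemma sum_multiples_eq {N s : ℕ} (hs : 0 < s) (f : ℕ → ℂ) (h0 : f 0 = 0)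
    (hN : ∀ n, N < n → f n = 0) :
    ∑ n ∈ Icc 1 N with s ∣ n, f n = ∑ m ∈ range (N + 1), f (s * m) := by
  have hinj : Set.InjOn (s * ·) (range (N + 1) : Set ℕ) :=
    fun a _ b _ h => Nat.eq_of_mul_eq_mul_left hs h
  rw [← sum_image (f := f) (g := (s * ·)) hinj]
  refine sum_subset_zero_on_sdiff ?_ ?_ fun _ _ => rfl
  · intro n hn
    obtain ⟨h1, m, rfl⟩ := mem_filter.1 hn
    rw [mem_Icc] at h1
    refine mem_image.2 ⟨m, mem_range.2 ?_, rfl⟩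
    have : m ≤ s * m := Nat.le_mul_of_pos_left m hs
    omega
  · intro n hn
    obtain ⟨h1, h2⟩ := mem_sdiff.1 hn
    obtain ⟨m, hm, rfl⟩ := mem_image.1 h1
    rcases Nat.eq_zero_or_pos (s * m) with h3 | h3
    · rw [h3, h0]
    · refine hN _ ?_
      by_contra h4
      exact h2 (mem_filter.2 ⟨mem_Icc.2 ⟨h3, by omega⟩, dvd_mul_right _ _⟩)

lemma IsBump.integral_norm_powerSum_le {w : ℝ → ℝ} {h : ℝ} {k N : ℕ} (hw : IsBump w (N + 1) h)
    (hh : 0 < h) {𝒟 : Finset ℕ} (h𝒟 : ∀ d ∈ 𝒟, 0 < d) :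
    ∫ α in (0 : ℝ)..1, ‖powerSum k N w 𝒟 α‖ ≤ 58 * #𝒟 := by
  have h0 : w 0 = 0 := by
    by_contra h1
    exact lt_irrefl _ (hw.supp _ h1).1
  have hpt : ∀ α : ℝ, ‖powerSum k N w 𝒟 α‖ ≤ ∑ d ∈ 𝒟,
      ‖trigPoly (range (N + 1)) (fun m => (w ((d ^ k * m : ℕ) : ℝ) : ℂ)) ((d ^ k : ℕ) * α)‖ := by
    intro α
    rw [powerSum_eq]
    refine (norm_sum_le _ _).trans (sum_le_sum fun d hd => ?_)
    rw [norm_mul]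
    refine (mul_le_of_le_one_left (norm_nonneg _) (norm_moebius_le d)).trans (le_of_eq ?_)
    rw [sum_multiples_eq (pow_pos (h𝒟 d hd) k) _ (by simp [h0])]
    · congr 1
      refine sum_congr rfl fun m _ => ?_
      congr 2
      push_cast
      ring
    · intro n hn
      have : w n = 0 := by
        by_contra h1
        have h2 := (hw.supp _ h1).2.1
        have h3 : n < N + 1 := by exact_mod_cast h2
        omega
      simp [this]
  calc ∫ α in (0 : ℝ)..1, ‖powerSum k N w 𝒟 α‖
      ≤ ∫ α in (0 : ℝ)..1, ∑ d ∈ 𝒟,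
        ‖trigPoly (range (N + 1)) (fun m => (w ((d ^ k * m : ℕ) : ℝ) : ℂ)) ((d ^ k : ℕ) * α)‖ := by
        refine intervalIntegral.integral_mono_on (by norm_num)
          (Continuous.intervalIntegrable (by fun_prop) _ _)
          (Continuous.intervalIntegrable (by fun_prop) _ _) fun α _ => hpt α
    _ = ∑ d ∈ 𝒟, ∫ α in (0 : ℝ)..1,
        ‖trigPoly (range (N + 1)) (fun m => (w ((d ^ k * m : ℕ) : ℝ) : ℂ)) ((d ^ k : ℕ) * α)‖ :=
        intervalIntegral.integral_finsetSum fun d _ =>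
          Continuous.intervalIntegrable (by fun_prop) _ _
    _ ≤ ∑ d ∈ 𝒟, 58 := by
        refine sum_le_sum fun d hd => ?_
        have := integral_periodic_comp_nat_mul
          (f := fun α => ‖trigPoly (range (N + 1)) (fun m => (w ((d ^ k * m : ℕ) : ℝ) : ℂ)) α‖)
          (fun α => congrArg norm (trigPoly_add_one _ _ _)) (by fun_prop) (pow_pos (h𝒟 d hd) k)
        rw [this]
        exact hw.integral_norm_le hh (pow_pos (h𝒟 d hd) k)
    _ = 58 * #𝒟 := by
        rw [sum_const, nsmul_eq_mul, mul_comm]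

/-- Expanding the square leads to counts of the multiples of `lcm(d, e) ^ k` in `A`, for which a
bound `x / q + y` is assumed, the second term being absent for `q > N`. -/
lemma sum_sq_card_le {A 𝒟 : Finset ℕ} (h𝒟 : ∀ d ∈ 𝒟, 0 < d) {k N : ℕ} {x y : ℝ}
    (hA : ∀ q : ℕ, 0 < q → (#{n ∈ A | q ∣ n} : ℝ) ≤ x / q + if q ≤ N then y else 0) :
    ∑ n ∈ A, (#{d ∈ 𝒟 | d ^ k ∣ n} : ℝ) ^ 2 ≤
      x * ∑ d ∈ 𝒟, ∑ e ∈ 𝒟, ((Nat.lcm d e : ℝ) ^ k)⁻¹ +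
        y * #{z ∈ 𝒟 ×ˢ 𝒟 | Nat.lcm z.1 z.2 ^ k ≤ N} := by
  calc ∑ n ∈ A, (#{d ∈ 𝒟 | d ^ k ∣ n} : ℝ) ^ 2
      = ∑ z ∈ 𝒟 ×ˢ 𝒟, (#{n ∈ A | Nat.lcm z.1 z.2 ^ k ∣ n} : ℝ) := by
        simp_rw [← sum_boole, sq, sum_mul_sum]
        rw [sum_comm, sum_product]
        refine sum_congr rfl fun d _ => ?_
        rw [sum_comm]
        refine sum_congr rfl fun e _ => sum_congr rfl fun n _ => ?_
        simp only [← pow_dvd_and_pow_dvd_iff]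
        by_cases h1 : d ^ k ∣ n <;> by_cases h2 : e ^ k ∣ n <;> simp [h1, h2]
    _ ≤ ∑ z ∈ 𝒟 ×ˢ 𝒟, (x * ((Nat.lcm z.1 z.2 : ℝ) ^ k)⁻¹ +
          if Nat.lcm z.1 z.2 ^ k ≤ N then y else 0) := by
        refine sum_le_sum fun z hz => ?_
        rw [mem_product] at hz
        have := hA (Nat.lcm z.1 z.2 ^ k)
          (pow_pos (Nat.lcm_pos (h𝒟 _ hz.1) (h𝒟 _ hz.2)) k)
        push_cast at this
        rwa [div_eq_mul_inv] at this
    _ = _ := by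
        rw [sum_add_distrib, ← mul_sum, sum_product, ← sum_filter, sum_const, nsmul_eq_mul]
        ring

lemma integral_norm_sq_powerSum_le {k N : ℕ} {w : ℝ → ℝ} (hw : ∀ x, |w x| ≤ 1)
    (𝒟 : Finset ℕ) : ∫ α in (0 : ℝ)..1, ‖powerSum k N w 𝒟 α‖ ^ 2 ≤
      ∑ n ∈ Icc 1 N with w (n : ℕ) ≠ 0, (#{d ∈ 𝒟 | d ^ k ∣ n} : ℝ) ^ 2 := by
  rw [powerSum, integral_norm_sq_trigPoly, sum_filter]
  refine sum_le_sum fun n _ => ?_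
  split_ifs with h
  · gcongr
    rw [norm_mul, Complex.norm_real]
    refine (mul_le_of_le_one_left (norm_nonneg _) (hw _)).trans ((norm_sum_le _ _).trans ?_)
    calc _ ≤ ∑ d ∈ 𝒟 with d ^ k ∣ n, (1 : ℝ) := sum_le_sum fun d _ => norm_moebius_le d
      _ = _ := by simp
  · simp only [ne_eq, not_not] at h
    simp [h]

/-- The mean square over a dyadic block. The second term comes from the `+ 1` in the count of
the multiples of `lcm(d, e) ^ k` in the support of `w`; only pairs with `lcm(d, e) ^ k ≤ N`
contribute to it. -/
lemma IsBump.integral_norm_sq_powerSum_le {w : ℝ → ℝ} {h : ℝ} {k N : ℕ}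
    (hw : IsBump w (N + 1) h) (hh : 0 < h) (hk : 2 ≤ k) {D : ℕ} (hD : 1 ≤ D) :
    ∫ α in (0 : ℝ)..1, ‖powerSum k N w (Ico D (2 * D)) α‖ ^ 2 ≤
      24 * h / (D : ℝ) ^ (k - 1) + (N : ℝ) ^ (1 / (k : ℝ)) * (4 * (1 + Real.log (2 * D))) := by
  refine (KFree.integral_norm_sq_powerSum_le hw.abs_le_one _).trans ?_
  refine (sum_sq_card_le (N := N) (x := 2 * h) (y := 1)
    (fun d hd => by have := (mem_Ico.1 hd).1; omega) ?_).trans ?_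
  · intro q hq
    have hq' : (0 : ℝ) < q := by exact_mod_cast hq
    split_ifs with hqN
    · have hc : #{n ∈ {n ∈ Icc 1 N | w (n : ℕ) ≠ 0} | q ∣ n} ≤
          #{m ∈ range (N + 1) | w ((q * m : ℕ) : ℝ) ≠ 0} := by
        refine (card_le_card (t := {m ∈ range (N + 1) | w ((q * m : ℕ) : ℝ) ≠ 0}.image (q * ·))
          ?_).trans card_image_le
        intro n hn
        obtain ⟨h1, m, rfl⟩ := mem_filter.1 hn
        obtain ⟨h2, h3⟩ := mem_filter.1 h1
        refine mem_image.2 ⟨m, mem_filter.2 ⟨mem_range.2 ?_, h3⟩, rfl⟩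
        have : m ≤ q * m := Nat.le_mul_of_pos_left m hq
        rw [mem_Icc] at h2
        omega
      have hc' : (#{n ∈ {n ∈ Icc 1 N | w (n : ℕ) ≠ 0} | q ∣ n} : ℝ) ≤
          #{m ∈ range (N + 1) | w ((q * m : ℕ) : ℝ) ≠ 0} := by exact_mod_cast hc
      refine hc'.trans ((hw.card_le hh _ hq).trans (le_of_eq ?_))
      ring
    · have : {n ∈ {n ∈ Icc 1 N | w (n : ℕ) ≠ 0} | q ∣ n} = ∅ := by
        refine filter_eq_empty_iff.2 fun n hn hqn => ?_
        have h1 := mem_Icc.1 (mem_filter.1 hn).1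
        have := Nat.le_of_dvd (by omega) hqn
        omega
      rw [this]
      simp only [card_empty, Nat.cast_zero, add_zero]
      positivity
  · have h1 : ∑ d ∈ Ico D (2 * D), ∑ e ∈ Ico D (2 * D), ((Nat.lcm d e : ℝ) ^ k)⁻¹ ≤
        12 / (D : ℝ) ^ (k - 1) := by
      refine le_trans ?_ (sum_sum_inv_lcm_pow_le hk hD (2 * D))
      have hs : Ico D (2 * D) ⊆ Icc D (2 * D) := Ico_subset_Icc_self
      calc _ ≤ ∑ d ∈ Ico D (2 * D), ∑ e ∈ Icc D (2 * D), ((Nat.lcm d e : ℝ) ^ k)⁻¹ :=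
            sum_le_sum fun d _ => sum_le_sum_of_subset_of_nonneg hs fun _ _ _ => by positivity
        _ ≤ _ := sum_le_sum_of_subset_of_nonneg hs fun _ _ _ =>
            sum_nonneg fun _ _ => by positivity
    have h2 := card_pairs_lcm_pow_le (N := N) hk hD
    calc _ ≤ 2 * h * (12 / (D : ℝ) ^ (k - 1)) +
          1 * ((N : ℝ) ^ (1 / (k : ℝ)) * (4 * (1 + Real.log (2 * D)))) := by gcongr
      _ = _ := by ring

/-- The contribution of the powers of large moduli is small in mean square. -/
lemma integral_norm_sq_powerSum_Icc_le {w : ℝ → ℝ} {k N : ℕ} (hw : ∀ x, |w x| ≤ 1)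
    (hk : 2 ≤ k) {D : ℕ} (hD : 1 ≤ D) (X : ℕ) :
    ∫ α in (0 : ℝ)..1, ‖powerSum k N w (Icc D X) α‖ ^ 2 ≤ 12 * N / (D : ℝ) ^ (k - 1) := by
  refine (integral_norm_sq_powerSum_le hw _).trans ?_
  refine (sum_sq_card_le (N := N) (x := N) (y := 0)
    (fun d hd => by have := (mem_Icc.1 hd).1; omega) ?_).trans ?_
  · intro q hq
    simp only [ite_self, add_zero]
    refine card_multiples_le_pos hq (fun m hm => (mem_filter.1 hm).2) (by positivity) ?_
    intro m hm
    have := mem_Icc.1 (mem_filter.1 (mem_filter.1 hm).1).1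
    exact ⟨this.1, by exact_mod_cast this.2⟩
  · rw [zero_mul, add_zero]
    calc _ ≤ (N : ℝ) * (12 / (D : ℝ) ^ (k - 1)) := by
          gcongr
          exact sum_sum_inv_lcm_pow_le hk hD X
      _ = _ := by ring

/-! ### The `L^p` norm as a dyadic sum -/

lemma sum_dyadic_blocks (f : ℕ → ℂ) (J : ℕ) :
    ∑ d ∈ Ico 1 (2 ^ J), f d = ∑ j ∈ range J, ∑ d ∈ Ico (2 ^ j) (2 * 2 ^ j), f d := by
  induction J with
  | zero => simp
  | succ J ih =>
    rw [sum_range_succ, ← ih, pow_succ', sum_Ico_consecutive _ Nat.one_le_two_pow (by omega)]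

lemma kFreeExpSum_eq_trigPoly (k N : ℕ) :
    kFreeExpSum k N = trigPoly (Icc 1 N) (kFreeIndicator k) := rfl

@[fun_prop] lemma continuous_kFreeExpSum (k N : ℕ) : Continuous (kFreeExpSum k N) := by
  rw [kFreeExpSum_eq_trigPoly]
  fun_prop

/-- The exponential sum as a sum of smooth dyadic pieces and of the contribution of the large
moduli. -/
lemma kFreeExpSum_decomposition {k N : ℕ} (hk : k ≠ 0) {I : ℕ} (hI : N + 1 ≤ 2 ^ (I + 1)) (J : ℕ)
    (α : ℝ) : kFreeExpSum k N α =
      ∑ z ∈ range J ×ˢ range (I + 1),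
        powerSum k N (endPiece (N + 1) z.2) (Ico (2 ^ z.1) (2 * 2 ^ z.1)) α +
      powerSum k N (fun _ => 1) (Icc (2 ^ J) (2 ^ J + N)) α := by
  have hcoef : ∀ n ∈ Icc 1 N, kFreeIndicator k n =
      ∑ z ∈ range J ×ˢ range (I + 1), ((endPiece (N + 1) z.2 n : ℝ) : ℂ) *
        ∑ d ∈ Ico (2 ^ z.1) (2 * 2 ^ z.1) with d ^ k ∣ n, (ArithmeticFunction.moebius d : ℂ) +
      ((1 : ℝ) : ℂ) * ∑ d ∈ Icc (2 ^ J) (2 ^ J + N) with d ^ k ∣ n,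
        (ArithmeticFunction.moebius d : ℂ) := by
    intro n hn
    rw [mem_Icc] at hn
    have hw : ∑ i ∈ range (I + 1), endPiece (N + 1) i n = 1 := by
      have hI' : ((N : ℝ) + 1) ≤ 2 ^ (I + 1) := by exact_mod_cast hI
      rw [sum_endPiece]
      have h1 : ((N : ℝ) + 1) / 2 ^ (I + 1) ≤ 1 := div_le_one_of_le₀ hI' (by positivity)
      have h2 : (1 : ℝ) ≤ n := by exact_mod_cast hn.1
      have h3 : (n : ℝ) ≤ N := by exact_mod_cast hn.2
      exact trapezoid_eq_one (by positivity) (by linarith) (by linarith)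
    have hw' : ∑ i ∈ range (I + 1), ((endPiece (N + 1) i n : ℝ) : ℂ) = 1 := by
      rw [← Complex.ofReal_sum, hw, Complex.ofReal_one]
    have h1 : 1 ≤ 2 ^ J := Nat.one_le_two_pow
    rw [kFreeIndicator_eq_sum hk hn.1 (X := 2 ^ J + N) (by omega), sum_product]
    simp_rw [← sum_mul, hw', one_mul, Complex.ofReal_one, one_mul, sum_filter]
    rw [← sum_dyadic_blocks]
    have e1 : Icc 1 (2 ^ J + N) = Ico 1 (2 ^ J + N + 1) := by
      ext; simp only [mem_Icc, mem_Ico]; omega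
    have e2 : Icc (2 ^ J) (2 ^ J + N) = Ico (2 ^ J) (2 ^ J + N + 1) := by
      ext; simp only [mem_Icc, mem_Ico]; omega
    rw [e1, e2, sum_Ico_consecutive _ h1 (by omega)]
  simp only [kFreeExpSum, powerSum, trigPoly]
  rw [sum_congr rfl fun n hn => by rw [hcoef n hn], sum_comm, ← sum_add_distrib]
  refine sum_congr rfl fun n _ => ?_
  rw [add_mul, sum_mul]

/-- The `L^p` norm of a dyadic piece, by interpolation between `L¹` and `L²`. -/
lemma lpNorm_powerSum_le {k N : ℕ} (hk : 2 ≤ k) (hN : 1 ≤ N) {p : ℝ} (hp1 : 1 < p) (hp2 : p < 2)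
    {w : ℝ → ℝ} {h : ℝ} (hw : IsBump w (N + 1) h) (hh : 0 < h) {D : ℕ} (hD : 1 ≤ D) :
    lpNorm p (powerSum k N w (Ico D (2 * D))) ≤
      58 * (h ^ ((p - 1) / p) * (D : ℝ) ^ ((1 - k * (p - 1)) / p) +
        ((D : ℝ) ^ (2 - p) * ((N : ℝ) ^ (1 / (k : ℝ)) * (1 + Real.log (2 * D))) ^ (p - 1))
          ^ (1 / p)) := by
  have hp0 : 0 < p := by linarith
  have hD1 : (1 : ℝ) ≤ D := by exact_mod_cast hD
  have hD' : (0 : ℝ) < D := by linarith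
  have hN' : (0 : ℝ) < N := by exact_mod_cast hN
  have hlog : 0 ≤ Real.log (2 * D) := Real.log_nonneg (by linarith)
  set Z := (N : ℝ) ^ (1 / (k : ℝ)) * (1 + Real.log (2 * D)) with hZ
  have hZ0 : 0 < Z := by positivity
  set Y := h / (D : ℝ) ^ (k - 1) with hY
  have hY0 : 0 < Y := by positivity
  have h1 : ∫ α in (0 : ℝ)..1, ‖powerSum k N w (Ico D (2 * D)) α‖ ≤ 58 * D := by
    have := hw.integral_norm_powerSum_le (k := k) hh (𝒟 := Ico D (2 * D))
      fun d hd => by have := (mem_Ico.1 hd).1; omega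
    rw [Nat.card_Ico, show 2 * D - D = D by omega] at this
    exact this
  have h2 : ∫ α in (0 : ℝ)..1, ‖powerSum k N w (Ico D (2 * D)) α‖ ^ 2 ≤ 58 * (Y + Z) := by
    refine (hw.integral_norm_sq_powerSum_le hh hk hD).trans ?_
    have e1 : 24 * h / (D : ℝ) ^ (k - 1) = 24 * Y := by rw [hY]; ring
    have e2 : (N : ℝ) ^ (1 / (k : ℝ)) * (4 * (1 + Real.log (2 * D))) = 4 * Z := by rw [hZ]; ring
    rw [e1, e2]
    linarith
  have h3 := integral_rpow_le_of_integral_le (continuous_powerSum _ _ _ _) hp1 hp2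
    (by positivity) (by positivity) h1 h2
  have h4 : (58 * (D : ℝ)) ^ (2 - p) * (58 * (Y + Z)) ^ (p - 1) ≤
      58 * ((D : ℝ) ^ (2 - p) * Y ^ (p - 1) + (D : ℝ) ^ (2 - p) * Z ^ (p - 1)) := by
    rw [mul_rpow (by norm_num) hD'.le, mul_rpow (by norm_num) (by positivity)]
    have e : (58 : ℝ) ^ (2 - p) * 58 ^ (p - 1) = 58 := by
      rw [← rpow_add (by norm_num)]
      norm_num
    have h5 := Real.rpow_add_le_add_rpow hY0.le hZ0.le (p := p - 1) (by linarith) (by linarith)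
    calc _ = (58 : ℝ) ^ (2 - p) * 58 ^ (p - 1) * ((D : ℝ) ^ (2 - p) * (Y + Z) ^ (p - 1)) := by
          ring
      _ ≤ 58 * ((D : ℝ) ^ (2 - p) * (Y ^ (p - 1) + Z ^ (p - 1))) := by
          rw [e]
          gcongr
      _ = _ := by ring
  have h0 : 0 ≤ ∫ α in (0 : ℝ)..1, ‖powerSum k N w (Ico D (2 * D)) α‖ ^ p :=
    intervalIntegral.integral_nonneg (by norm_num) fun _ _ => by positivity
  have hip : 1 / p ≤ 1 := by rw [div_le_one hp0]; exact hp1.le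
  have hip0 : 0 ≤ 1 / p := by positivity
  have h58 : (58 : ℝ) ^ (1 / p) ≤ 58 := by
    calc (58 : ℝ) ^ (1 / p) ≤ 58 ^ (1 : ℝ) := rpow_le_rpow_of_exponent_le (by norm_num) hip
      _ = 58 := rpow_one _
  calc lpNorm p (powerSum k N w (Ico D (2 * D)))
      ≤ (58 * ((D : ℝ) ^ (2 - p) * Y ^ (p - 1) + (D : ℝ) ^ (2 - p) * Z ^ (p - 1))) ^ (1 / p) :=
        rpow_le_rpow h0 (h3.trans h4) hip0
    _ = 58 ^ (1 / p) *
        ((D : ℝ) ^ (2 - p) * Y ^ (p - 1) + (D : ℝ) ^ (2 - p) * Z ^ (p - 1)) ^ (1 / p) :=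
        mul_rpow (by norm_num) (by positivity)
    _ ≤ 58 * (((D : ℝ) ^ (2 - p) * Y ^ (p - 1)) ^ (1 / p) +
          ((D : ℝ) ^ (2 - p) * Z ^ (p - 1)) ^ (1 / p)) := by
        gcongr
        exact Real.rpow_add_le_add_rpow (by positivity) (by positivity) hip0 hip
    _ = _ := by
        congr 2
        have e1 : (D : ℝ) ^ (2 - p) * Y ^ (p - 1) =
            h ^ (p - 1) * (D : ℝ) ^ (1 - k * (p - 1)) := by
          have hk1 : (((k - 1 : ℕ) : ℝ)) = k - 1 := by
            rw [Nat.cast_sub (by omega)]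
            simp
          rw [hY, div_rpow hh.le (by positivity), ← rpow_natCast (D : ℝ) (k - 1),
            ← rpow_mul hD'.le, hk1,
            show (1 - k * (p - 1) : ℝ) = (2 - p) - (k - 1) * (p - 1) by ring, rpow_sub hD' (2 - p),
            mul_div_left_comm]
        rw [e1, mul_rpow (by positivity) (by positivity), ← rpow_mul hh.le, ← rpow_mul hD'.le,
          mul_one_div, mul_one_div]

lemma log_factor_le {ε : ℝ} (hε : 0 < ε) : ∃ C : ℝ, 0 < C ∧ ∀ N : ℕ, 1 ≤ N →
    (1 + Real.log (2 * N)) ^ 3 ≤ C * (N : ℝ) ^ ε := by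
  set δ := ε / 3
  have hδ : 0 < δ := by positivity
  refine ⟨(1 + 2 ^ δ / δ) ^ 3, by positivity, fun N hN => ?_⟩
  have hN1 : (1 : ℝ) ≤ N := by exact_mod_cast hN
  have h1 : Real.log (2 * N) ≤ (2 * N) ^ δ / δ := Real.log_le_rpow_div (by positivity) hδ
  have h0 : 0 ≤ Real.log (2 * N) := Real.log_nonneg (by linarith)
  rw [mul_rpow (by norm_num) (by linarith)] at h1
  have h2 : 1 ≤ (N : ℝ) ^ δ := Real.one_le_rpow hN1 hδ.le
  have h3 : 1 + Real.log (2 * N) ≤ (1 + 2 ^ δ / δ) * (N : ℝ) ^ δ := by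
    have e : 2 ^ δ * (N : ℝ) ^ δ / δ = 2 ^ δ / δ * (N : ℝ) ^ δ := by ring
    rw [e] at h1
    linarith
  calc (1 + Real.log (2 * N)) ^ 3 ≤ ((1 + 2 ^ δ / δ) * (N : ℝ) ^ δ) ^ 3 := by gcongr
    _ = (1 + 2 ^ δ / δ) ^ 3 * (N : ℝ) ^ ε := by
      rw [mul_pow, ← rpow_natCast ((N : ℝ) ^ δ), ← rpow_mul (by linarith)]
      congr 2
      simp only [δ]
      push_cast
      ring

lemma natLog_add_one_le {x : ℝ} {n N : ℕ} (hN : 1 ≤ N) (hn : n ≤ 2 * N) (hx : x = Nat.log 2 n) :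
    x + 1 ≤ 2 * (1 + Real.log (2 * N)) := by
  have hN1 : (1 : ℝ) ≤ N := by exact_mod_cast hN
  have h0 : 0 ≤ Real.log (2 * N) := Real.log_nonneg (by linarith)
  rcases Nat.eq_zero_or_pos n with rfl | hn0
  · rw [hx]
    simp only [Nat.log_zero_right, Nat.cast_zero]
    linarith
  have h1 : ((2 : ℝ)) ^ (Nat.log 2 n) ≤ 2 * N := by
    exact_mod_cast (Nat.pow_log_le_self 2 (by omega)).trans hn
  have h2 := Real.log_le_log (by positivity) h1
  rw [Real.log_pow] at h2
  have h3 := Real.log_two_gt_d9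
  rw [hx]
  have h4 : (0 : ℝ) ≤ Nat.log 2 n := by positivity
  nlinarith

/-- The main upper bound in `L^p`, `1 < p < 2`. The exponent of `2 ^ j` is positive, zero or
negative according as `p` is below, at or above `1 + 1 / k`, and the dyadic sum is dominated by
its last term, has equal terms, or is dominated by its first term. -/
lemma exists_lpNorm_kFreeExpSum_le {k : ℕ} (hk : 2 ≤ k) {p : ℝ} (hp1 : 1 < p) (hp2 : p < 2) :
    ∃ C : ℝ, 0 < C ∧ ∀ N : ℕ, 1 ≤ N →
      lpNorm p (kFreeExpSum k N) ≤ C * ((N : ℝ) ^ ((p - 1) / p) *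
        ∑ j ∈ range (Nat.log 2 ⌊(N : ℝ) ^ (1 / ((k : ℝ) + 1))⌋₊ + 1),
          ((2 : ℝ) ^ j) ^ ((1 - k * (p - 1)) / p) + (N : ℝ) ^ (1 / ((k : ℝ) + 1))) := by
  have hp0 : 0 < p := by linarith
  have hk2 : (2 : ℝ) ≤ k := by exact_mod_cast hk
  have hk0 : (0 : ℝ) < k := by linarith
  set σ := (p - 1) / p with hσ
  have hσ0 : 0 < σ := div_pos (by linarith) hp0
  set τ := (1 - k * (p - 1)) / p with hτ
  -- the power of `N` that the secondary terms save over `R`; it absorbs the logarithms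
  set ε := (p - 1) * (k - 1) / (k * (k + 1) * p) with hε
  have hε0 : 0 < ε := div_pos (mul_pos (by linarith) (by linarith)) (by positivity)
  obtain ⟨C₁, hC₁, hlog⟩ := log_factor_le hε0
  set q := ((2 : ℝ) ^ σ)⁻¹ with hq
  have hq0 : 0 < q := by positivity
  have hq1 : q < 1 := inv_lt_one_of_one_lt₀ (Real.one_lt_rpow (by norm_num) hσ0)
  refine ⟨58 * (2 / (1 - q)) + 58 * (4 * C₁) + 4, ?_, fun N hN => ?_⟩
  · have : 0 < 1 - q := by linarith
    positivity
  have hN1 : (1 : ℝ) ≤ N := by exact_mod_cast hN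
  have hN0 : (0 : ℝ) < N := by linarith
  -- moduli above `R` are treated in mean square: then `N / R ^ (k - 1) = R ^ 2`
  set R := (N : ℝ) ^ (1 / ((k : ℝ) + 1)) with hR
  have hR1 : 1 ≤ R := Real.one_le_rpow hN1 (by positivity)
  have hR0 : 0 < R := by linarith
  have hRN : R ≤ N := by
    calc R ≤ (N : ℝ) ^ (1 : ℝ) := by
          refine rpow_le_rpow_of_exponent_le hN1 ?_
          rw [div_le_one (by positivity)]
          linarith
      _ = N := rpow_one _
  set J := Nat.log 2 ⌊R⌋₊ with hJ
  have hfl : ⌊R⌋₊ ≠ 0 := (Nat.floor_pos.2 hR1).ne'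
  have hJR : ∀ j ∈ range (J + 1), ((2 ^ j : ℕ) : ℝ) ≤ R := by
    intro j hj
    have h1 : 2 ^ j ≤ ⌊R⌋₊ := (Nat.pow_le_pow_right (by norm_num)
      (by rw [mem_range] at hj; omega)).trans (Nat.pow_log_le_self 2 hfl)
    exact (Nat.le_floor_iff hR0.le).1 h1
  have hJR' : R ≤ ((2 ^ (J + 1) : ℕ) : ℝ) := by
    have h1 : ⌊R⌋₊ < 2 ^ (J + 1) := Nat.lt_pow_succ_log_self (by norm_num) _
    exact (Nat.floor_lt hR0.le).1 h1 |>.le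
  set I := Nat.log 2 (N + 1) with hI
  have hI1 : N + 1 ≤ 2 ^ (I + 1) := (Nat.lt_pow_succ_log_self (by norm_num) _).le
  set ℓ := 1 + Real.log (2 * N) with hℓ
  have hℓ1 : 1 ≤ ℓ := by
    have : 0 ≤ Real.log (2 * N) := Real.log_nonneg (by linarith)
    linarith
  have hIℓ : (I : ℝ) + 1 ≤ 2 * ℓ := natLog_add_one_le (n := N + 1) hN (by omega) rfl
  have hJℓ : (J : ℝ) + 1 ≤ 2 * ℓ := by
    refine natLog_add_one_le (n := ⌊R⌋₊) hN ?_ rfl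
    have : ⌊R⌋₊ ≤ N := Nat.floor_le_of_le hRN
    omega
  -- the moduli above `R`
  have htail : lpNorm p (powerSum k N (fun _ => 1) (Icc (2 ^ (J + 1)) (2 ^ (J + 1) + N))) ≤
      4 * R := by
    have h1 := integral_norm_sq_powerSum_Icc_le (k := k) (N := N) (w := fun _ => 1)
      (fun _ => by simp) hk (D := 2 ^ (J + 1)) Nat.one_le_two_pow (2 ^ (J + 1) + N)
    have hNR : (N : ℝ) = R ^ 2 * R ^ (k - 1) := by
      rw [← pow_add, hR, ← rpow_natCast, ← rpow_mul hN0.le, show 2 + (k - 1) = k + 1 by omega]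
      push_cast
      rw [one_div_mul_cancel (by positivity), rpow_one]
    have h2 : 12 * (N : ℝ) / ((2 ^ (J + 1) : ℕ) : ℝ) ^ (k - 1) ≤ 12 * R ^ 2 := by
      rw [div_le_iff₀ (by positivity)]
      calc 12 * (N : ℝ) = 12 * R ^ 2 * R ^ (k - 1) := by rw [hNR]; ring
        _ ≤ _ := by gcongr
    have h3 := integral_rpow_le_of_le (f := powerSum k N (fun _ => 1)
      (Icc (2 ^ (J + 1)) (2 ^ (J + 1) + N))) (p := p) (q := 2) (B := 12 * R ^ 2)
      (continuous_powerSum _ _ _ _) hp0.le hp2.le (by norm_num) (by positivity) (by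
        simp_rw [rpow_two]
        exact h1.trans h2)
    unfold lpNorm
    calc _ ≤ ((12 * R ^ 2) ^ (p / 2)) ^ (1 / p) := by
          refine rpow_le_rpow ?_ h3 (by positivity)
          exact intervalIntegral.integral_nonneg (by norm_num) fun _ _ => by positivity
      _ = (12 * R ^ 2) ^ (1 / 2 : ℝ) := by
          rw [← rpow_mul (by positivity)]
          congr 1
          field_simp
      _ ≤ ((4 * R) ^ 2) ^ (1 / 2 : ℝ) := by
          refine rpow_le_rpow (by positivity) ?_ (by norm_num)
          nlinarith
      _ = 4 * R := by
          rw [← sqrt_eq_rpow, sqrt_sq (by positivity)]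
  -- the secondary terms of the dyadic pieces
  have hsec : ∀ j ∈ range (J + 1), (((2 ^ j : ℕ) : ℝ) ^ (2 - p) *
      ((N : ℝ) ^ (1 / (k : ℝ)) * (1 + Real.log (2 * ((2 ^ j : ℕ) : ℝ)))) ^ (p - 1)) ^ (1 / p) ≤
        ℓ * (R / (N : ℝ) ^ ε) := by
    intro j hj
    have hj1 := hJR j hj
    have hj2 : (1 : ℝ) ≤ ((2 ^ j : ℕ) : ℝ) := by exact_mod_cast Nat.one_le_two_pow
    have hlj : 0 ≤ Real.log (2 * ((2 ^ j : ℕ) : ℝ)) := Real.log_nonneg (by linarith)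
    have hll : 1 + Real.log (2 * ((2 ^ j : ℕ) : ℝ)) ≤ ℓ := by
      have := Real.log_le_log (by positivity)
        (show 2 * ((2 ^ j : ℕ) : ℝ) ≤ 2 * N by linarith)
      linarith
    have hexp : 0 ≤ p - 1 := by linarith
    have hexp2 : 0 ≤ 2 - p := by linarith
    calc _ ≤ (R ^ (2 - p) * ((N : ℝ) ^ (1 / (k : ℝ)) * ℓ) ^ (p - 1)) ^ (1 / p) := by gcongr
      _ = ℓ ^ σ * (R / (N : ℝ) ^ ε) := by
          rw [mul_rpow (x := (N : ℝ) ^ (1 / (k : ℝ))) (y := ℓ) (by positivity) (by linarith),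
            ← mul_assoc, mul_rpow (by positivity) (by positivity),
            ← rpow_mul (by linarith : (0 : ℝ) ≤ ℓ), mul_one_div, mul_comm]
          congr 1
          rw [hR, ← rpow_mul hN0.le, ← rpow_mul hN0.le, ← rpow_add hN0, ← rpow_mul hN0.le,
            ← rpow_sub hN0]
          congr 1
          rw [hε]
          field_simp
          ring
      _ ≤ ℓ * (R / (N : ℝ) ^ ε) := by
          gcongr
          calc ℓ ^ σ ≤ ℓ ^ (1 : ℝ) := by
                refine rpow_le_rpow_of_exponent_le hℓ1 ?_
                rw [hσ, div_le_one hp0]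
                linarith
            _ = ℓ := rpow_one _
  -- the geometric sum over the pieces near the ends of the interval
  have hgeom : ∑ i ∈ range (I + 1), (((N : ℝ) + 1) / 2 ^ i) ^ σ ≤ 2 / (1 - q) * (N : ℝ) ^ σ := by
    have e : ∀ i, (((N : ℝ) + 1) / 2 ^ i) ^ σ = ((N : ℝ) + 1) ^ σ * q ^ i := by
      intro i
      rw [div_rpow (by positivity) (by positivity), hq, inv_pow, div_eq_mul_inv,
        ← rpow_natCast (2 ^ σ), ← rpow_natCast 2, ← rpow_mul (by norm_num),
        ← rpow_mul (by norm_num), mul_comm σ]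
    simp_rw [e]
    rw [← mul_sum]
    have h1 : ∑ i ∈ range (I + 1), q ^ i ≤ 1 / (1 - q) := by
      rw [geom_sum_eq hq1.ne, ← neg_div_neg_eq, neg_sub, neg_sub]
      have : 0 < 1 - q := by linarith
      gcongr
      have : 0 ≤ q ^ (I + 1) := by positivity
      linarith
    have h2 : ((N : ℝ) + 1) ^ σ ≤ 2 * (N : ℝ) ^ σ := by
      calc ((N : ℝ) + 1) ^ σ ≤ (2 * N) ^ σ := by
            refine rpow_le_rpow (by positivity) (by linarith) hσ0.le
        _ = 2 ^ σ * (N : ℝ) ^ σ := mul_rpow (by norm_num) hN0.le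
        _ ≤ 2 * (N : ℝ) ^ σ := by
            gcongr
            calc (2 : ℝ) ^ σ ≤ 2 ^ (1 : ℝ) := by
                  refine rpow_le_rpow_of_exponent_le (by norm_num) ?_
                  rw [hσ, div_le_one hp0]
                  linarith
              _ = 2 := rpow_one _
    calc _ ≤ 2 * (N : ℝ) ^ σ * (1 / (1 - q)) := by
          gcongr
      _ = _ := by ring
  have hpiece : ∀ z ∈ range (J + 1) ×ˢ range (I + 1),
      lpNorm p (powerSum k N (endPiece (N + 1) z.2) (Ico (2 ^ z.1) (2 * 2 ^ z.1))) ≤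
        58 * ((((N : ℝ) + 1) / 2 ^ z.2) ^ σ * ((2 : ℝ) ^ z.1) ^ τ) +
          58 * (ℓ * (R / (N : ℝ) ^ ε)) := by
    intro z hz
    rw [mem_product] at hz
    have h1 := lpNorm_powerSum_le hk hN hp1 hp2 (isBump_endPiece (L := (N : ℝ) + 1)
      (by positivity) z.2) (by positivity) (D := 2 ^ z.1) Nat.one_le_two_pow
    have h2 := hsec z.1 hz.1
    rw [← hσ, ← hτ, mul_add] at h1
    have e : ((2 ^ z.1 : ℕ) : ℝ) ^ τ = ((2 : ℝ) ^ z.1) ^ τ := by push_cast; rfl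
    rw [e] at h1
    linarith
  -- Minkowski's inequality for the pieces and the tail, written as a sum over `Bool`
  have hfun : kFreeExpSum k N = fun α => ∑ o ∈ Finset.univ,
      (fun b : Bool => if b then fun α => ∑ z ∈ range (J + 1) ×ˢ range (I + 1),
        powerSum k N (endPiece (N + 1) z.2) (Ico (2 ^ z.1) (2 * 2 ^ z.1)) α
      else powerSum k N (fun _ => 1) (Icc (2 ^ (J + 1)) (2 ^ (J + 1) + N))) o α := by
    ext α
    rw [kFreeExpSum_decomposition (by omega) hI1 (J + 1)]
    simp
  have hsum : lpNorm p (kFreeExpSum k N) ≤ ∑ z ∈ range (J + 1) ×ˢ range (I + 1),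
      lpNorm p (powerSum k N (endPiece (N + 1) z.2) (Ico (2 ^ z.1) (2 * 2 ^ z.1))) +
      lpNorm p (powerSum k N (fun _ => 1) (Icc (2 ^ (J + 1)) (2 ^ (J + 1) + N))) := by
    rw [hfun]
    refine (lpNorm_sum_le _ hp1.le fun b _ => ?_).trans ?_
    · cases b
      · simp only [Bool.false_eq_true, if_false]
        fun_prop
      · simp only [if_true]
        fun_prop
    · rw [Fintype.sum_bool]
      simp only [if_true, Bool.false_eq_true, if_false]
      gcongr
      exact lpNorm_sum_le _ hp1.le fun z _ => by fun_prop
  have hdyad0 : 0 ≤ ∑ j ∈ range (J + 1), ((2 : ℝ) ^ j) ^ τ := sum_nonneg fun _ _ => by positivity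
  have hq1' : 0 < 1 - q := by linarith
  calc lpNorm p (kFreeExpSum k N)
      ≤ ∑ z ∈ range (J + 1) ×ˢ range (I + 1),
        (58 * ((((N : ℝ) + 1) / 2 ^ z.2) ^ σ * ((2 : ℝ) ^ z.1) ^ τ) +
          58 * (ℓ * (R / (N : ℝ) ^ ε))) + 4 * R :=
        hsum.trans (add_le_add (sum_le_sum hpiece) htail)
    _ = 58 * ((∑ i ∈ range (I + 1), (((N : ℝ) + 1) / 2 ^ i) ^ σ) *
          ∑ j ∈ range (J + 1), ((2 : ℝ) ^ j) ^ τ) +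
        ((J : ℝ) + 1) * ((I : ℝ) + 1) * (58 * (ℓ * (R / (N : ℝ) ^ ε))) + 4 * R := by
        rw [sum_add_distrib, sum_const, card_product, card_range, card_range, nsmul_eq_mul,
          ← mul_sum, sum_product, sum_comm, sum_mul_sum]
        push_cast
        ring
    _ ≤ 58 * ((2 / (1 - q) * (N : ℝ) ^ σ) * ∑ j ∈ range (J + 1), ((2 : ℝ) ^ j) ^ τ) +
        (2 * ℓ) * (2 * ℓ) * (58 * (ℓ * (R / (N : ℝ) ^ ε))) + 4 * R := by
        gcongr
    _ = 58 * (2 / (1 - q)) * ((N : ℝ) ^ σ * ∑ j ∈ range (J + 1), ((2 : ℝ) ^ j) ^ τ) +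
        58 * 4 * (ℓ ^ 3 / (N : ℝ) ^ ε) * R + 4 * R := by ring
    _ ≤ 58 * (2 / (1 - q)) * ((N : ℝ) ^ σ * ∑ j ∈ range (J + 1), ((2 : ℝ) ^ j) ^ τ) +
        58 * 4 * C₁ * R + 4 * R := by
        gcongr
        rw [div_le_iff₀ (by positivity)]
        exact hlog N hN
    _ ≤ _ := by
        set P := (N : ℝ) ^ σ * ∑ j ∈ range (J + 1), ((2 : ℝ) ^ j) ^ τ
        have hP : 0 ≤ P := by positivity
        have h1 : 0 ≤ (58 * (4 * C₁) + 4) * P := by positivity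
        have h2 : 0 ≤ 58 * (2 / (1 - q)) * R := by positivity
        nlinarith

/-! ### Upper bounds for the moments -/

lemma kFreeMoment_nonneg (k N : ℕ) (p : ℝ) : 0 ≤ kFreeMoment k N p :=
  intervalIntegral.integral_nonneg (by norm_num) fun _ _ => by positivity

lemma kFreeMoment_eq_lpNorm_rpow {k N : ℕ} {p : ℝ} (hp : 0 < p) :
    kFreeMoment k N p = lpNorm p (kFreeExpSum k N) ^ p := by
  have h0 := kFreeMoment_nonneg k N p
  unfold kFreeMoment at *
  rw [lpNorm, ← rpow_mul h0, one_div_mul_cancel hp.ne', rpow_one]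

lemma norm_kFreeIndicator_le (k n : ℕ) : ‖kFreeIndicator k n‖ ≤ 1 := by
  unfold kFreeIndicator
  split_ifs <;> simp

lemma norm_kFreeExpSum_le (k N : ℕ) (α : ℝ) : ‖kFreeExpSum k N α‖ ≤ N := by
  refine (norm_sum_le _ _).trans ?_
  calc _ ≤ ∑ n ∈ Icc 1 N, (1 : ℝ) := by
        refine sum_le_sum fun n _ => ?_
        rw [norm_mul, norm_expTwoPiI, mul_one]
        exact norm_kFreeIndicator_le k n
    _ = N := by simp

lemma geom_sum_le_of_one_lt {x : ℝ} (hx : 1 < x) (J : ℕ) :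
    ∑ j ∈ range (J + 1), x ^ j ≤ x / (x - 1) * x ^ J := by
  have h : 0 < x - 1 := by linarith
  rw [geom_sum_eq hx.ne', pow_succ, div_mul_eq_mul_div, div_le_div_iff_of_pos_right h]
  linarith

lemma geom_sum_le_of_lt_one {x : ℝ} (hx0 : 0 ≤ x) (hx : x < 1) (J : ℕ) :
    ∑ j ∈ range (J + 1), x ^ j ≤ 1 / (1 - x) := by
  have : 0 < 1 - x := by linarith
  rw [geom_sum_eq hx.ne, ← neg_div_neg_eq, neg_sub, neg_sub]
  gcongr
  have : 0 ≤ x ^ (J + 1) := by positivity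
  linarith

lemma two_pow_rpow (j : ℕ) (τ : ℝ) : ((2 : ℝ) ^ j) ^ τ = (2 ^ τ) ^ j := by
  rw [← rpow_natCast, ← rpow_natCast, ← rpow_mul (by norm_num), ← rpow_mul (by norm_num), mul_comm]

lemma kFreeMoment_le_of_gt_of_lt_two {k : ℕ} (hk : 2 ≤ k) {p : ℝ} (hp : 1 + 1 / (k : ℝ) < p)
    (hp2 : p < 2) :
    ∃ C : ℝ, 0 < C ∧ ∀ N : ℕ, 1 ≤ N → kFreeMoment k N p ≤ C * (N : ℝ) ^ (p - 1) := by
  have hk2 : (2 : ℝ) ≤ k := by exact_mod_cast hk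
  have hk0 : (0 : ℝ) < k := by linarith
  have hik : 0 < 1 / (k : ℝ) := by positivity
  have hp1 : 1 < p := by linarith
  have hp0 : 0 < p := by linarith
  have hkp : 1 < k * (p - 1) := by
    rw [← div_lt_iff₀' hk0]
    linarith
  obtain ⟨C, hC, h⟩ := exists_lpNorm_kFreeExpSum_le hk hp1 hp2
  set τ := (1 - k * (p - 1)) / p with hτ
  have hτ0 : τ < 0 := div_neg_of_neg_of_pos (by linarith) hp0
  have hx1 : (2 : ℝ) ^ τ < 1 := Real.rpow_lt_one_of_one_lt_of_neg (by norm_num) hτ0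
  have hx0 : (0 : ℝ) < 2 ^ τ := by positivity
  have h1x : 0 < 1 - (2 : ℝ) ^ τ := by linarith
  refine ⟨(C * (1 / (1 - 2 ^ τ) + 1)) ^ p, by positivity, fun N hN => ?_⟩
  have hN1 : (1 : ℝ) ≤ N := by exact_mod_cast hN
  have h1 := h N hN
  simp_rw [two_pow_rpow] at h1
  have h2 := geom_sum_le_of_lt_one hx0.le hx1 (Nat.log 2 ⌊(N : ℝ) ^ (1 / ((k : ℝ) + 1))⌋₊)
  have h3 : (N : ℝ) ^ (1 / ((k : ℝ) + 1)) ≤ (N : ℝ) ^ ((p - 1) / p) := by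
    refine rpow_le_rpow_of_exponent_le hN1 ?_
    rw [div_le_div_iff₀ (by positivity) hp0]
    linarith
  have h4 : lpNorm p (kFreeExpSum k N) ≤
      C * (1 / (1 - 2 ^ τ) + 1) * (N : ℝ) ^ ((p - 1) / p) := by
    refine h1.trans ?_
    rw [mul_assoc]
    gcongr
    rw [add_mul, one_mul, mul_comm]
    gcongr
  rw [kFreeMoment_eq_lpNorm_rpow hp0]
  calc _ ≤ (C * (1 / (1 - 2 ^ τ) + 1) * (N : ℝ) ^ ((p - 1) / p)) ^ p :=
        rpow_le_rpow (lpNorm_nonneg _ _) h4 hp0.le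
    _ = _ := by
        rw [mul_rpow (by positivity) (by positivity), ← rpow_mul (by linarith),
          div_mul_cancel₀ _ hp0.ne']

lemma kFreeMoment_le_of_gt {k : ℕ} (hk : 2 ≤ k) {p : ℝ} (hp : 1 + 1 / (k : ℝ) < p) :
    ∃ C : ℝ, 0 < C ∧ ∀ N : ℕ, 1 ≤ N → kFreeMoment k N p ≤ C * (N : ℝ) ^ (p - 1) := by
  rcases lt_or_ge p 2 with hp2 | hp2
  · exact kFreeMoment_le_of_gt_of_lt_two hk hp hp2
  · -- reduce to an exponent below `2` by the trivial bound for the other factors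
    have hk2 : (2 : ℝ) ≤ k := by exact_mod_cast hk
    have hik : 1 / (k : ℝ) ≤ 1 / 2 := one_div_le_one_div_of_le (by norm_num) hk2
    have hik0 : 0 < 1 / (k : ℝ) := by positivity
    obtain ⟨C, hC, h⟩ := kFreeMoment_le_of_gt_of_lt_two hk (p := 7 / 4) (by linarith) (by norm_num)
    refine ⟨C, hC, fun N hN => ?_⟩
    have hN0 : (0 : ℝ) < N := by exact_mod_cast hN
    have hc : ∀ q : ℝ, 0 < q → Continuous fun α => ‖kFreeExpSum k N α‖ ^ q := fun q hq =>
      (continuous_kFreeExpSum k N).norm.rpow_const fun _ => Or.inr hq.le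
    have h1 : kFreeMoment k N p ≤ (N : ℝ) ^ (p - 7 / 4) * kFreeMoment k N (7 / 4) := by
      unfold kFreeMoment
      rw [← intervalIntegral.integral_const_mul]
      refine intervalIntegral.integral_mono_on (by norm_num)
        ((hc p (by linarith)).intervalIntegrable _ _)
        (((hc (7 / 4) (by norm_num)).const_mul _).intervalIntegrable _ _) fun α _ => ?_
      have h0 : 0 ≤ ‖kFreeExpSum k N α‖ := norm_nonneg _
      calc ‖kFreeExpSum k N α‖ ^ p
          = ‖kFreeExpSum k N α‖ ^ (p - 7 / 4) * ‖kFreeExpSum k N α‖ ^ (7 / 4 : ℝ) := by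
            rw [← rpow_add' h0 (by linarith)]
            congr 1
            ring
        _ ≤ _ := by
            gcongr
            · linarith
            · exact norm_kFreeExpSum_le k N α
    calc _ ≤ (N : ℝ) ^ (p - 7 / 4) * (C * (N : ℝ) ^ (7 / 4 - 1 : ℝ)) :=
          h1.trans (mul_le_mul_of_nonneg_left (h N hN) (by positivity))
      _ = C * (N : ℝ) ^ (p - 1) := by
          rw [mul_left_comm, ← rpow_add hN0]
          congr 2
          ring

lemma kFreeMoment_le_of_eq {k : ℕ} (hk : 2 ≤ k) {p : ℝ} (hp : p = 1 + 1 / (k : ℝ)) :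
    ∃ C : ℝ, 0 < C ∧ ∀ N : ℕ, 2 ≤ N →
      kFreeMoment k N p ≤ C * ((N : ℝ) ^ (1 / (k : ℝ)) * Real.log N ^ 2) := by
  have hk2 : (2 : ℝ) ≤ k := by exact_mod_cast hk
  have hk0 : (0 : ℝ) < k := by linarith
  have hik : 0 < 1 / (k : ℝ) := by positivity
  have hik2 : 1 / (k : ℝ) ≤ 1 / 2 := one_div_le_one_div_of_le (by norm_num) hk2
  have hp1 : 1 < p := by linarith
  have hp0 : 0 < p := by linarith
  have hp2 : p < 2 := by linarith
  have hkp : (1 - k * (p - 1)) / p = 0 := by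
    rw [hp]
    field_simp
    ring
  obtain ⟨C, hC, h⟩ := exists_lpNorm_kFreeExpSum_le hk hp1 hp2
  have hlog2 : 0 < Real.log 2 := Real.log_pos (by norm_num)
  set A := C * (2 + 4 / Real.log 2 + 1 / Real.log 2)
  have hA : 0 < A := by positivity
  refine ⟨A ^ p * (Real.log 2) ^ (p - 2), by positivity, fun N hN => ?_⟩
  have hN2 : (2 : ℝ) ≤ N := by exact_mod_cast hN
  have hN0 : (0 : ℝ) < N := by linarith
  have hlogN : Real.log 2 ≤ Real.log N := Real.log_le_log (by norm_num) hN2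
  have hlogN0 : 0 < Real.log N := by linarith
  have h1 := h N (by omega)
  simp only [hkp, rpow_zero, sum_const, card_range, nsmul_eq_mul, mul_one] at h1
  set R := (N : ℝ) ^ (1 / ((k : ℝ) + 1)) with hR
  have hσ : (p - 1) / p = 1 / ((k : ℝ) + 1) := by
    rw [hp]
    field_simp
    ring
  have hRN : R ≤ N := by
    calc R ≤ (N : ℝ) ^ (1 : ℝ) := by
          refine rpow_le_rpow_of_exponent_le (by linarith) ?_
          rw [div_le_one (by positivity)]
          linarith
      _ = N := rpow_one _
  have hJ : ((Nat.log 2 ⌊R⌋₊ + 1 : ℕ) : ℝ) ≤ (2 + 4 / Real.log 2) * Real.log N := by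
    have h2 := natLog_add_one_le (n := ⌊R⌋₊) (N := N) (by omega)
      ((Nat.floor_le_of_le hRN).trans (by omega)) rfl
    push_cast
    refine h2.trans ?_
    rw [Real.log_mul (by norm_num) hN0.ne']
    have h3 : 1 ≤ 1 / Real.log 2 * Real.log N := by
      rw [div_mul_eq_mul_div, one_mul, le_div_iff₀ hlog2]
      linarith
    have h4 : Real.log 2 ≤ 1 := by
      have := Real.log_two_lt_d9
      linarith
    have h5 : (2 + 4 / Real.log 2) * Real.log N =
        2 * Real.log N + 4 * (1 / Real.log 2 * Real.log N) := by ring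
    rw [h5]
    linarith
  have hR0 : 0 < R := by positivity
  have h4 : lpNorm p (kFreeExpSum k N) ≤ A * (R * Real.log N) := by
    refine h1.trans ?_
    rw [hσ, ← hR]
    simp only [A]
    rw [mul_assoc]
    gcongr
    have h6 : 1 ≤ 1 / Real.log 2 * Real.log N := by
      rw [div_mul_eq_mul_div, one_mul, le_div_iff₀ hlog2]
      linarith
    calc R * ((Nat.log 2 ⌊R⌋₊ + 1 : ℕ) : ℝ) + R
        ≤ R * ((2 + 4 / Real.log 2) * Real.log N) + R * (1 / Real.log 2 * Real.log N) := by
          gcongr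
          exact le_mul_of_one_le_right hR0.le h6
      _ = _ := by ring
  rw [kFreeMoment_eq_lpNorm_rpow hp0]
  calc _ ≤ (A * (R * Real.log N)) ^ p :=
        rpow_le_rpow (lpNorm_nonneg _ _) h4 hp0.le
    _ = A ^ p * ((N : ℝ) ^ (1 / (k : ℝ)) * (Real.log N ^ 2 * Real.log N ^ (p - 2))) := by
        rw [mul_rpow hA.le (by positivity), mul_rpow hR0.le hlogN0.le,
          hR, ← rpow_mul hN0.le, ← rpow_natCast (Real.log N) 2, ← rpow_add hlogN0]
        congr 3
        · rw [hp]
          field_simp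
        · push_cast
          ring
    _ ≤ A ^ p * ((N : ℝ) ^ (1 / (k : ℝ)) * (Real.log N ^ 2 * Real.log 2 ^ (p - 2))) := by
        have := Real.rpow_le_rpow_of_nonpos hlog2 hlogN (show p - 2 ≤ 0 by linarith)
        gcongr
    _ = _ := by ring

lemma kFreeMoment_le_of_lt_of_one_lt {k : ℕ} (hk : 2 ≤ k) {p : ℝ} (hp : p < 1 + 1 / (k : ℝ))
    (hp1 : 1 < p) :
    ∃ C : ℝ, 0 < C ∧ ∀ N : ℕ, 1 ≤ N → kFreeMoment k N p ≤ C * (N : ℝ) ^ (p / ((k : ℝ) + 1)) := by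
  have hk2 : (2 : ℝ) ≤ k := by exact_mod_cast hk
  have hk0 : (0 : ℝ) < k := by linarith
  have hik : 0 < 1 / (k : ℝ) := by positivity
  have hik2 : 1 / (k : ℝ) ≤ 1 / 2 := one_div_le_one_div_of_le (by norm_num) hk2
  have hp0 : 0 < p := by linarith
  have hkp : k * (p - 1) < 1 := by
    rw [← lt_div_iff₀' hk0]
    linarith
  obtain ⟨C, hC, h⟩ := exists_lpNorm_kFreeExpSum_le hk hp1 (by linarith)
  set τ := (1 - k * (p - 1)) / p with hτ
  have hτ0 : 0 < τ := div_pos (by linarith) hp0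
  set x := (2 : ℝ) ^ τ
  have hx1 : 1 < x := Real.one_lt_rpow (by norm_num) hτ0
  have h1x : 0 < x - 1 := by linarith
  refine ⟨(C * (x / (x - 1) + 1)) ^ p, by positivity, fun N hN => ?_⟩
  have hN1 : (1 : ℝ) ≤ N := by exact_mod_cast hN
  have hN0 : (0 : ℝ) < N := by linarith
  have h1 := h N hN
  simp_rw [two_pow_rpow] at h1
  set R := (N : ℝ) ^ (1 / ((k : ℝ) + 1)) with hR
  have hR1 : 1 ≤ R := Real.one_le_rpow hN1 (by positivity)
  have h2 := geom_sum_le_of_one_lt hx1 (Nat.log 2 ⌊R⌋₊)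
  have h3 : x ^ (Nat.log 2 ⌊R⌋₊) ≤ R ^ τ := by
    rw [← two_pow_rpow]
    have h5 : 2 ^ (Nat.log 2 ⌊R⌋₊) ≤ ⌊R⌋₊ := Nat.pow_log_le_self 2 (Nat.floor_pos.2 hR1).ne'
    have h6 : ((2 : ℝ)) ^ (Nat.log 2 ⌊R⌋₊) ≤ R := by
      exact_mod_cast (Nat.le_floor_iff (by linarith)).1 h5
    exact rpow_le_rpow (by positivity) h6 hτ0.le
  have h4 : (N : ℝ) ^ ((p - 1) / p) * R ^ τ = R := by
    rw [hR, ← rpow_mul hN0.le, ← rpow_add hN0]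
    congr 1
    rw [hτ]
    field_simp
    ring
  have h5 : lpNorm p (kFreeExpSum k N) ≤ C * (x / (x - 1) + 1) * R := by
    refine h1.trans ?_
    rw [mul_assoc]
    gcongr
    calc _ ≤ (N : ℝ) ^ ((p - 1) / p) * (x / (x - 1) * R ^ τ) + R := by
          gcongr
          refine h2.trans ?_
          gcongr
      _ = x / (x - 1) * ((N : ℝ) ^ ((p - 1) / p) * R ^ τ) + R := by ring
      _ = (x / (x - 1) + 1) * R := by rw [h4]; ring
  rw [kFreeMoment_eq_lpNorm_rpow hp0]
  calc _ ≤ (C * (x / (x - 1) + 1) * R) ^ p :=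
        rpow_le_rpow (lpNorm_nonneg _ _) h5 hp0.le
    _ = _ := by
        rw [mul_rpow (by positivity) (by positivity), hR, ← rpow_mul hN0.le, one_div_mul_eq_div]

lemma kFreeMoment_le_of_lt {k : ℕ} (hk : 2 ≤ k) {p : ℝ} (hp0 : 0 ≤ p)
    (hp : p < 1 + 1 / (k : ℝ)) :
    ∃ C : ℝ, 0 < C ∧ ∀ N : ℕ, 1 ≤ N → kFreeMoment k N p ≤ C * (N : ℝ) ^ (p / ((k : ℝ) + 1)) := by
  rcases lt_or_ge 1 p with hp1 | hp1
  · exact kFreeMoment_le_of_lt_of_one_lt hk hp hp1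
  · -- exponents up to `1` are dominated by an exponent between `1` and `1 + 1 / k`
    have hk0 : (0 : ℝ) < k := by
      have : 0 < k := by omega
      exact_mod_cast this
    have hik : 0 < 1 / (k : ℝ) := by positivity
    set q := 1 + 1 / (k : ℝ) / 2
    have hq1 : 1 < q := by simp only [q]; linarith
    obtain ⟨C, hC, h⟩ := kFreeMoment_le_of_lt_of_one_lt hk (p := q) (by simp only [q]; linarith) hq1
    refine ⟨C ^ (p / q), by positivity, fun N hN => ?_⟩
    have hN0 : (0 : ℝ) < N := by exact_mod_cast hN
    refine (integral_rpow_le_of_le (continuous_kFreeExpSum k N) hp0 (by linarith) (by linarith)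
      (by positivity) (h N hN)).trans (le_of_eq ?_)
    rw [mul_rpow hC.le (by positivity), ← rpow_mul hN0.le]
    congr 2
    have : q ≠ 0 := by linarith
    field_simp

/-! ### The lower bound from the neighbourhood of zero -/

lemma sum_kFreeIndicator_ge {k : ℕ} (hk : 2 ≤ k) (N : ℕ) :
    (N : ℝ) / 4 ≤ ‖∑ n ∈ Icc 1 N, kFreeIndicator k n‖ := by
  classical
  have h := card_kFree_ge hk N
  have e : ∑ n ∈ Icc 1 N, kFreeIndicator k n =
      ((#{n ∈ Icc 1 N | ∀ d, 1 < d → ¬ d ^ k ∣ n} : ℝ) : ℂ) := by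
    rw [← sum_boole]
    push_cast
    refine sum_congr rfl fun n _ => ?_
    rw [kFreeIndicator]
    by_cases hn : ∃ d : ℕ, 1 < d ∧ d ^ k ∣ n
    · have h' : ¬ ∀ d, 1 < d → ¬ d ^ k ∣ n := by
        push Not
        exact hn
      rw [if_pos hn, if_neg h', Complex.ofReal_zero]
    · have h' : ∀ d, 1 < d → ¬ d ^ k ∣ n := by
        push Not at hn
        exact hn
      rw [if_neg hn, if_pos h', Complex.ofReal_one]
  rw [e, Complex.norm_real, norm_of_nonneg (by positivity)]
  convert h

/-- On `[0, 1 / (64 N)]` the sum has size of order `N`. -/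
lemma kFreeMoment_ge {k : ℕ} (hk : 2 ≤ k) {p : ℝ} (hp : 0 ≤ p) :
    ∃ c : ℝ, 0 < c ∧ ∀ N : ℕ, 1 ≤ N → c * (N : ℝ) ^ (p - 1) ≤ kFreeMoment k N p := by
  refine ⟨(1 / 8) ^ p * (1 / 64), by positivity, fun N hN => ?_⟩
  have hN1 : (1 : ℝ) ≤ N := by exact_mod_cast hN
  have hN0 : (0 : ℝ) < N := by linarith
  set r := 1 / (64 * (N : ℝ)) with hr
  have hr0 : 0 < r := by positivity
  have hr1 : r ≤ 1 := by
    rw [hr, div_le_one (by positivity)]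
    linarith
  have hpt : ∀ α ∈ Set.Icc 0 r, (N : ℝ) / 8 ≤ ‖kFreeExpSum k N α‖ := by
    intro α hα
    have h1 := sum_kFreeIndicator_ge hk N
    have h2 : ‖∑ n ∈ Icc 1 N, kFreeIndicator k n - kFreeExpSum k N α‖ ≤ N / 8 := by
      rw [kFreeExpSum, ← sum_sub_distrib]
      refine (norm_sum_le _ _).trans ?_
      calc _ ≤ ∑ n ∈ Icc 1 N, (1 / 8 : ℝ) := by
            refine sum_le_sum fun n hn => ?_
            have hnN : (n : ℝ) ≤ N := by exact_mod_cast (mem_Icc.1 hn).2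
            rw [show kFreeIndicator k n - kFreeIndicator k n * expTwoPiI (α * n) =
              kFreeIndicator k n * (1 - expTwoPiI (α * n)) by ring, norm_mul]
            refine (mul_le_of_le_one_left (norm_nonneg _) (norm_kFreeIndicator_le k n)).trans ?_
            refine (norm_one_sub_expTwoPiI_le _).trans ?_
            rw [abs_of_nonneg (mul_nonneg hα.1 (by positivity))]
            have h3 : α * n ≤ r * N := by
              have := hα.1
              have := hα.2
              gcongr
            have h4 : r * N = 1 / 64 := by rw [hr]; field_simp
            have := Real.pi_le_four
            rw [h4] at h3
            nlinarith [Real.pi_pos]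
        _ = N / 8 := by
            rw [sum_const, Nat.card_Icc, nsmul_eq_mul, Nat.add_sub_cancel]
            ring
    have h3 := norm_sub_norm_le (∑ n ∈ Icc 1 N, kFreeIndicator k n) (kFreeExpSum k N α)
    linarith
  have hc : Continuous fun α => ‖kFreeExpSum k N α‖ ^ p :=
    (continuous_kFreeExpSum k N).norm.rpow_const fun _ => Or.inr hp
  calc (1 / 8) ^ p * (1 / 64) * (N : ℝ) ^ (p - 1) = ∫ _ in (0 : ℝ)..r, ((N : ℝ) / 8) ^ p := by
        rw [intervalIntegral.integral_const, smul_eq_mul, sub_zero, hr, rpow_sub_one hN0.ne',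
          show (N : ℝ) / 8 = 1 / 8 * N by ring, mul_rpow (by norm_num) hN0.le]
        field_simp
    _ ≤ ∫ α in (0 : ℝ)..r, ‖kFreeExpSum k N α‖ ^ p := by
        refine intervalIntegral.integral_mono_on hr0.le (by simp)
          (hc.intervalIntegrable _ _) fun α hα => ?_
        exact rpow_le_rpow (by positivity) (hpt α hα) hp
    _ ≤ kFreeMoment k N p :=
        intervalIntegral.integral_mono_interval le_rfl hr0.le hr1
          (Filter.Eventually.of_forall fun α => by positivity) (hc.intervalIntegrable _ _)

/-! ### Exponential sums with the weight `sin (π n / N)` -/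

/-- Summation by parts, twice. -/
lemma norm_one_sub_sq_mul_norm_trigPoly_le {n : ℕ} {a : ℕ → ℂ} (h0 : a 0 = 0)
    (hn : ∀ m, n ≤ m → a m = 0) (y : ℝ) :
    ‖1 - expTwoPiI y‖ ^ 2 * ‖trigPoly (range n) a y‖ ≤
      ∑ m ∈ range (n + 2), ‖a m - 2 * a (m - 1) + a (m - 2)‖ := by
  have h1 := one_sub_mul_trigPoly h0 (hn n le_rfl) y
  have h2 := one_sub_mul_trigPoly (n := n + 1) (a := fun m => a m - a (m - 1)) (by simp)
    (by simp [hn (n + 1) (by omega), hn n le_rfl]) y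
  rw [← h1] at h2
  rw [sq, mul_assoc, ← norm_mul, ← norm_mul, h2]
  refine (norm_sum_le _ _).trans (sum_le_sum fun m _ => ?_)
  rw [norm_mul, norm_expTwoPiI, mul_one]
  refine le_of_eq (congrArg norm ?_)
  simp only [Nat.sub_sub]
  ring

/-- The sum of `sin (π n / N) e(αn)` over the multiples `n ≤ N` of `s`. -/
noncomputable def waveSum (N s : ℕ) (α : ℝ) : ℂ :=
  ∑ n ∈ Icc 1 N with s ∣ n, ((Real.sin (π * n / N) : ℝ) : ℂ) * expTwoPiI (α * n)

@[fun_prop] lemma continuous_waveSum (N s : ℕ) : Continuous (waveSum N s) := by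
  unfold waveSum
  fun_prop

lemma waveSum_eq {N s : ℕ} (hs : 0 < s) (α : ℝ) :
    waveSum N s α = ∑ m ∈ range (N / s + 1),
      ((Real.sin (π * m / (N / s : ℝ)) : ℝ) : ℂ) * expTwoPiI (α * s * m) := by
  have hs' : (s : ℝ) ≠ 0 := by positivity
  have hinj : Set.InjOn (s * ·) (range (N / s + 1) : Set ℕ) :=
    fun a _ b _ h => Nat.eq_of_mul_eq_mul_left hs h
  have e : ∀ m : ℕ, ((Real.sin (π * m / (N / s : ℝ)) : ℝ) : ℂ) * expTwoPiI (α * s * m) =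
      (fun n : ℕ => ((Real.sin (π * n / N) : ℝ) : ℂ) * expTwoPiI (α * n)) (s * m) := by
    intro m
    simp only
    congr 2
    · congr 1
      push_cast
      field_simp
    · push_cast
      ring
  simp_rw [e]
  rw [← sum_image (f := (fun n : ℕ => ((Real.sin (π * n / N) : ℝ) : ℂ) * expTwoPiI (α * n)))
    (g := (s * ·)) hinj, waveSum]
  refine sum_subset_zero_on_sdiff ?_ ?_ fun _ _ => rfl
  · intro n hn
    obtain ⟨h1, m, rfl⟩ := mem_filter.1 hn
    rw [mem_Icc] at h1
    refine mem_image.2 ⟨m, mem_range.2 ?_, rfl⟩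
    rw [Nat.lt_succ_iff, Nat.le_div_iff_mul_le hs, mul_comm]
    exact h1.2
  · intro n hn
    obtain ⟨h1, h2⟩ := mem_sdiff.1 hn
    obtain ⟨m, hm, rfl⟩ := mem_image.1 h1
    rcases Nat.eq_zero_or_pos (s * m) with h3 | h3
    · simp [h3]
    · exfalso
      refine h2 (mem_filter.2 ⟨mem_Icc.2 ⟨h3, ?_⟩, dvd_mul_right _ _⟩)
      rw [mem_range, Nat.lt_succ_iff, Nat.le_div_iff_mul_le hs, mul_comm] at hm
      exact hm

lemma sin_pi_mul_div_nonneg {M : ℝ} (hM : 1 ≤ M) {m : ℕ} (hm : m ∈ range (⌊M⌋₊ + 1)) :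
    0 ≤ Real.sin (π * m / M) := by
  have h1 : (m : ℝ) ≤ M := (Nat.cast_le.2 (by rw [mem_range] at hm; omega)).trans
    (Nat.floor_le (by linarith))
  refine Real.sin_nonneg_of_nonneg_of_le_pi (by positivity) ?_
  rw [div_le_iff₀ (by linarith)]
  gcongr

lemma sum_sin_mul_two_sin {M : ℝ} (n : ℕ) :
    (∑ m ∈ range (n + 1), Real.sin (π * m / M)) * (2 * Real.sin (π / (2 * M))) =
      Real.cos (π / (2 * M)) - Real.cos (π * n / M + π / (2 * M)) := by
  induction n with
  | zero => simp
  | succ n ih =>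
    rw [sum_range_succ, add_mul, ih]
    have h2 : π * n / M + π / (2 * M) = π * ((n + 1 : ℕ) : ℝ) / M - π / (2 * M) := by
      push_cast
      rcases eq_or_ne M 0 with rfl | hM
      · simp
      · field_simp
        ring
    rw [h2, Real.cos_sub, Real.cos_add]
    ring

lemma sum_sin_le {M : ℝ} (hM : 1 ≤ M) :
    ∑ m ∈ range (⌊M⌋₊ + 1), Real.sin (π * m / M) ≤ 2 * M / π := by
  set φ := π / (2 * M) with hφ
  have hφ0 : 0 < φ := by positivity
  have hφ1 : φ ≤ π / 2 := by
    rw [hφ]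
    gcongr
    linarith
  have hsin : 0 < Real.sin φ := Real.sin_pos_of_pos_of_lt_pi hφ0 (by linarith [pi_pos])
  have h1 := sum_sin_mul_two_sin (M := M) ⌊M⌋₊
  rw [← hφ] at h1
  have h2 : Real.cos φ - Real.cos (π * ⌊M⌋₊ / M + φ) ≤ Real.cos φ + 1 := by
    linarith [Real.neg_one_le_cos (π * ⌊M⌋₊ / M + φ)]
  -- `(1 + cos φ) / (2 sin φ) = cot (φ / 2) / 2`
  have h3 : φ * (Real.cos φ + 1) ≤ 2 * Real.sin φ := by
    have e1 : Real.cos φ = 2 * Real.cos (φ / 2) ^ 2 - 1 := by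
      rw [← Real.cos_two_mul]
      congr 1
      ring
    have e2 : Real.sin φ = 2 * Real.sin (φ / 2) * Real.cos (φ / 2) := by
      rw [← Real.sin_two_mul]
      congr 1
      ring
    have hc : 0 < Real.cos (φ / 2) :=
      Real.cos_pos_of_mem_Ioo ⟨by linarith [pi_pos], by linarith [pi_pos]⟩
    have h4 := Real.lt_tan (show 0 < φ / 2 by positivity) (by linarith [pi_pos])
    rw [Real.tan_eq_sin_div_cos, lt_div_iff₀ hc] at h4
    rw [e1, e2]
    nlinarith
  have h4 : 2 * M / π = 1 / φ := by rw [hφ]; field_simp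
  rw [h4, le_div_iff₀ hφ0]
  have h5 : (∑ m ∈ range (⌊M⌋₊ + 1), Real.sin (π * m / M)) * φ * (2 * Real.sin φ) ≤
      1 * (2 * Real.sin φ) := by
    calc _ = (Real.cos φ - Real.cos (π * ⌊M⌋₊ / M + φ)) * φ := by rw [← h1]; ring
      _ ≤ (Real.cos φ + 1) * φ := by gcongr
      _ ≤ _ := by linarith
  exact le_of_mul_le_mul_right h5 (by positivity)

lemma le_sum_sin {M : ℝ} (hM : 1 ≤ M) :
    2 * M / π * Real.cos (π / (2 * M)) ≤ ∑ m ∈ range (⌊M⌋₊ + 1), Real.sin (π * m / M) := by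
  set φ := π / (2 * M) with hφ
  have hM0 : 0 < M := by linarith
  have hφ0 : 0 < φ := by positivity
  have hφ1 : φ ≤ π / 2 := by
    rw [hφ]
    gcongr
    linarith
  have hsin : 0 < Real.sin φ := Real.sin_pos_of_pos_of_lt_pi hφ0 (by linarith [pi_pos])
  have hcos : 0 ≤ Real.cos φ := Real.cos_nonneg_of_mem_Icc ⟨by linarith [pi_pos], hφ1⟩
  have h1 := sum_sin_mul_two_sin (M := M) ⌊M⌋₊
  rw [← hφ] at h1
  have h2 : Real.cos φ ≤ -Real.cos (π * ⌊M⌋₊ / M + φ) := by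
    rw [← Real.cos_sub_pi, ← Real.cos_abs (π * ⌊M⌋₊ / M + φ - π)]
    refine Real.cos_le_cos_of_nonneg_of_le_pi (abs_nonneg _) (by linarith [pi_pos]) ?_
    have h3 : (⌊M⌋₊ : ℝ) ≤ M := Nat.floor_le hM0.le
    have h4 : M < ⌊M⌋₊ + 1 := Nat.lt_floor_add_one M
    have e1 : π * ⌊M⌋₊ / M + φ - π = 2 * φ * (⌊M⌋₊ - M) + φ := by
      rw [hφ]
      field_simp
      ring
    rw [e1, abs_le]
    constructor <;> nlinarith
  have h4 : 2 * M / π = 1 / φ := by rw [hφ]; field_simp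
  have h5 : Real.sin φ ≤ φ := Real.sin_le hφ0.le
  have h6 : Real.cos φ / Real.sin φ ≤ ∑ m ∈ range (⌊M⌋₊ + 1), Real.sin (π * m / M) := by
    rw [div_le_iff₀ hsin]
    nlinarith
  rw [h4, one_div_mul_eq_div]
  exact (div_le_div_of_nonneg_left hcos hsin h5).trans h6

lemma norm_second_diff_expTwoPiI (φ : ℝ) (m : ℕ) :
    ‖expTwoPiI (φ * (m + 2 : ℕ)) - 2 * expTwoPiI (φ * (m + 1 : ℕ)) + expTwoPiI (φ * m)‖ =
      ‖1 - expTwoPiI φ‖ ^ 2 := by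
  have : expTwoPiI (φ * (m + 2 : ℕ)) - 2 * expTwoPiI (φ * (m + 1 : ℕ)) + expTwoPiI (φ * m) =
      expTwoPiI (φ * m) * (1 - expTwoPiI φ) ^ 2 := by
    simp only [expTwoPiI_mul_nat]
    ring
  rw [this, norm_mul, norm_expTwoPiI, one_mul, norm_pow]

lemma sin_mul_expTwoPiI (M θ : ℝ) (m : ℕ) :
    ((Real.sin (π * m / M) : ℝ) : ℂ) * expTwoPiI (θ * m) =
      (expTwoPiI ((θ + 1 / (2 * M)) * m) - expTwoPiI ((θ - 1 / (2 * M)) * m)) /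
        (2 * Complex.I) := by
  have e1 : (θ + 1 / (2 * M)) * m = θ * m + (1 / (2 * M)) * m := by ring
  have e2 : (θ - 1 / (2 * M)) * m = θ * m + -((1 / (2 * M)) * m) := by ring
  rw [e1, e2, expTwoPiI_add, expTwoPiI_add, expTwoPiI_eq ((1 / (2 * M)) * m),
    expTwoPiI_eq (-((1 / (2 * M)) * m))]
  have e3 : 2 * π * (1 / (2 * M) * m) = π * m / M := by
    rcases eq_or_ne M 0 with rfl | hM
    · simp
    · field_simp
  have e4 : 2 * π * -(1 / (2 * M) * m) = -(π * m / M) := by rw [← e3]; ring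
  rw [e3, e4, Real.cos_neg, Real.sin_neg]
  have hI : (2 * Complex.I) ≠ 0 := by simp
  rw [eq_div_iff hI]
  push_cast
  ring

/-! ### Decay of the wave off its peaks -/

/-- The wave `m ↦ sin (π m / M) e(θm)` on `[0, M]`, extended by zero. -/
noncomputable def wave (M θ : ℝ) (m : ℕ) : ℂ :=
  if m ≤ ⌊M⌋₊ then ((Real.sin (π * m / M) : ℝ) : ℂ) * expTwoPiI (θ * m) else 0

lemma wave_zero (M θ : ℝ) : wave M θ 0 = 0 := by
  simp [wave]

lemma norm_wave_le_one (M θ : ℝ) (m : ℕ) : ‖wave M θ m‖ ≤ 1 := by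
  unfold wave
  split_ifs
  · rw [norm_mul, norm_expTwoPiI, mul_one, Complex.norm_real]
    exact Real.abs_sin_le_one _
  · simp

lemma norm_wave_le {M : ℝ} (hM : 0 < M) (θ : ℝ) (m : ℕ) : ‖wave M θ m‖ ≤ 4 * |m - M| / M := by
  unfold wave
  split_ifs
  · rw [norm_mul, norm_expTwoPiI, mul_one, Complex.norm_real, norm_eq_abs, ← Real.sin_pi_sub]
    refine Real.abs_sin_le_abs.trans ?_
    have : π - π * m / M = -(π * (m - M) / M) := by
      field_simp
      ring
    rw [this, abs_neg, abs_div, abs_mul, abs_of_pos pi_pos, abs_of_pos hM]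
    have := Real.pi_le_four
    gcongr
  · rw [norm_zero]
    positivity

/-- The second differences of the wave are summable with total `O(1 / M)`: inside they are
`O(1 / M²)`, and at the two ends the wave vanishes to first order. -/
lemma sum_norm_second_diff_wave_le {M θ : ℝ} (hM : 1 ≤ M) (hθ0 : 0 ≤ θ) (hθ : θ ≤ 1 / (20 * M)) :
    ∑ m ∈ range (⌊M⌋₊ + 1 + 2), ‖wave M θ m - 2 * wave M θ (m - 1) + wave M θ (m - 2)‖ ≤
      40 / M := by
  have hM0 : 0 < M := by linarith
  set n := ⌊M⌋₊ with hn
  have hn1 : 1 ≤ n := Nat.le_floor (by simpa using hM)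
  have hnM : (n : ℝ) ≤ M := Nat.floor_le hM0.le
  have hMn : M < n + 1 := Nat.lt_floor_add_one M
  have hinner : ∀ m, m + 2 ≤ n →
      ‖wave M θ (m + 2) - 2 * wave M θ (m + 1) + wave M θ m‖ ≤ 13 / M ^ 2 := by
    intro m hm
    have hb : ∀ φ : ℝ, |φ| ≤ 11 / 20 / M → ‖1 - expTwoPiI φ‖ ^ 2 ≤ 13 / M ^ 2 := by
      intro φ hφ
      have h1 : ‖1 - expTwoPiI φ‖ ≤ 3.6 / M := by
        refine (norm_one_sub_expTwoPiI_le φ).trans ?_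
        have hpi := Real.pi_lt_d2
        calc 2 * π * |φ| ≤ 2 * 3.15 * (11 / 20 / M) := by gcongr
          _ = 3.465 / M := by ring
          _ ≤ 3.6 / M := by gcongr; norm_num
      calc _ ≤ (3.6 / M) ^ 2 := by gcongr
        _ = 12.96 / M ^ 2 := by rw [div_pow]; norm_num
        _ ≤ _ := by gcongr; norm_num
    have e20 : 1 / (20 * M) = 1 / 20 / M := by rw [div_div]
    have e2 : 1 / (2 * M) = 1 / 2 / M := by rw [div_div]
    have h0 : 0 < 1 / M := by positivity
    have h1 := hb (θ + 1 / (2 * M)) (by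
      rw [abs_of_nonneg (by positivity), e2]
      rw [e20] at hθ
      calc θ + 1 / 2 / M ≤ 1 / 20 / M + 1 / 2 / M := by gcongr
        _ = 11 / 20 / M := by ring)
    have h2 := hb (θ - 1 / (2 * M)) (by
      rw [e2]
      rw [e20] at hθ
      have i1 : 1 / 20 / M = 1 / 20 * (1 / M) := by ring
      have i2 : 1 / 2 / M = 1 / 2 * (1 / M) := by ring
      have i3 : 11 / 20 / M = 11 / 20 * (1 / M) := by ring
      rw [i1] at hθ
      rw [i2, i3, abs_le]
      constructor <;> linarith)
    unfold wave
    rw [if_pos hm, if_pos (by omega), if_pos (by omega), sin_mul_expTwoPiI, sin_mul_expTwoPiI,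
      sin_mul_expTwoPiI]
    set A := θ + 1 / (2 * M)
    set B := θ - 1 / (2 * M)
    have hA := norm_second_diff_expTwoPiI A m
    have hB := norm_second_diff_expTwoPiI B m
    have e : (expTwoPiI (A * (m + 2 : ℕ)) - expTwoPiI (B * (m + 2 : ℕ))) / (2 * Complex.I) -
        2 * ((expTwoPiI (A * (m + 1 : ℕ)) - expTwoPiI (B * (m + 1 : ℕ))) / (2 * Complex.I)) +
        (expTwoPiI (A * m) - expTwoPiI (B * m)) / (2 * Complex.I) =
        ((expTwoPiI (A * (m + 2 : ℕ)) - 2 * expTwoPiI (A * (m + 1 : ℕ)) + expTwoPiI (A * m)) -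
        (expTwoPiI (B * (m + 2 : ℕ)) - 2 * expTwoPiI (B * (m + 1 : ℕ)) + expTwoPiI (B * m))) /
          (2 * Complex.I) := by ring
    rw [e, norm_div]
    have hI : ‖2 * Complex.I‖ = 2 := by simp
    rw [hI, div_le_iff₀ (by norm_num)]
    refine (norm_sub_le _ _).trans ?_
    rw [hA, hB]
    linarith
  have hlast1 : ‖wave M θ (n + 1) - 2 * wave M θ n + wave M θ (n - 1)‖ ≤ 16 / M := by
    have e0 : wave M θ (n + 1) = 0 := by
      unfold wave
      rw [if_neg (by omega)]
    have h1 := norm_wave_le hM0 θ n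
    have h2 := norm_wave_le hM0 θ (n - 1)
    have h3 : |(n : ℝ) - M| ≤ 1 := by rw [abs_le]; constructor <;> linarith
    have h4 : |((n - 1 : ℕ) : ℝ) - M| ≤ 2 := by
      rw [Nat.cast_sub hn1, abs_le]
      push_cast
      constructor <;> linarith
    have h5 : ‖wave M θ n‖ ≤ 4 / M := h1.trans (by gcongr; linarith)
    have h6 : ‖wave M θ (n - 1)‖ ≤ 8 / M := h2.trans (by gcongr; linarith)
    rw [e0, zero_sub]
    refine (norm_add_le _ _).trans ?_
    rw [norm_neg, norm_mul]
    have : ‖(2 : ℂ)‖ = 2 := by simp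
    rw [this]
    calc 2 * ‖wave M θ n‖ + ‖wave M θ (n - 1)‖ ≤ 2 * (4 / M) + 8 / M := by gcongr
      _ = 16 / M := by ring
  have hlast2 : ‖wave M θ (n + 2) - 2 * wave M θ (n + 1) + wave M θ n‖ ≤ 4 / M := by
    have e0 : wave M θ (n + 1) = 0 := by
      unfold wave
      rw [if_neg (by omega)]
    have e1 : wave M θ (n + 2) = 0 := by
      unfold wave
      rw [if_neg (by omega)]
    rw [e0, e1]
    simp only [mul_zero, sub_zero, zero_add]
    refine (norm_wave_le hM0 θ n).trans ?_
    have h3 : |(n : ℝ) - M| ≤ 1 := by rw [abs_le]; constructor <;> linarith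
    gcongr
    linarith
  have hfirst : ‖wave M θ 1‖ ≤ 4 / M := by
    unfold wave
    rw [if_pos hn1, norm_mul, norm_expTwoPiI, mul_one, Complex.norm_real, norm_eq_abs]
    refine Real.abs_sin_le_abs.trans ?_
    rw [abs_of_nonneg (by positivity)]
    have := Real.pi_le_four
    simp only [Nat.cast_one, mul_one]
    gcongr
  set d : ℕ → ℝ := fun m => ‖wave M θ m - 2 * wave M θ (m - 1) + wave M θ (m - 2)‖ with hd
  have hd0 : d 0 = 0 := by simp [hd, wave_zero]
  have hd1 : d 1 = ‖wave M θ 1‖ := by simp [hd, wave_zero]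
  have hsplit : ∑ m ∈ range (n + 1 + 2), d m =
      ∑ m ∈ range (n - 1), d (m + 2) + d 1 + d (n + 1) + d (n + 2) := by
    obtain ⟨j, hj⟩ := Nat.exists_eq_add_of_le' hn1
    rw [hj, show j + 1 + 1 + 2 = j + 1 + 1 + 1 + 1 by omega, sum_range_succ, sum_range_succ,
      sum_range_succ', sum_range_succ', hd0, add_zero]
    rfl
  rw [hsplit, hd1]
  have e1 : d (n + 1) = ‖wave M θ (n + 1) - 2 * wave M θ n + wave M θ (n - 1)‖ := by
    simp only [hd, Nat.add_sub_cancel, show n + 1 - 2 = n - 1 by omega]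
  have e2 : d (n + 2) = ‖wave M θ (n + 2) - 2 * wave M θ (n + 1) + wave M θ n‖ := rfl
  rw [e1, e2]
  have hs : ∑ m ∈ range (n - 1), d (m + 2) ≤ 13 / M := by
    calc _ ≤ ∑ m ∈ range (n - 1), 13 / M ^ 2 := by
          refine sum_le_sum fun m hm => hinner m ?_
          rw [mem_range] at hm
          omega
      _ = ((n - 1 : ℕ) : ℝ) * (13 / M ^ 2) := by rw [sum_const, card_range, nsmul_eq_mul]
      _ ≤ M * (13 / M ^ 2) := by
          gcongr
          refine (Nat.cast_le.2 (Nat.sub_le n 1)).trans hnM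
      _ = 13 / M := by field_simp
  have hfin : 13 / M + 4 / M + 16 / M + 4 / M ≤ 40 / M := by
    rw [← add_div, ← add_div, ← add_div]
    gcongr
    norm_num
  linarith

lemma norm_trigPoly_wave_le {M θ : ℝ} (hM : 1 ≤ M) (y : ℝ) :
    ‖trigPoly (range (⌊M⌋₊ + 1)) (wave M θ) y‖ ≤ M := by
  refine (norm_sum_le _ _).trans ?_
  rw [sum_range_succ']
  simp only [wave_zero, zero_mul, norm_zero, add_zero]
  calc _ ≤ ∑ m ∈ range ⌊M⌋₊, (1 : ℝ) := by
        refine sum_le_sum fun m _ => ?_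
        rw [norm_mul, norm_expTwoPiI, mul_one]
        exact norm_wave_le_one _ _ _
    _ = ⌊M⌋₊ := by simp
    _ ≤ M := Nat.floor_le (by linarith)

lemma sum_min_inv_sq_le {M : ℝ} (hM : 0 < M) {r : ℕ} (hr : 0 < r) :
    ∑ b ∈ Ioo 0 r, min M (3 * (r : ℝ) ^ 2 / (M * (b : ℝ) ^ 2)) ≤ 7 * r := by
  have hr' : (0 : ℝ) < r := by exact_mod_cast hr
  set T := ⌊(r : ℝ) / M⌋₊
  have hT1 : (T : ℝ) ≤ r / M := Nat.floor_le (by positivity)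
  have hT2 : (r : ℝ) / M < T + 1 := Nat.lt_floor_add_one _
  calc _ ≤ ∑ b ∈ Icc 1 T, min M (3 * (r : ℝ) ^ 2 / (M * (b : ℝ) ^ 2)) +
        ∑ b ∈ Ioo T r, min M (3 * (r : ℝ) ^ 2 / (M * (b : ℝ) ^ 2)) := by
        have hsub : Ioo 0 r ⊆ Icc 1 T ∪ Ioo T r := by
          intro b hb
          simp only [mem_Ioo, mem_union, mem_Icc] at hb ⊢
          omega
        have hdisj : Disjoint (Icc 1 T) (Ioo T r) := by
          rw [Finset.disjoint_left]
          intro b hb hb'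
          simp only [mem_Ioo, mem_Icc] at hb hb'
          omega
        rw [← sum_union hdisj]
        exact sum_le_sum_of_subset_of_nonneg hsub fun _ _ _ => le_min hM.le (by positivity)
    _ ≤ ∑ b ∈ Icc 1 T, M + ∑ b ∈ Ioo T r, 3 * (r : ℝ) ^ 2 / M * ((b : ℝ) ^ 2)⁻¹ := by
        gcongr with b hb b hb
        · exact min_le_left _ _
        · refine (min_le_right _ _).trans (le_of_eq ?_)
          rw [← div_div, div_eq_mul_inv]
    _ = T * M + 3 * (r : ℝ) ^ 2 / M * ∑ b ∈ Ioo T r, ((b : ℝ) ^ 2)⁻¹ := by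
        rw [← mul_sum]
        simp
    _ ≤ r / M * M + 3 * (r : ℝ) ^ 2 / M * (2 / (r / M)) := by
        gcongr
        refine (sum_Ioo_inv_sq_le (α := ℝ) T r).trans ?_
        gcongr
    _ = 7 * r := by
        field_simp
        norm_num

/-- The values of the transform of the wave at the nonzero multiples of `1 / r`: below `M` in any
case, and below `3 M⁻¹ ‖b / r‖⁻²` by the bound for the second differences. -/
lemma sum_norm_trigPoly_wave_le {M θ : ℝ} (hM : 1 ≤ M) (hθ0 : 0 ≤ θ) (hθ : θ ≤ 1 / (20 * M))
    {r : ℕ} (hr : 0 < r) :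
    ∑ b ∈ Ioo 0 r, ‖trigPoly (range (⌊M⌋₊ + 1)) (wave M θ) (b / r)‖ ≤ 14 * r := by
  have hM0 : 0 < M := by linarith
  have hr' : (0 : ℝ) < r := by exact_mod_cast hr
  set F := trigPoly (range (⌊M⌋₊ + 1)) (wave M θ)
  set g : ℕ → ℝ := fun b => min M (3 * (r : ℝ) ^ 2 / (M * (b : ℝ) ^ 2)) with hg
  have hg0 : ∀ b, 0 ≤ g b := fun b => le_min hM0.le (by positivity)
  have hkey : ∀ y : ℝ, ∀ b : ℕ, 0 < b → 4 * (b / r : ℝ) ≤ ‖1 - expTwoPiI y‖ → ‖F y‖ ≤ g b := by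
    intro y b hb h
    have hb' : (0 : ℝ) < b := by exact_mod_cast hb
    refine le_min (norm_trigPoly_wave_le hM y) ?_
    have h1 := norm_one_sub_sq_mul_norm_trigPoly_le (wave_zero M θ) (n := ⌊M⌋₊ + 1)
      (fun m hm => by unfold wave; rw [if_neg (by omega)]) y
    have h2 := h1.trans (sum_norm_second_diff_wave_le hM hθ0 hθ)
    have h3 : (4 * (b / r : ℝ)) ^ 2 * ‖F y‖ ≤ 40 / M :=
      (mul_le_mul_of_nonneg_right (pow_le_pow_left₀ (by positivity) h 2) (norm_nonneg _)).trans h2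
    have h4 : ‖F y‖ ≤ 40 / M / (4 * (b / r : ℝ)) ^ 2 := by
      rw [le_div_iff₀ (by positivity), mul_comm]
      exact h3
    refine h4.trans ?_
    have e : 40 / M / (4 * (b / r : ℝ)) ^ 2 = 2.5 * (r : ℝ) ^ 2 / (M * (b : ℝ) ^ 2) := by
      field_simp
      norm_num
    rw [e]
    gcongr
    norm_num
  have hpt : ∀ b ∈ Ioo 0 r, ‖F (b / r)‖ ≤ g b + g (r - b) := by
    intro b hb
    rw [mem_Ioo] at hb
    have hbr : (b : ℝ) < r := by exact_mod_cast hb.2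
    have hb0 : (0 : ℝ) < b := by exact_mod_cast hb.1
    rcases le_total (2 * b) r with h | h
    · have h' : 2 * (b : ℝ) ≤ r := by exact_mod_cast h
      have := hkey (b / r) b hb.1 (by
        have h1 := four_mul_abs_le_norm_one_sub (x := b / r) (by
          rw [abs_of_nonneg (by positivity), div_le_iff₀ hr']
          linarith)
        rwa [abs_of_nonneg (by positivity)] at h1)
      linarith [hg0 (r - b)]
    · have h' : (r : ℝ) ≤ 2 * b := by exact_mod_cast h
      have := hkey (b / r) (r - b) (by omega) (by
        have e1 : ((r - b : ℕ) : ℝ) / r = |(b : ℝ) / r - 1| := by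
          have : (b : ℝ) / r ≤ 1 := (div_le_one hr').2 hbr.le
          rw [abs_of_nonpos (by linarith), Nat.cast_sub hb.2.le]
          field_simp
          ring
        have h1 := four_mul_abs_le_norm_one_sub (x := b / r - 1) (by
          have : 1 / 2 ≤ (b : ℝ) / r := by
            rw [le_div_iff₀ hr']
            linarith
          have h3 : (b : ℝ) / r ≤ 1 := (div_le_one hr').2 hbr.le
          rw [abs_le]
          constructor <;> linarith)
        have e2 : expTwoPiI ((b : ℝ) / r) = expTwoPiI (b / r - 1) := by
          have h5 := expTwoPiI_add (b / r - 1) 1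
          have h6 := expTwoPiI_nat 1
          rw [Nat.cast_one] at h6
          rwa [sub_add_cancel, h6, mul_one] at h5
        rw [e1, e2]
        exact h1)
      linarith [hg0 b]
  have hrefl : ∑ b ∈ Ioo 0 r, g (r - b) = ∑ b ∈ Ioo 0 r, g b := by
    refine sum_bij' (fun b _ => r - b) (fun b _ => r - b) ?_ ?_ ?_ ?_ fun _ _ => rfl
    all_goals
      intro b hb
      simp only [mem_Ioo] at hb ⊢
      omega
  calc _ ≤ ∑ b ∈ Ioo 0 r, (g b + g (r - b)) := sum_le_sum hpt
    _ = 2 * ∑ b ∈ Ioo 0 r, g b := by rw [sum_add_distrib, hrefl]; ring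
    _ ≤ 2 * (7 * r) := by gcongr; exact sum_min_inv_sq_le hM0 hr
    _ = _ := by ring

lemma waveSum_eq_trigPoly {N s : ℕ} (hs : 0 < s) (y β : ℝ) :
    waveSum N s (y + β) =
      trigPoly (range (⌊(N : ℝ) / s⌋₊ + 1)) (wave ((N : ℝ) / s) (β * s)) (y * s) := by
  rw [waveSum_eq hs, Nat.floor_div_eq_div, trigPoly]
  refine sum_congr rfl fun m hm => ?_
  rw [wave, Nat.floor_div_eq_div, if_pos (by rw [mem_range] at hm; omega),
    mul_assoc (Complex.ofReal _), ← expTwoPiI_add]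
  congr 2
  ring

lemma sum_range_mul_periodic {f : ℕ → ℝ} {r : ℕ} (hf : ∀ a, f (a + r) = f a) (g : ℕ) :
    ∑ a ∈ range (g * r), f a = g * ∑ a ∈ range r, f a := by
  have hper : ∀ g a, f (g * r + a) = f a := by
    intro g a
    induction g with
    | zero => simp
    | succ g ih => rw [← ih, ← hf (g * r + a)]; congr 1; ring
  induction g with
  | zero => simp
  | succ g ih =>
    rw [add_mul, one_mul, sum_range_add, ih, sum_congr rfl fun a _ => hper g a]
    push_cast
    ring

/-- The mean over the fractions `a / q` of the wave over multiples of `s`, away from its peaks,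
is bounded, without a logarithm: off the peaks the wave decays quadratically. -/
lemma sum_norm_waveSum_le {N s q : ℕ} (hs : 0 < s) (hsN : s ≤ N) (hq : 0 < q) {β : ℝ}
    (hβ0 : 0 ≤ β) (hβ : β ≤ 1 / (20 * N)) :
    ∑ a ∈ range q with ¬ q ∣ a * s, ‖waveSum N s (a / q + β)‖ ≤ 14 * q := by
  have hs' : (0 : ℝ) < s := by exact_mod_cast hs
  have hN' : (0 : ℝ) < N := by exact_mod_cast hs.trans_le hsN
  have hM : 1 ≤ (N : ℝ) / s := by
    rw [le_div_iff₀ hs', one_mul]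
    exact_mod_cast hsN
  set F := trigPoly (range (⌊(N : ℝ) / s⌋₊ + 1)) (wave ((N : ℝ) / s) (β * s)) with hF
  have hθ : β * s ≤ 1 / (20 * ((N : ℝ) / s)) := by
    calc β * s ≤ 1 / (20 * N) * s := by gcongr
      _ = _ := by field_simp
  -- in lowest terms `s / q = s' / r`, and `a s'` runs `g` times through the residues mod `r`
  obtain ⟨g, s', r, hg, hcop, hse, hqe⟩ := Nat.exists_coprime' (Nat.gcd_pos_of_pos_left q hs)
  have hr : 0 < r := Nat.pos_of_ne_zero fun h => by rw [hqe, h, zero_mul] at hq; omega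
  have hr' : (0 : ℝ) < r := by exact_mod_cast hr
  have hg' : (0 : ℝ) < g := by exact_mod_cast hg
  set f : ℕ → ℝ := fun b => if b % r = 0 then 0 else ‖F ((b % r : ℕ) / r)‖ with hf
  have hFper : ∀ b : ℕ, F ((b : ℝ) / r) = F ((b % r : ℕ) / r) := by
    intro b
    have h1 := (periodic_trigPoly (range (⌊(N : ℝ) / s⌋₊ + 1))
      (wave ((N : ℝ) / s) (β * s))).nat_mul (b / r) ((b % r : ℕ) / r)
    rw [← hF] at h1
    rw [← h1]
    congr 1
    have h2 : ((b % r : ℕ) : ℝ) + r * (b / r : ℕ) = b := by exact_mod_cast Nat.mod_add_div b r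
    rw [← h2]
    field_simp
  have hterm : ∀ a : ℕ, (if ¬ q ∣ a * s then ‖waveSum N s (a / q + β)‖ else 0) = f (a * s') := by
    intro a
    have hdiv : q ∣ a * s ↔ a * s' % r = 0 := by
      rw [hse, hqe, ← mul_assoc, Nat.mul_dvd_mul_iff_right hg, Nat.dvd_iff_mod_eq_zero]
    simp only [hf]
    by_cases h : a * s' % r = 0
    · rw [if_pos h, if_neg (not_not.2 (hdiv.2 h))]
    · rw [if_neg h, if_pos (fun h' => h (hdiv.1 h')), waveSum_eq_trigPoly hs, ← hF, ← hFper]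
      congr 2
      rw [hqe]
      nth_rewrite 1 [hse]
      push_cast
      field_simp
  rw [sum_filter, sum_congr rfl fun a _ => hterm a]
  nth_rewrite 1 [hqe]
  rw [mul_comm r g, sum_range_mul_periodic (f := fun a => f (a * s'))]
  · have hinj : Set.InjOn (fun a => a * s' % r) (range r : Set ℕ) := by
      intro a ha b hb h
      simp only [coe_range, Set.mem_Iio] at ha hb
      have h1 : a * s' ≡ b * s' [MOD r] := h
      have h2 : a ≡ b [MOD r] := Nat.ModEq.cancel_right_of_coprime hcop.symm h1
      exact Nat.ModEq.eq_of_lt_of_lt h2 ha hb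
    have h1 : ∑ a ∈ range r, f (a * s') ≤ 14 * r := by
      calc ∑ a ∈ range r, f (a * s') = ∑ a ∈ range r, f (a * s' % r) := by
            refine sum_congr rfl fun a _ => ?_
            simp only [hf, Nat.mod_mod]
        _ = ∑ b ∈ (range r).image fun a => a * s' % r, f b := by rw [sum_image hinj]
        _ ≤ ∑ b ∈ range r, f b := by
            refine sum_le_sum_of_subset_of_nonneg ?_ fun b _ _ => ?_
            · intro b hb
              obtain ⟨a, _, rfl⟩ := mem_image.1 hb
              exact mem_range.2 (Nat.mod_lt _ hr)
            · simp only [hf]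
              split_ifs <;> positivity
        _ = ∑ b ∈ Ioo 0 r, ‖F (b / r)‖ := by
            rw [range_eq_Ico, ← Ioo_insert_left hr, sum_insert (by simp)]
            simp only [hf, Nat.zero_mod, if_true, zero_add]
            refine sum_congr rfl fun b hb => ?_
            rw [mem_Ioo] at hb
            rw [Nat.mod_eq_of_lt hb.2, if_neg (by omega)]
        _ ≤ 14 * r := sum_norm_trigPoly_wave_le hM (by positivity) hθ hr
    calc (g : ℝ) * ∑ a ∈ range r, f (a * s') ≤ g * (14 * r) := by gcongr
      _ = 14 * q := by
        rw [hqe]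
        push_cast
        ring
  · intro a
    simp only [hf, add_mul, Nat.add_mul_mod_self_left]

/-- The triangle inequality. The constant `2 / π` is the mean of `sin` over half a period; it
also appears in the lower bound `le_norm_waveSum` on the peaks, so that the two can be compared. -/
lemma norm_waveSum_le {N s : ℕ} (hs : 0 < s) (hsN : s ≤ N) (α : ℝ) :
    ‖waveSum N s α‖ ≤ 2 / π * (N / s) := by
  have hs' : (0 : ℝ) < s := by exact_mod_cast hs
  have hM : 1 ≤ (N : ℝ) / s := by
    rw [le_div_iff₀ hs', one_mul]
    exact_mod_cast hsN
  rw [waveSum_eq hs, ← Nat.floor_div_eq_div (K := ℝ)]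
  refine (norm_sum_le _ _).trans ?_
  calc _ = ∑ m ∈ range (⌊(N : ℝ) / s⌋₊ + 1), Real.sin (π * m / (N / s : ℝ)) := by
        refine sum_congr rfl fun m hm => ?_
        rw [norm_mul, norm_expTwoPiI, mul_one, Complex.norm_real, norm_eq_abs,
          abs_of_nonneg (sin_pi_mul_div_nonneg hM hm)]
    _ ≤ 2 * (N / s) / π := sum_sin_le hM
    _ = _ := by ring

/-- The peaks of the wave over multiples of `s` are just to the right of the multiples of `1 / s`:
there the phases `e(βn)` stay close to `1`. -/
lemma le_norm_waveSum {N s : ℕ} (hs : 0 < s) (hsN : 5 * s ≤ N) {y β : ℝ} {t : ℕ}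
    (hy : y * s = t) (hβ0 : 0 ≤ β) (hβ : β ≤ 1 / (20 * N)) :
    2 / π * (N / s) * (7 / 8) ≤ ‖waveSum N s (y + β)‖ := by
  have hs' : (0 : ℝ) < s := by exact_mod_cast hs
  have hN' : (0 : ℝ) < N := by exact_mod_cast (by omega : 0 < N)
  set M := (N : ℝ) / s with hMd
  have hM5 : 5 ≤ M := by
    rw [hMd, le_div_iff₀ hs']
    exact_mod_cast hsN
  have hM : 1 ≤ M := by linarith
  have hM0 : 0 < M := by linarith
  have hpi := Real.pi_lt_d2
  have hpi0 := Real.pi_pos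
  have hcos : ∀ x : ℝ, 0 ≤ x → x ≤ 0.32 → 0.94 ≤ Real.cos x := by
    intro x hx0 hx
    have := Real.one_sub_sq_div_two_le_cos (x := x)
    nlinarith
  have h1 : 0.94 ≤ Real.cos (π / (2 * M)) := by
    refine hcos _ (by positivity) ?_
    rw [div_le_iff₀ (by positivity)]
    nlinarith
  have h2 : ∀ m ∈ range (⌊M⌋₊ + 1), Real.sin (π * m / M) * 0.94 ≤
      (((Real.sin (π * m / M) : ℝ) : ℂ) * expTwoPiI ((y + β) * s * m)).re := by
    intro m hm
    have hmM : (m : ℝ) ≤ M := (Nat.cast_le.2 (by rw [mem_range] at hm; omega)).trans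
      (Nat.floor_le (by linarith))
    have e : (y + β) * s * m = β * s * m + (t * m : ℕ) := by
      rw [add_mul, hy]
      push_cast
      ring
    rw [Complex.re_ofReal_mul, e, expTwoPiI_add, expTwoPiI_nat, mul_one, re_expTwoPiI]
    have h0 := sin_pi_mul_div_nonneg hM hm
    gcongr
    refine hcos _ (by positivity) ?_
    have h3 : β * s * m ≤ 1 / 20 := by
      calc β * s * m ≤ 1 / (20 * N) * s * M := by gcongr
        _ = 1 / 20 := by rw [hMd]; field_simp
    calc 2 * π * (β * s * m) ≤ 2 * 3.15 * (1 / 20) := by gcongr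
      _ ≤ 0.32 := by norm_num
  have h3 : (∑ m ∈ range (⌊M⌋₊ + 1), Real.sin (π * m / M)) * 0.94 ≤ (waveSum N s (y + β)).re := by
    rw [waveSum_eq hs, ← Nat.floor_div_eq_div (K := ℝ), Complex.re_sum, sum_mul]
    exact sum_le_sum h2
  have h4 := le_sum_sin hM
  have h5 : 0 < 2 / π * M := by positivity
  have e : 2 * M / π = 2 / π * M := by ring
  rw [e] at h4
  calc 2 / π * M * (7 / 8) ≤ 2 / π * M * 0.94 * 0.94 := by nlinarith
    _ ≤ 2 / π * M * Real.cos (π / (2 * M)) * 0.94 := by gcongr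
    _ ≤ _ := by gcongr
    _ ≤ _ := h3.trans ((le_abs_self _).trans (Complex.abs_re_le_norm _))

/-! ### Rational points with `k`-th power denominators -/

/-- The squarefree moduli in `(D / 8, D]`. -/
def majorModuli (D : ℕ) : Finset ℕ := {d ∈ Icc 1 D | Squarefree d ∧ D < 8 * d}

/-- The pairs `(d, a)` with `d` a squarefree modulus in `(D / 8, D]` and `0 ≤ a < d ^ k` such that
no `e ∣ d` with `e > 1` satisfies `e ^ k ∣ a`. They stand for the fractions `a / d ^ k`, whose
reduced denominator `q` has the property that `q ∣ δ ^ k` if and only if `d ∣ δ`. -/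
def majorPoints (k D : ℕ) : Finset (Σ _ : ℕ, ℕ) :=
  (majorModuli D).sigma fun d => {a ∈ range (d ^ k) | ∀ e ∈ d.divisors, 1 < e → ¬ e ^ k ∣ a}

/-- The fraction `a / d ^ k`. -/
noncomputable def fraction (k : ℕ) (x : Σ _ : ℕ, ℕ) : ℝ := (x.2 : ℝ) / (x.1 : ℝ) ^ k

lemma card_majorModuli_ge (D : ℕ) : (D : ℝ) / 8 ≤ #(majorModuli D) := by
  classical
  have h := card_kFree_ge le_rfl D
  have hsub : {n ∈ Icc 1 D | ∀ d, 1 < d → ¬ d ^ 2 ∣ n} ⊆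
      majorModuli D ∪ {n ∈ Icc 1 D | 8 * n ≤ D} := by
    intro n hn
    obtain ⟨h1, h2⟩ := mem_filter.1 hn
    by_cases h3 : 8 * n ≤ D
    · exact mem_union_right _ (mem_filter.2 ⟨h1, h3⟩)
    · refine mem_union_left _ (mem_filter.2 ⟨h1, fun x hx => ?_, by omega⟩)
      rw [← sq] at hx
      rw [mem_Icc] at h1
      have h4 : ¬ 1 < x := fun h => h2 x h hx
      have h5 : x ≠ 0 := by
        rintro rfl
        simp at hx
        omega
      rw [Nat.isUnit_iff]
      omega
  have h1 : (#{n ∈ Icc 1 D | ∀ d, 1 < d → ¬ d ^ 2 ∣ n} : ℝ) ≤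
      #(majorModuli D) + #{n ∈ Icc 1 D | 8 * n ≤ D} := by
    exact_mod_cast (card_le_card hsub).trans (card_union_le _ _)
  have h2 : (#{n ∈ Icc 1 D | 8 * n ≤ D} : ℝ) ≤ D / 8 := by
    refine card_le_of_forall_mem_pos (by positivity) fun m hm => ?_
    obtain ⟨h3, h4⟩ := mem_filter.1 hm
    refine ⟨(mem_Icc.1 h3).1, ?_⟩
    rw [le_div_iff₀ (by norm_num)]
    exact_mod_cast (by omega : m * 8 ≤ D)
  have h3 : (D : ℝ) / 4 ≤ #{n ∈ Icc 1 D | ∀ d, 1 < d → ¬ d ^ 2 ∣ n} := by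
    convert h
  linarith

lemma card_majorModuli_le (D : ℕ) : #(majorModuli D) ≤ D :=
  (card_filter_le _ _).trans (by simp)

lemma card_majorPoints_ge {k : ℕ} (hk : 2 ≤ k) (D : ℕ) :
    1 / (4 * 8 ^ (k + 1)) * (D : ℝ) ^ (k + 1) ≤ #(majorPoints k D) := by
  rw [majorPoints, card_sigma]
  push_cast
  calc 1 / (4 * 8 ^ (k + 1)) * (D : ℝ) ^ (k + 1) = D / 8 * ((D / 8 : ℝ) ^ k / 4) := by
        rw [div_pow, pow_succ, pow_succ]
        field_simp
    _ ≤ #(majorModuli D) * ((D / 8 : ℝ) ^ k / 4) := by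
        gcongr
        exact card_majorModuli_ge D
    _ = ∑ d ∈ majorModuli D, (D / 8 : ℝ) ^ k / 4 := by rw [sum_const, nsmul_eq_mul]
    _ ≤ _ := by
        refine sum_le_sum fun d hd => ?_
        obtain ⟨h1, h2, h3⟩ := mem_filter.1 hd
        refine le_trans ?_ (card_kFree_residues_ge hk (mem_Icc.1 h1).1)
        have : (D : ℝ) / 8 ≤ d := by
          rw [div_le_iff₀ (by norm_num)]
          exact_mod_cast (by omega : D ≤ d * 8)
        gcongr

/-- Pairs of distinct fractions with given denominators which are close to each other. There is no
term beside the expected one, since a nonzero difference is at least `1 / lcm(q₁, q₂)`. -/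
lemma card_close_fractions_le {q₁ q₂ : ℕ} (h₁ : 0 < q₁) (h₂ : 0 < q₂) {η : ℝ} (hη : 0 ≤ η) :
    (#{z ∈ range q₁ ×ˢ range q₂ | z.1 * q₂ ≠ z.2 * q₁ ∧
      |(z.1 : ℝ) / q₁ - z.2 / q₂| ≤ η} : ℝ) ≤ 2 * η * (q₁ * q₂) := by
  obtain ⟨g, r₁, r₂, hg, hcop, e₁, e₂⟩ := Nat.exists_coprime' (Nat.gcd_pos_of_pos_left q₂ h₁)
  have hr₁ : 0 < r₁ := Nat.pos_of_ne_zero fun h => by rw [e₁, h, zero_mul] at h₁; omega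
  have hr₂ : 0 < r₂ := Nat.pos_of_ne_zero fun h => by rw [e₂, h, zero_mul] at h₂; omega
  have hg' : (0 : ℝ) < g := by exact_mod_cast hg
  have hr₁' : (0 : ℝ) < r₁ := by exact_mod_cast hr₁
  have hr₂' : (0 : ℝ) < r₂ := by exact_mod_cast hr₂
  set Z : ℝ := η * (g * r₁ * r₂) with hZ
  have hZ0 : 0 ≤ Z := by positivity
  set A := {z ∈ range q₁ ×ˢ range q₂ | z.1 * q₂ ≠ z.2 * q₁ ∧ |(z.1 : ℝ) / q₁ - z.2 / q₂| ≤ η}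
  set B : Finset (ℤ × ℕ) := ((Icc (-(⌊Z⌋₊ : ℤ)) ⌊Z⌋₊).erase 0) ×ˢ range g
  -- the numerator of the difference and the quotient of `z.1` by `r₁` determine the pair
  have hcard : #A ≤ #B := by
    refine card_le_card_of_injOn (fun z => ((z.1 : ℤ) * r₂ - z.2 * r₁, z.1 / r₁)) ?_ ?_
    · intro z hz
      obtain ⟨h3, h4, h5⟩ := mem_filter.1 hz
      rw [mem_product, mem_range, mem_range] at h3
      simp only [B, coe_product, Set.mem_prod, mem_coe, mem_erase, mem_Icc, mem_range]
      refine ⟨⟨fun h => h4 ?_, ?_⟩, ?_⟩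
      · have h6 : (z.1 : ℤ) * r₂ = z.2 * r₁ := by linarith
        have h7 : z.1 * r₂ = z.2 * r₁ := by exact_mod_cast h6
        rw [e₁, e₂, ← mul_assoc, ← mul_assoc, h7]
      · have h6 : |(((z.1 : ℤ) * r₂ - z.2 * r₁ : ℤ) : ℝ)| ≤ Z := by
          have h7 : (((z.1 : ℤ) * r₂ - z.2 * r₁ : ℤ) : ℝ) =
              ((z.1 : ℝ) / q₁ - z.2 / q₂) * (g * r₁ * r₂) := by
            rw [e₁, e₂]
            push_cast
            field_simp
          rw [h7, abs_mul, abs_of_pos (show (0 : ℝ) < g * r₁ * r₂ by positivity), hZ]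
          exact mul_le_mul_of_nonneg_right h5 (by positivity)
        have h8 : ((((z.1 : ℤ) * r₂ - z.2 * r₁).natAbs : ℕ) : ℝ) ≤ Z := by
          rw [Nat.cast_natAbs]
          push_cast at h6 ⊢
          exact h6
        have h9 := Nat.le_floor h8
        omega
      · rw [Nat.div_lt_iff_lt_mul hr₁, mul_comm g, ← e₁]
        exact h3.1
    · intro z hz w hw h
      simp only [Prod.mk.injEq] at h
      obtain ⟨h6, h7⟩ := h
      have h8 : (r₁ : ℤ) ∣ (z.1 - w.1) * r₂ := ⟨z.2 - w.2, by linarith⟩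
      have h9 : (r₁ : ℤ) ∣ (z.1 - w.1) :=
        IsCoprime.dvd_of_dvd_mul_right (Nat.isCoprime_iff_coprime.2 hcop) h8
      have h10 : z.1 ≡ w.1 [MOD r₁] := ((Nat.modEq_iff_dvd).2 h9).symm
      have h11 : z.1 = w.1 := by
        rw [← Nat.div_add_mod z.1 r₁, ← Nat.div_add_mod w.1 r₁, h7, h10]
      have h12 : (z.2 : ℤ) * r₁ = w.2 * r₁ := by
        rw [h11] at h6
        linarith
      have h13 : z.2 = w.2 := by
        have := mul_right_cancel₀ (show (r₁ : ℤ) ≠ 0 by exact_mod_cast hr₁.ne') h12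
        exact_mod_cast this
      exact Prod.ext h11 h13
  have hB : #B = 2 * ⌊Z⌋₊ * g := by
    rw [card_product, card_range, card_erase_of_mem (by rw [mem_Icc]; omega), Int.card_Icc]
    congr 1
    omega
  have h3 : (#A : ℝ) ≤ 2 * ⌊Z⌋₊ * g := by
    rw [hB] at hcard
    exact_mod_cast hcard
  calc (#A : ℝ) ≤ 2 * ⌊Z⌋₊ * g := h3
    _ ≤ 2 * Z * g := by
        gcongr
        exact Nat.floor_le hZ0
    _ = 2 * η * (q₁ * q₂) := by
        rw [hZ, e₁, e₂]
        push_cast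
        ring

lemma mem_majorPoints {k D : ℕ} {x : Σ _ : ℕ, ℕ} : x ∈ majorPoints k D ↔
    (1 ≤ x.1 ∧ x.1 ≤ D ∧ Squarefree x.1 ∧ D < 8 * x.1) ∧
      x.2 < x.1 ^ k ∧ ∀ e ∈ x.1.divisors, 1 < e → ¬ e ^ k ∣ x.2 := by
  rw [majorPoints, mem_sigma, majorModuli, mem_filter, mem_filter, mem_Icc, mem_range]
  tauto

open scoped Classical in
/-- The points of `majorPoints k D` that are at distance more than `η` from the others. -/
noncomputable def isolatedPoints (k D : ℕ) (η : ℝ) : Finset (Σ _ : ℕ, ℕ) :=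
  {x ∈ majorPoints k D | ∀ y ∈ majorPoints k D, y ≠ x → η < |fraction k x - fraction k y|}

lemma lt_abs_fraction_sub {k D : ℕ} {η : ℝ} {x y : Σ _ : ℕ, ℕ} (hx : x ∈ isolatedPoints k D η)
    (hy : y ∈ majorPoints k D) (hyx : y ≠ x) : η < |fraction k x - fraction k y| :=
  (mem_filter.1 hx).2 y hy hyx

/-- The number of points with a close neighbour is at most the number of close pairs. -/
lemma card_isolatedPoints_ge {k D : ℕ} {η : ℝ} (hη0 : 0 ≤ η) :
    (#(majorPoints k D) : ℝ) - 2 * η * (D : ℝ) ^ (2 * k + 2) ≤ #(isolatedPoints k D η) := by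
  classical
  set P := {z ∈ majorPoints k D ×ˢ majorPoints k D | z.2 ≠ z.1 ∧
    |fraction k z.1 - fraction k z.2| ≤ η} with hP
  have hcover : majorPoints k D ⊆ isolatedPoints k D η ∪ P.image Prod.fst := by
    intro x hx
    by_cases h : ∀ y ∈ majorPoints k D, y ≠ x → η < |fraction k x - fraction k y|
    · exact mem_union_left _ (mem_filter.2 ⟨hx, h⟩)
    · push Not at h
      obtain ⟨y, hy, hyx, hxy⟩ := h
      exact mem_union_right _ (mem_image.2 ⟨(x, y),
        mem_filter.2 ⟨mem_product.2 ⟨hx, hy⟩, hyx, hxy⟩, rfl⟩)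
  have h1 : (#(majorPoints k D) : ℝ) ≤ #(isolatedPoints k D η) + #P := by
    have := (card_le_card hcover).trans ((card_union_le _ _).trans
      (Nat.add_le_add_left card_image_le _))
    exact_mod_cast this
  have h2 : #P ≤ ⌊2 * η * (D : ℝ) ^ (2 * k)⌋₊ * #(P.image fun z => (z.1.1, z.2.1)) := by
    refine card_le_mul_card_image _ _ fun d hd => ?_
    obtain ⟨z₀, hz₀, rfl⟩ := mem_image.1 hd
    obtain ⟨hz₁, -⟩ := mem_filter.1 hz₀
    rw [mem_product, mem_majorPoints, mem_majorPoints] at hz₁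
    set d₁ := z₀.1.1
    set d₂ := z₀.2.1
    have hd₁ : 0 < d₁ := hz₁.1.1.1
    have hd₂ : 0 < d₂ := hz₁.2.1.1
    have hd₁' : (0 : ℝ) < d₁ := by exact_mod_cast hd₁
    have hd₂' : (0 : ℝ) < d₂ := by exact_mod_cast hd₂
    have hd₁D : (d₁ : ℝ) ≤ D := by exact_mod_cast hz₁.1.1.2.1
    have hd₂D : (d₂ : ℝ) ≤ D := by exact_mod_cast hz₁.2.1.2.1
    refine Nat.le_floor ?_
    have h3 := card_close_fractions_le (pow_pos hd₁ k) (pow_pos hd₂ k) hη0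
    have h4 : #{z ∈ P | (z.1.1, z.2.1) = (d₁, d₂)} ≤
        #{z ∈ range (d₁ ^ k) ×ˢ range (d₂ ^ k) | z.1 * d₂ ^ k ≠ z.2 * d₁ ^ k ∧
          |(z.1 : ℝ) / (d₁ ^ k : ℕ) - z.2 / (d₂ ^ k : ℕ)| ≤ η} := by
      refine card_le_card_of_injOn (fun z => (z.1.2, z.2.2)) ?_ ?_
      · intro z hz
        obtain ⟨hzP, hzd⟩ := mem_filter.1 hz
        obtain ⟨hz1, hz2, hz3⟩ := mem_filter.1 hzP
        rw [mem_product, mem_majorPoints, mem_majorPoints] at hz1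
        simp only [Prod.mk.injEq] at hzd
        obtain ⟨⟨e₁, a₁⟩, ⟨e₂, a₂⟩⟩ := z
        simp only at hzd hz1 hz2
        obtain ⟨rfl, rfl⟩ := hzd
        simp only [fraction] at hz3
        simp only [coe_filter, mem_product, mem_range, Set.mem_ofPred_eq]
        refine ⟨⟨hz1.1.2.1, hz1.2.2.1⟩, fun heq => ?_, by push_cast; exact hz3⟩
        have hdvd₁ : d₁ ∣ d₂ := dvd_of_pow_dvd_mul_pow hd₁ hz1.1.2.2 ⟨a₂, by rw [heq]; ring⟩
        have hdvd₂ : d₂ ∣ d₁ := dvd_of_pow_dvd_mul_pow hd₂ hz1.2.2.2 ⟨a₁, by rw [← heq]; ring⟩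
        have hdd : d₁ = d₂ := Nat.dvd_antisymm hdvd₁ hdvd₂
        apply hz2
        rw [hdd] at heq ⊢
        have := Nat.eq_of_mul_eq_mul_right (pow_pos hd₂ k) heq
        rw [this]
      · intro z hz w hw h
        have hz' := (mem_filter.1 hz).2
        have hw' := (mem_filter.1 hw).2
        simp only [Prod.mk.injEq] at hz' hw' h
        obtain ⟨⟨e₁, a₁⟩, ⟨e₂, a₂⟩⟩ := z
        obtain ⟨⟨f₁, b₁⟩, ⟨f₂, b₂⟩⟩ := w
        simp only at hz' hw' h
        obtain ⟨rfl, rfl⟩ := h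
        rw [hz'.1, hz'.2, hw'.1, hw'.2]
    calc (#{z ∈ P | (z.1.1, z.2.1) = (d₁, d₂)} : ℝ) ≤ 2 * η * ((d₁ ^ k : ℕ) * (d₂ ^ k : ℕ)) :=
          (Nat.cast_le.2 h4).trans h3
      _ ≤ 2 * η * ((D : ℝ) ^ k * (D : ℝ) ^ k) := by
          push_cast
          gcongr
      _ = 2 * η * (D : ℝ) ^ (2 * k) := by ring
  have h3 : #(P.image fun z => (z.1.1, z.2.1)) ≤ D * D := by
    have hsub : (P.image fun z => (z.1.1, z.2.1)) ⊆ Icc 1 D ×ˢ Icc 1 D := by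
      intro d hd
      obtain ⟨z, hz, rfl⟩ := mem_image.1 hd
      have hz1 := (mem_filter.1 hz).1
      rw [mem_product, mem_majorPoints, mem_majorPoints] at hz1
      simp only [mem_product, mem_Icc]
      exact ⟨⟨hz1.1.1.1, hz1.1.1.2.1⟩, ⟨hz1.2.1.1, hz1.2.1.2.1⟩⟩
    refine (card_le_card hsub).trans ?_
    simp
  have h4 : (#P : ℝ) ≤ 2 * η * (D : ℝ) ^ (2 * k + 2) := by
    calc (#P : ℝ) ≤ (⌊2 * η * (D : ℝ) ^ (2 * k)⌋₊ : ℝ) * (D * D : ℕ) := by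
          exact_mod_cast h2.trans (Nat.mul_le_mul_left _ h3)
      _ ≤ 2 * η * (D : ℝ) ^ (2 * k) * (D * D : ℕ) := by
          gcongr
          exact Nat.floor_le (by positivity)
      _ = _ := by
          push_cast
          ring
  linarith

/-! ### Integrals over separated arcs -/

/-- The arcs `(x i, x i + r]` of points with distances more than `r` are disjoint. -/
lemma sum_integral_arcs_le {ι : Type*} {X : Finset ι} {x : ι → ℝ} {r : ℝ} (hr : 0 ≤ r)
    (hx0 : ∀ i ∈ X, 0 ≤ x i) (hx1 : ∀ i ∈ X, x i + r ≤ 1)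
    (hsep : ∀ i ∈ X, ∀ j ∈ X, j ≠ i → r < |x i - x j|) {f : ℝ → ℝ} (hf0 : ∀ α, 0 ≤ f α)
    (hf : IntervalIntegrable f volume 0 1) :
    ∑ i ∈ X, ∫ β in (0 : ℝ)..r, f (x i + β) ≤ ∫ α in (0 : ℝ)..1, f α := by
  have hf' : IntegrableOn f (Set.Ioc 0 1) :=
    (intervalIntegrable_iff_integrableOn_Ioc_of_le zero_le_one).1 hf
  have hsub : ∀ i ∈ X, Set.Ioc (x i) (x i + r) ⊆ Set.Ioc 0 1 := fun i hi =>
    Set.Ioc_subset_Ioc (hx0 i hi) (hx1 i hi)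
  have h1 : ∀ i ∈ X, ∫ β in (0 : ℝ)..r, f (x i + β) = ∫ α in Set.Ioc (x i) (x i + r), f α := by
    intro i _
    rw [intervalIntegral.integral_comp_add_left, add_zero,
      intervalIntegral.integral_of_le (by linarith)]
  rw [sum_congr rfl h1, ← integral_biUnion_finset X (fun i _ => measurableSet_Ioc) ?_
    fun i hi => hf'.mono_set (hsub i hi), intervalIntegral.integral_of_le zero_le_one]
  · refine setIntegral_mono_set hf' (Filter.Eventually.of_forall hf0)
      (Filter.Eventually.of_forall ?_)
    exact Set.iUnion₂_subset hsub
  · intro i hi j hj hij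
    rw [Function.onFun, Set.disjoint_left]
    intro α hα hα'
    have := hsep i hi j hj hij.symm
    rw [lt_abs] at this
    rcases this with h | h <;> linarith [hα.1, hα.2, hα'.1, hα'.2]

/-! ### The smoothed sum and its decomposition -/

/-- The sum `∑ μ_k(n) sin(πn / N) e(αn)` over `1 ≤ n ≤ N`. -/
noncomputable def sineSum (k N : ℕ) : ℝ → ℂ :=
  trigPoly (Icc 1 N) fun n => kFreeIndicator k n * ((Real.sin (π * n / N) : ℝ) : ℂ)

@[fun_prop] lemma continuous_sineSum (k N : ℕ) : Continuous (sineSum k N) := continuous_trigPoly _ _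

lemma sineSum_eq {k : ℕ} (hk : k ≠ 0) (N Δ : ℕ) (α : ℝ) :
    sineSum k N α =
      ∑ δ ∈ Icc 1 Δ, (ArithmeticFunction.moebius δ : ℂ) * waveSum N (δ ^ k) α +
        powerSum k N (fun t => Real.sin (π * t / N)) (Icc (Δ + 1) (Δ + N)) α := by
  have h1 : ∑ δ ∈ Icc 1 Δ, (ArithmeticFunction.moebius δ : ℂ) * waveSum N (δ ^ k) α =
      powerSum k N (fun t => Real.sin (π * t / N)) (Icc 1 Δ) α := by
    rw [powerSum_eq]
    rfl
  rw [h1]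
  simp only [powerSum, trigPoly, sineSum]
  rw [← sum_add_distrib]
  refine sum_congr rfl fun n hn => ?_
  rw [mem_Icc] at hn
  have hu : Icc 1 (Δ + N) = Icc 1 Δ ∪ Icc (Δ + 1) (Δ + N) := by
    ext d
    simp only [mem_Icc, mem_union]
    omega
  have hdisj : Disjoint (Icc 1 Δ) (Icc (Δ + 1) (Δ + N)) := by
    rw [Finset.disjoint_left]
    intro d hd hd'
    rw [mem_Icc] at hd hd'
    omega
  rw [kFreeIndicator_eq_sum hk hn.1 (show n ≤ Δ + N by omega), hu, filter_union,
    sum_union (disjoint_filter_filter hdisj)]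
  ring

/-! ### The size of the smoothed sum near the fractions with `k`-th power denominators -/

/-- Near `a / d ^ k` the terms of index `δ = d e` have the same shape for all `e`, and the term
`e = 1` dominates since `∑ e ^ (-k)` over `e ≥ 2` is less than `1`. -/
lemma le_norm_sum_multiples {k D Δ N : ℕ} (hk : 2 ≤ k) (hD : 0 < D) (hDΔ : D ≤ Δ)
    (hΔ : 5 * Δ ^ k ≤ N) {x : Σ _ : ℕ, ℕ} (hx : x ∈ majorPoints k D) {β : ℝ} (hβ0 : 0 ≤ β)
    (hβ : β ≤ 1 / (20 * N)) :
    (N : ℝ) / (16 * D ^ k) ≤ ‖∑ δ ∈ Icc 1 Δ with x.1 ∣ δ,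
      (ArithmeticFunction.moebius δ : ℂ) * waveSum N (δ ^ k) (fraction k x + β)‖ := by
  classical
  obtain ⟨⟨hd1, hdD, hsq, -⟩, ha, -⟩ := mem_majorPoints.1 hx
  set d := x.1
  have hd' : (0 : ℝ) < d := by exact_mod_cast hd1
  have hdD' : (d : ℝ) ≤ D := by exact_mod_cast hdD
  have hpow : ∀ δ ≤ Δ, 5 * δ ^ k ≤ N := fun δ hδ =>
    (Nat.mul_le_mul_left 5 (Nat.pow_le_pow_left hδ k)).trans hΔ
  have hmem : d ∈ {δ ∈ Icc 1 Δ | d ∣ δ} :=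
    mem_filter.2 ⟨mem_Icc.2 ⟨hd1, hdD.trans hDΔ⟩, dvd_rfl⟩
  set W : ℝ := 2 / π * (N / (d : ℝ) ^ k) with hW
  have hW0 : 0 ≤ W := by positivity
  have hmain : W * (7 / 8) ≤
      ‖(ArithmeticFunction.moebius d : ℂ) * waveSum N (d ^ k) (fraction k x + β)‖ := by
    rw [norm_mul, Complex.norm_intCast, ← Int.cast_abs,
      ArithmeticFunction.abs_moebius_eq_one_of_squarefree hsq, Int.cast_one, one_mul]
    have h := le_norm_waveSum (y := fraction k x) (t := x.2) (pow_pos hd1 k)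
      (hpow d (hdD.trans hDΔ)) (by
        rw [fraction, Nat.cast_pow]
        exact div_mul_cancel₀ _ (pow_pos hd' k).ne') hβ0 hβ
    push_cast at h
    exact h
  have hrest : ‖∑ δ ∈ {δ ∈ Icc 1 Δ | d ∣ δ}.erase d,
      (ArithmeticFunction.moebius δ : ℂ) * waveSum N (δ ^ k) (fraction k x + β)‖ ≤ W * (3 / 4) := by
    refine (norm_sum_le _ _).trans ?_
    calc _ ≤ ∑ δ ∈ {δ ∈ Icc 1 Δ | d ∣ δ}.erase d, 2 / π * ((N : ℝ) / (δ : ℝ) ^ k) := by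
          refine sum_le_sum fun δ hδ => ?_
          obtain ⟨-, hδ⟩ := mem_erase.1 hδ
          have h1 := mem_Icc.1 (mem_filter.1 hδ).1
          rw [norm_mul]
          have h2 := norm_waveSum_le (N := N) (pow_pos (show 0 < δ by omega) k)
            (by have := hpow δ h1.2; omega) (fraction k x + β)
          push_cast at h2
          calc _ ≤ 1 * (2 / π * ((N : ℝ) / (δ : ℝ) ^ k)) := by
                gcongr
                exact norm_moebius_le δ
            _ = _ := one_mul _
      _ ≤ ∑ δ ∈ (Icc 2 Δ).image (d * ·), 2 / π * ((N : ℝ) / (δ : ℝ) ^ k) := by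
          refine sum_le_sum_of_subset_of_nonneg (fun δ hδ => ?_) fun _ _ _ => by positivity
          obtain ⟨hne, hδ⟩ := mem_erase.1 hδ
          obtain ⟨h1, e, rfl⟩ := mem_filter.1 hδ
          rw [mem_Icc] at h1
          refine mem_image.2 ⟨e, mem_Icc.2 ⟨?_, ?_⟩, rfl⟩
          · by_contra h
            have : e = 0 ∨ e = 1 := by omega
            rcases this with rfl | rfl <;> simp at hne h1
          · exact (Nat.le_mul_of_pos_left e hd1).trans h1.2
      _ = ∑ e ∈ Icc 2 Δ, W * ((e : ℝ) ^ k)⁻¹ := by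
          rw [sum_image fun a _ b _ h => Nat.eq_of_mul_eq_mul_left hd1 h]
          refine sum_congr rfl fun e he => ?_
          have : (0 : ℝ) < e := by
            have := (mem_Icc.1 he).1
            exact_mod_cast (by omega : 0 < e)
          rw [hW]
          push_cast
          rw [mul_pow]
          field_simp
      _ ≤ W * (3 / 4) := by
          rw [← mul_sum]
          gcongr
          exact sum_inv_pow_two_le hk Δ
  have hfin : (N : ℝ) / (16 * D ^ k) ≤ W / 8 := by
    have hpi := Real.pi_le_four
    calc (N : ℝ) / (16 * D ^ k) = 2 / 4 * (N / (D : ℝ) ^ k) / 8 := by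
          rw [mul_comm (16 : ℝ), ← div_div]
          ring
      _ ≤ W / 8 := by
          rw [hW]
          gcongr
  rw [← add_sum_erase _ _ hmem]
  have := norm_sub_le_norm_add
    ((ArithmeticFunction.moebius d : ℂ) * waveSum N (d ^ k) (fraction k x + β))
    (∑ δ ∈ {δ ∈ Icc 1 Δ | d ∣ δ}.erase d,
      (ArithmeticFunction.moebius δ : ℂ) * waveSum N (δ ^ k) (fraction k x + β))
  linarith

/-- The contribution near `x` of the indices `δ ≤ Δ` which are not multiples of the modulus. -/
noncomputable def arcError (k N Δ : ℕ) (x : Σ _ : ℕ, ℕ) (β : ℝ) : ℝ :=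
  ∑ δ ∈ Icc 1 Δ with ¬ x.1 ∣ δ, ‖waveSum N (δ ^ k) (fraction k x + β)‖

@[fun_prop] lemma continuous_arcError (k N Δ : ℕ) (x : Σ _ : ℕ, ℕ) :
    Continuous (arcError k N Δ x) := by
  unfold arcError
  fun_prop

lemma arcError_nonneg (k N Δ : ℕ) (x : Σ _ : ℕ, ℕ) (β : ℝ) : 0 ≤ arcError k N Δ x β :=
  sum_nonneg fun _ _ => norm_nonneg _

lemma le_norm_sineSum_add {k D Δ N : ℕ} (hk : 2 ≤ k) (hD : 0 < D) (hDΔ : D ≤ Δ)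
    (hΔ : 5 * Δ ^ k ≤ N) {x : Σ _ : ℕ, ℕ} (hx : x ∈ majorPoints k D) {β : ℝ} (hβ0 : 0 ≤ β)
    (hβ : β ≤ 1 / (20 * N)) :
    (N : ℝ) / (16 * D ^ k) ≤ ‖sineSum k N (fraction k x + β)‖ + arcError k N Δ x β +
      ‖powerSum k N (fun t => Real.sin (π * t / N)) (Icc (Δ + 1) (Δ + N)) (fraction k x + β)‖ := by
  have h := le_norm_sum_multiples hk hD hDΔ hΔ hx hβ0 hβ
  have e := sineSum_eq (show k ≠ 0 by omega) N Δ (fraction k x + β)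
  rw [← sum_filter_add_sum_filter_not (Icc 1 Δ) (fun δ => x.1 ∣ δ)] at e
  set A := ∑ δ ∈ Icc 1 Δ with x.1 ∣ δ,
      (ArithmeticFunction.moebius δ : ℂ) * waveSum N (δ ^ k) (fraction k x + β)
  set B := ∑ δ ∈ Icc 1 Δ with ¬ x.1 ∣ δ,
      (ArithmeticFunction.moebius δ : ℂ) * waveSum N (δ ^ k) (fraction k x + β) with hB
  set T := powerSum k N (fun t => Real.sin (π * t / N)) (Icc (Δ + 1) (Δ + N)) (fraction k x + β)
  have hBE : ‖B‖ ≤ arcError k N Δ x β := by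
    refine (norm_sum_le _ _).trans (sum_le_sum fun δ _ => ?_)
    rw [norm_mul]
    exact mul_le_of_le_one_left (norm_nonneg _) (norm_moebius_le δ)
  have e' : A = sineSum k N (fraction k x + β) - B - T := by
    rw [e]
    ring
  rw [e'] at h
  have h1 := norm_sub_le (sineSum k N (fraction k x + β) - B) T
  have h2 := norm_sub_le (sineSum k N (fraction k x + β)) B
  linarith

/-- If `d ∤ δ` then `a δ ^ k / d ^ k` is not an integer, so `a / d ^ k` is off the peaks of the wave
over multiples of `δ ^ k`. -/
lemma sum_arcError_le {k D Δ N : ℕ} (hΔ : Δ ^ k ≤ N) {β : ℝ} (hβ0 : 0 ≤ β)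
    (hβ : β ≤ 1 / (20 * N)) :
    ∑ x ∈ majorPoints k D, arcError k N Δ x β ≤ 14 * Δ * (D : ℝ) ^ (k + 1) := by
  rw [majorPoints, sum_sigma]
  have hmod : ∀ d ∈ majorModuli D,
      ∑ a ∈ range (d ^ k) with ∀ e ∈ d.divisors, 1 < e → ¬ e ^ k ∣ a,
        arcError k N Δ ⟨d, a⟩ β ≤ 14 * Δ * (D : ℝ) ^ k := by
    intro d hd
    obtain ⟨h1, -⟩ := mem_filter.1 hd
    rw [mem_Icc] at h1
    have hdD : (d : ℝ) ≤ D := by exact_mod_cast h1.2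
    simp only [arcError]
    rw [sum_comm' (t' := {δ ∈ Icc 1 Δ | ¬ d ∣ δ})
      (s' := fun _ => {a ∈ range (d ^ k) | ∀ e ∈ d.divisors, 1 < e → ¬ e ^ k ∣ a})
      (fun a δ => by tauto)]
    calc _ ≤ ∑ δ ∈ Icc 1 Δ with ¬ d ∣ δ, 14 * (D : ℝ) ^ k := by
          refine sum_le_sum fun δ hδ => ?_
          obtain ⟨h2, h3⟩ := mem_filter.1 hδ
          rw [mem_Icc] at h2
          have h4 := sum_norm_waveSum_le (N := N) (q := d ^ k) (pow_pos (show 0 < δ by omega) k)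
            ((Nat.pow_le_pow_left h2.2 k).trans hΔ) (pow_pos (show 0 < d by omega) k) hβ0 hβ
          calc _ ≤ ∑ a ∈ range (d ^ k) with ¬ d ^ k ∣ a * δ ^ k,
                ‖waveSum N (δ ^ k) (a / (d ^ k : ℕ) + β)‖ := by
                push_cast
                refine sum_le_sum_of_subset_of_nonneg (fun a ha => ?_)
                  fun _ _ _ => norm_nonneg _
                obtain ⟨h5, h6⟩ := mem_filter.1 ha
                exact mem_filter.2 ⟨h5, fun h => h3 (dvd_of_pow_dvd_mul_pow h1.1 h6 h)⟩
            _ ≤ 14 * (d ^ k : ℕ) := h4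
            _ ≤ 14 * (D : ℝ) ^ k := by
                push_cast
                gcongr
      _ = #{δ ∈ Icc 1 Δ | ¬ d ∣ δ} * (14 * (D : ℝ) ^ k) := by rw [sum_const, nsmul_eq_mul]
      _ ≤ Δ * (14 * (D : ℝ) ^ k) := by
          gcongr
          exact (card_filter_le _ _).trans (by simp)
      _ = _ := by ring
  calc _ ≤ ∑ d ∈ majorModuli D, 14 * Δ * (D : ℝ) ^ k := sum_le_sum hmod
    _ = #(majorModuli D) * (14 * Δ * (D : ℝ) ^ k) := by rw [sum_const, nsmul_eq_mul]
    _ ≤ D * (14 * Δ * (D : ℝ) ^ k) := by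
        gcongr
        exact card_majorModuli_le D
    _ = _ := by ring

/-! ### Level sets -/

open scoped Classical in
/-- The indicator function of the level set `{α | t ≤ ‖f α‖}`. -/
noncomputable def levelIndicator (f : ℝ → ℂ) (t α : ℝ) : ℝ := if t ≤ ‖f α‖ then 1 else 0

lemma levelIndicator_nonneg (f : ℝ → ℂ) (t α : ℝ) : 0 ≤ levelIndicator f t α := by
  unfold levelIndicator
  split_ifs <;> norm_num

lemma levelIndicator_le_one (f : ℝ → ℂ) (t α : ℝ) : levelIndicator f t α ≤ 1 := by
  unfold levelIndicator
  split_ifs <;> norm_num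

lemma intervalIntegrable_levelIndicator {f : ℝ → ℂ} (hf : Continuous f) (t a b : ℝ) :
    IntervalIntegrable (levelIndicator f t) volume a b := by
  classical
  have hm : Measurable (levelIndicator f t) := by
    unfold levelIndicator
    exact Measurable.ite (measurableSet_le measurable_const hf.norm.measurable) measurable_const
      measurable_const
  refine (intervalIntegrable_const (c := (1 : ℝ))).mono_fun hm.aestronglyMeasurable
    (Filter.Eventually.of_forall fun α => ?_)
  simp only [norm_one]
  rw [norm_eq_abs, abs_of_nonneg (levelIndicator_nonneg _ _ _)]
  exact levelIndicator_le_one _ _ _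

lemma periodic_levelIndicator {f : ℝ → ℂ} (hf : Function.Periodic f 1) (t : ℝ) :
    Function.Periodic (levelIndicator f t) 1 := fun α => by
  simp only [levelIndicator, hf α]

/-- Chebyshev's inequality in pointwise form, with two error terms. -/
lemma one_le_levelIndicator_add {f : ℝ → ℂ} {α Λ E T : ℝ} (hΛ : 0 < Λ) (hE : 0 ≤ E) (hT : 0 ≤ T)
    (h : Λ ≤ ‖f α‖ + E + T) :
    1 ≤ levelIndicator f (Λ / 2) α + 4 / Λ * E + 16 / Λ ^ 2 * T ^ 2 := by
  unfold levelIndicator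
  have h1 : 0 ≤ 4 / Λ * E := by positivity
  have h2 : 0 ≤ 16 / Λ ^ 2 * T ^ 2 := by positivity
  split_ifs with h3
  · linarith
  · rcases le_total (Λ / 4) E with h4 | h4
    · have : 1 ≤ 4 / Λ * E := by
        rw [div_mul_eq_mul_div, one_le_div hΛ]
        linarith
      linarith
    · have h5 : Λ / 4 ≤ T := by linarith
      have : 1 ≤ 16 / Λ ^ 2 * T ^ 2 := by
        rw [div_mul_eq_mul_div, one_le_div (by positivity)]
        nlinarith
      linarith

/-- The pointwise bound `one_le_levelIndicator_add`, integrated over the disjoint arcs of length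
`1 / (20 N)` to the right of the isolated points. -/
lemma card_isolatedPoints_mul_le {k D Δ N : ℕ} (hk : 2 ≤ k) (hD : 0 < D) (hDΔ : D ≤ Δ)
    (hΔ : 5 * Δ ^ k ≤ N) :
    #(isolatedPoints k D (1 / (20 * N))) * (1 / (20 * N)) ≤
      (∫ α in (0 : ℝ)..1, levelIndicator (sineSum k N) (N / (32 * D ^ k)) α) +
      64 * D ^ k / N * (14 * Δ * (D : ℝ) ^ (k + 1) * (1 / (20 * N))) +
      4096 * D ^ (2 * k) / N ^ 2 * (12 * N / ((Δ : ℝ) + 1) ^ (k - 1)) := by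
  classical
  have hΔ1 : 1 ≤ Δ ^ k := Nat.one_le_pow _ _ (by omega)
  have hN : (0 : ℝ) < N := by exact_mod_cast (by omega : 0 < N)
  have hD' : (0 : ℝ) < D := by exact_mod_cast hD
  set r : ℝ := 1 / (20 * N) with hr
  have hr0 : 0 < r := by positivity
  set X := isolatedPoints k D r
  have hXsub : X ⊆ majorPoints k D := filter_subset _ _
  set Λ : ℝ := N / (16 * D ^ k) with hΛd
  have hΛ : 0 < Λ := by positivity
  have hΛ2 : (N : ℝ) / (32 * D ^ k) = Λ / 2 := by
    rw [hΛd]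
    field_simp
    norm_num
  set T := powerSum k N (fun t => Real.sin (π * t / N)) (Icc (Δ + 1) (Δ + N)) with hTd
  have hTc : Continuous T := continuous_powerSum _ _ _ _
  set F : ℝ → ℝ := fun α => levelIndicator (sineSum k N) (Λ / 2) α + 16 / Λ ^ 2 * ‖T α‖ ^ 2 with hF
  have hF0 : ∀ α, 0 ≤ F α := fun α =>
    add_nonneg (levelIndicator_nonneg _ _ _) (by positivity)
  have hTi : ∀ a b, IntervalIntegrable (fun α => 16 / Λ ^ 2 * ‖T α‖ ^ 2) volume a b := fun a b =>
    (by fun_prop : Continuous fun α => 16 / Λ ^ 2 * ‖T α‖ ^ 2).intervalIntegrable a b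
  have hFi : ∀ a b, IntervalIntegrable F volume a b := fun a b =>
    (intervalIntegrable_levelIndicator (continuous_sineSum k N) _ a b).add (hTi a b)
  have hFx : ∀ x, IntervalIntegrable (fun β => F (fraction k x + β)) volume 0 r := fun x => by
    have := (hFi (fraction k x + 0) (fraction k x + r)).comp_add_left (c := fraction k x)
    simpa using this
  have hEi : ∀ x, IntervalIntegrable (fun β => 4 / Λ * arcError k N Δ x β) volume 0 r := fun x =>
    (by fun_prop : Continuous fun β => 4 / Λ * arcError k N Δ x β).intervalIntegrable _ _
  have hpt : ∀ x ∈ X, r ≤ (∫ β in (0 : ℝ)..r, F (fraction k x + β)) +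
      ∫ β in (0 : ℝ)..r, 4 / Λ * arcError k N Δ x β := by
    intro x hx
    rw [← intervalIntegral.integral_add (hFx x) (hEi x)]
    calc r = ∫ β in (0 : ℝ)..r, (1 : ℝ) := by simp
      _ ≤ _ := by
        refine intervalIntegral.integral_mono_on hr0.le intervalIntegrable_const
          ((hFx x).add (hEi x)) fun β hβ => ?_
        have h := one_le_levelIndicator_add hΛ (arcError_nonneg k N Δ x β) (norm_nonneg _)
          (le_norm_sineSum_add hk hD hDΔ hΔ (hXsub hx) hβ.1 hβ.2)
        simp only [hF]
        linarith
  have harcs : ∑ x ∈ X, ∫ β in (0 : ℝ)..r, F (fraction k x + β) ≤ ∫ α in (0 : ℝ)..1, F α := by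
    refine sum_integral_arcs_le hr0.le (fun x _ => by unfold fraction; positivity)
      (fun x hx => ?_) (fun x hx y hy hyx => lt_abs_fraction_sub hx (hXsub hy) hyx) hF0 (hFi 0 1)
    obtain ⟨⟨h1, h2, -⟩, h3, -⟩ := mem_majorPoints.1 (hXsub hx)
    have h4 : (0 : ℝ) < (x.1 : ℝ) ^ k := by
      have : (0 : ℝ) < x.1 := by exact_mod_cast h1
      positivity
    have h5 : (x.2 : ℝ) + 1 ≤ (x.1 : ℝ) ^ k := by exact_mod_cast h3
    have h6 : r ≤ 1 / (x.1 : ℝ) ^ k := by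
      rw [hr]
      have : x.1 ^ k ≤ N := by
        have := Nat.pow_le_pow_left (h2.trans hDΔ) k
        omega
      have : (x.1 : ℝ) ^ k ≤ N := by exact_mod_cast this
      gcongr
      linarith
    calc fraction k x + r ≤ x.2 / (x.1 : ℝ) ^ k + 1 / (x.1 : ℝ) ^ k := by
          rw [fraction]
          gcongr
      _ = ((x.2 : ℝ) + 1) / (x.1 : ℝ) ^ k := by rw [add_div]
      _ ≤ 1 := by rwa [div_le_one h4]
  have herr : ∑ x ∈ X, ∫ β in (0 : ℝ)..r, 4 / Λ * arcError k N Δ x β ≤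
      4 / Λ * (14 * Δ * (D : ℝ) ^ (k + 1) * r) := by
    calc _ = ∫ β in (0 : ℝ)..r, ∑ x ∈ X, 4 / Λ * arcError k N Δ x β :=
          (intervalIntegral.integral_finsetSum fun x _ => hEi x).symm
      _ ≤ ∫ β in (0 : ℝ)..r, 4 / Λ * (14 * Δ * (D : ℝ) ^ (k + 1)) := by
          refine intervalIntegral.integral_mono_on hr0.le ?_ intervalIntegrable_const
            fun β hβ => ?_
          · exact (by fun_prop : Continuous fun β => ∑ x ∈ X, 4 / Λ * arcError k N Δ x β
              ).intervalIntegrable _ _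
          · rw [← mul_sum]
            gcongr
            refine le_trans ?_ (sum_arcError_le (by omega) hβ.1 hβ.2)
            exact sum_le_sum_of_subset_of_nonneg hXsub fun x _ _ => arcError_nonneg _ _ _ _ _
      _ = _ := by
          rw [intervalIntegral.integral_const, smul_eq_mul]
          ring
  have htail : ∫ α in (0 : ℝ)..1, ‖T α‖ ^ 2 ≤ 12 * N / ((Δ : ℝ) + 1) ^ (k - 1) := by
    have h := integral_norm_sq_powerSum_Icc_le (N := N) (w := fun t => Real.sin (π * t / N))
      (fun t => Real.abs_sin_le_one _) hk (D := Δ + 1) (by omega) (Δ + N)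
    push_cast at h
    exact h
  have hsum : #X * r ≤ (∫ α in (0 : ℝ)..1, F α) + 4 / Λ * (14 * Δ * (D : ℝ) ^ (k + 1) * r) := by
    have h := sum_le_sum hpt
    rw [sum_const, nsmul_eq_mul, sum_add_distrib] at h
    linarith
  have hFint : ∫ α in (0 : ℝ)..1, F α =
      (∫ α in (0 : ℝ)..1, levelIndicator (sineSum k N) (Λ / 2) α) +
        16 / Λ ^ 2 * ∫ α in (0 : ℝ)..1, ‖T α‖ ^ 2 := by
    rw [← intervalIntegral.integral_const_mul]
    exact intervalIntegral.integral_add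
      (intervalIntegrable_levelIndicator (continuous_sineSum k N) _ 0 1) (hTi 0 1)
  have e1 : 4 / Λ = 64 * D ^ k / N := by
    rw [hΛd]
    field_simp
    norm_num
  have e2 : 16 / Λ ^ 2 = 4096 * D ^ (2 * k) / N ^ 2 := by
    rw [hΛd, pow_mul']
    field_simp
    norm_num
  rw [hΛ2, ← e1, ← e2]
  have h16 : 0 ≤ 16 / Λ ^ 2 := by positivity
  have := mul_le_mul_of_nonneg_left htail h16
  linarith

lemma exists_integral_levelIndicator_sineSum_ge {k : ℕ} (hk : 2 ≤ k) :
    ∃ c₀ c₁ : ℝ, 0 < c₀ ∧ 0 < c₁ ∧ ∀ N D : ℕ, 1 ≤ D → (D : ℝ) ^ (k + 1) ≤ c₀ * N →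
      c₁ * ((D : ℝ) ^ (k + 1) / N) ≤
        ∫ α in (0 : ℝ)..1, levelIndicator (sineSum k N) (N / (32 * D ^ k)) α := by
  set κ : ℝ := 1 / (4 * 8 ^ (k + 1)) with hκ
  have hκ0 : 0 < κ := by positivity
  -- `Δ = K D` with `K` so large that the moduli above `Δ` are negligible; then `c₀` is chosen so
  -- small that the points are mostly isolated and the moduli up to `Δ` are negligible
  obtain ⟨K, hK⟩ := exists_nat_ge (49152 * 160 / κ)
  have hK0 : (0 : ℝ) < K := lt_of_lt_of_le (by positivity) hK
  have hK1 : 1 ≤ K := by exact_mod_cast hK0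
  have hK1' : (1 : ℝ) ≤ K := by exact_mod_cast hK1
  refine ⟨min (κ / (7200 * K)) (1 / (5 * K ^ k)), κ / 80, by positivity, by positivity,
    fun N D hD hDN => ?_⟩
  have hD' : (0 : ℝ) < D := by exact_mod_cast hD
  have hD1 : (1 : ℝ) ≤ D := by exact_mod_cast hD
  set P : ℝ := (D : ℝ) ^ (k + 1) with hP
  have hP0 : 0 < P := by positivity
  have hN0 : (0 : ℝ) < N := by
    by_contra h
    have : (N : ℝ) = 0 := le_antisymm (not_lt.1 h) (Nat.cast_nonneg N)
    rw [this, mul_zero] at hDN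
    linarith
  have hP1 : P ≤ κ / (7200 * K) * N := hDN.trans (by gcongr; exact min_le_left _ _)
  have hP2 : P ≤ 1 / (5 * K ^ k) * N := hDN.trans (by gcongr; exact min_le_right _ _)
  have hΔ : 5 * (K * D) ^ k ≤ N := by
    have h : (5 : ℝ) * (K * D) ^ k ≤ N := by
      calc (5 : ℝ) * (K * D) ^ k ≤ 5 * K ^ k * P := by
            rw [mul_pow, hP, pow_succ, ← mul_assoc, ← mul_assoc]
            exact le_mul_of_one_le_right (by positivity) hD1
        _ ≤ 5 * K ^ k * (1 / (5 * K ^ k) * N) := by gcongr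
        _ = N := by field_simp
    exact_mod_cast h
  have h := card_isolatedPoints_mul_le hk hD (Nat.le_mul_of_pos_left D hK1) hΔ
  have hX := card_isolatedPoints_ge (k := k) (D := D) (η := 1 / (20 * N)) (by positivity)
  have hM := card_majorPoints_ge hk D
  rw [← hκ, ← hP] at hM
  have hPN : P / N ≤ κ / (7200 * K) := by rwa [div_le_iff₀ hN0]
  have hPN0 : 0 < P / N := by positivity
  have hcard : κ / 2 * P ≤ #(isolatedPoints k D (1 / (20 * N))) := by
    have e : 2 * (1 / (20 * N)) * (D : ℝ) ^ (2 * k + 2) = 1 / 10 * (P / N) * P := by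
      rw [show 2 * k + 2 = (k + 1) * 2 by ring, pow_mul, ← hP]
      field_simp
      norm_num
    have h1 : κ / (7200 * K) ≤ κ := div_le_self hκ0.le (by linarith)
    have h2 : 1 / 10 * (P / N) * P ≤ κ / 2 * P := by
      gcongr
      linarith
    rw [e] at hX
    linarith
  have hmain : κ / 40 * (P / N) ≤ #(isolatedPoints k D (1 / (20 * N))) * (1 / (20 * N)) := by
    calc κ / 40 * (P / N) = κ / 2 * P * (1 / (20 * N)) := by
          field_simp
          norm_num
      _ ≤ _ := by gcongr
  have herr : 64 * D ^ k / N * (14 * ((K * D : ℕ) : ℝ) * P * (1 / (20 * N))) ≤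
      κ / 160 * (P / N) := by
    calc 64 * D ^ k / N * (14 * ((K * D : ℕ) : ℝ) * P * (1 / (20 * N)))
        = 224 / 5 * K * (P / N) * (P / N) := by
          push_cast
          rw [hP, pow_succ]
          field_simp
          norm_num
      _ ≤ 224 / 5 * K * (κ / (7200 * K)) * (P / N) := by gcongr
      _ = 224 / 5 / 7200 * κ * (P / N) := by field_simp
      _ ≤ κ / 160 * (P / N) := by
          gcongr
          linarith
  have htail : 4096 * D ^ (2 * k) / N ^ 2 * (12 * N / (((K * D : ℕ) : ℝ) + 1) ^ (k - 1)) ≤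
      κ / 160 * (P / N) := by
    have h1 : (K : ℝ) * D ^ (k - 1) ≤ (((K * D : ℕ) : ℝ) + 1) ^ (k - 1) := by
      push_cast
      calc (K : ℝ) * D ^ (k - 1) ≤ K ^ (k - 1) * D ^ (k - 1) := by
            gcongr
            exact le_self_pow₀ hK1' (by omega)
        _ = (K * D) ^ (k - 1) := (mul_pow _ _ _).symm
        _ ≤ _ := by
            gcongr
            linarith
    calc _ ≤ 4096 * D ^ (2 * k) / N ^ 2 * (12 * N / ((K : ℝ) * D ^ (k - 1))) := by gcongr
      _ = 49152 / K * (P / N) := by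
          have e : (D : ℝ) ^ (2 * k) = D ^ (k - 1) * P := by
            rw [hP, ← pow_add]
            congr 1
            omega
          rw [e]
          field_simp
          norm_num
      _ ≤ κ / 160 * (P / N) := by
          gcongr ?_ * _
          rw [div_le_iff₀ hκ0] at hK
          rw [div_le_iff₀ hK0]
          linarith
  linarith

/-- The weight `sin(πn / N)` is a combination of two exponentials, so `sineSum k N` is a
combination of two translates of `kFreeExpSum k N`. -/
lemma sineSum_eq_translates (k N : ℕ) (α : ℝ) :
    sineSum k N α = (kFreeExpSum k N (α + 1 / (2 * N)) - kFreeExpSum k N (α - 1 / (2 * N))) /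
      (2 * Complex.I) := by
  rw [sineSum, trigPoly, kFreeExpSum, kFreeExpSum, ← sum_sub_distrib, sum_div]
  refine sum_congr rfl fun n _ => ?_
  rw [mul_assoc, sin_mul_expTwoPiI]
  ring

lemma integral_levelIndicator_sineSum_le (k N : ℕ) (t : ℝ) :
    ∫ α in (0 : ℝ)..1, levelIndicator (sineSum k N) t α ≤
      2 * ∫ α in (0 : ℝ)..1, levelIndicator (kFreeExpSum k N) t α := by
  have hper : Function.Periodic (levelIndicator (kFreeExpSum k N) t) 1 :=
    periodic_levelIndicator (periodic_trigPoly _ _) t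
  have hi : ∀ h : ℝ, IntervalIntegrable
      (fun α => levelIndicator (kFreeExpSum k N) t (α + h)) volume 0 1 := fun h => by
    have := (intervalIntegrable_levelIndicator (continuous_kFreeExpSum k N) t (0 + h)
      (1 + h)).comp_add_right (c := h)
    simpa using this
  calc _ ≤ ∫ α in (0 : ℝ)..1, (levelIndicator (kFreeExpSum k N) t (α + 1 / (2 * N)) +
        levelIndicator (kFreeExpSum k N) t (α + -(1 / (2 * N)))) := by
        refine intervalIntegral.integral_mono_on zero_le_one
          (intervalIntegrable_levelIndicator (continuous_sineSum k N) t 0 1)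
          ((hi _).add (hi _)) fun α _ => ?_
        have h1 := levelIndicator_nonneg (kFreeExpSum k N) t (α + 1 / (2 * N))
        have h2 := levelIndicator_nonneg (kFreeExpSum k N) t (α + -(1 / (2 * N)))
        by_cases h : t ≤ ‖sineSum k N α‖
        · have h3 : ‖sineSum k N α‖ ≤ (‖kFreeExpSum k N (α + 1 / (2 * N))‖ +
              ‖kFreeExpSum k N (α + -(1 / (2 * N)))‖) / 2 := by
            rw [sineSum_eq_translates, norm_div, ← sub_eq_add_neg,
              show ‖2 * Complex.I‖ = 2 by simp]
            gcongr
            exact norm_sub_le _ _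
          have h4 := levelIndicator_le_one (sineSum k N) t α
          rcases le_total ‖kFreeExpSum k N (α + 1 / (2 * N))‖
            ‖kFreeExpSum k N (α + -(1 / (2 * N)))‖ with h5 | h5
          · have h6 : levelIndicator (kFreeExpSum k N) t (α + -(1 / (2 * N))) = 1 :=
              if_pos (by linarith)
            linarith
          · have h6 : levelIndicator (kFreeExpSum k N) t (α + 1 / (2 * N)) = 1 :=
              if_pos (by linarith)
            linarith
        · have h3 : levelIndicator (sineSum k N) t α = 0 := if_neg h
          linarith
    _ = _ := by
        rw [intervalIntegral.integral_add (hi _) (hi _), integral_periodic_add hper,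
          integral_periodic_add hper]
        ring

/-- The level sets of `kFreeExpSum k N` at height `N / D ^ k` have measure at least a constant
times `D ^ (k + 1) / N`, as long as this is small. -/
lemma exists_integral_levelIndicator_ge {k : ℕ} (hk : 2 ≤ k) :
    ∃ c₀ c₁ : ℝ, 0 < c₀ ∧ 0 < c₁ ∧ ∀ N D : ℕ, 1 ≤ D → (D : ℝ) ^ (k + 1) ≤ c₀ * N →
      c₁ * ((D : ℝ) ^ (k + 1) / N) ≤
        ∫ α in (0 : ℝ)..1, levelIndicator (kFreeExpSum k N) (N / (32 * D ^ k)) α := by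
  obtain ⟨c₀, c₁, h0, h1, h⟩ := exists_integral_levelIndicator_sineSum_ge hk
  refine ⟨c₀, c₁ / 2, h0, by positivity, fun N D hD hDN => ?_⟩
  have h2 := h N D hD hDN
  have h3 := integral_levelIndicator_sineSum_le k N (N / (32 * D ^ k))
  linarith

/-! ### Lower bounds for the moments -/

/-- Chebyshev's inequality. -/
lemma rpow_mul_integral_levelIndicator_le (k N : ℕ) {p t : ℝ} (hp : 0 ≤ p) (ht : 0 ≤ t) :
    t ^ p * ∫ α in (0 : ℝ)..1, levelIndicator (kFreeExpSum k N) t α ≤ kFreeMoment k N p := by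
  have hc := continuous_kFreeExpSum k N
  rw [kFreeMoment, ← intervalIntegral.integral_const_mul]
  refine intervalIntegral.integral_mono_on zero_le_one
    ((intervalIntegrable_levelIndicator hc t 0 1).const_mul _)
    ((hc.norm.rpow_const fun _ => Or.inr hp).intervalIntegrable _ _) fun α _ => ?_
  unfold levelIndicator
  split_ifs with h
  · rw [mul_one]
    exact rpow_le_rpow ht h hp
  · rw [mul_zero]
    positivity

/-- The level set at the lowest admissible height, where `D ^ (k + 1)` has order `N`. This bound is
sharp for `p < 1 + 1 / k`. -/
lemma kFreeMoment_ge_rpow_div {k : ℕ} (hk : 2 ≤ k) {p : ℝ} (hp : 0 ≤ p) :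
    ∃ c : ℝ, 0 < c ∧ ∀ N : ℕ, 1 ≤ N → c * (N : ℝ) ^ (p / ((k : ℝ) + 1)) ≤ kFreeMoment k N p := by
  obtain ⟨c₀, c₁, h0, h1, hlev⟩ := exists_integral_levelIndicator_ge hk
  obtain ⟨c₂, h2, htriv⟩ := kFreeMoment_ge hk hp
  set A : ℝ := (1 / 32 * c₀ ^ (-(k / (k + 1) : ℝ))) ^ p * (c₁ * (c₀ / 2 ^ (k + 1))) with hA
  have hA0 : 0 < A := by positivity
  refine ⟨min (c₂ * c₀) A, by positivity, fun N hN => ?_⟩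
  have hN1 : (1 : ℝ) ≤ N := by exact_mod_cast hN
  have hN0 : (0 : ℝ) < N := by linarith
  have hk1 : (0 : ℝ) < (k : ℝ) + 1 := by positivity
  rcases lt_or_ge (c₀ * N) 1 with hsmall | hlarge
  · calc _ ≤ c₂ * c₀ * (N : ℝ) ^ p := by
          gcongr
          · exact min_le_left _ _
          · exact div_le_self hp (by linarith [(Nat.cast_nonneg k : (0 : ℝ) ≤ k)])
      _ = c₂ * (N : ℝ) ^ (p - 1) * (c₀ * N) := by
          rw [rpow_sub_one hN0.ne']
          field_simp
      _ ≤ c₂ * (N : ℝ) ^ (p - 1) * 1 := by gcongr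
      _ ≤ _ := by
          rw [mul_one]
          exact htriv N hN
  · set Y : ℝ := (c₀ * N) ^ (1 / ((k : ℝ) + 1)) with hY
    have hY1 : 1 ≤ Y := one_le_rpow hlarge (by positivity)
    have hY0 : 0 < Y := by linarith
    have hYk : Y ^ (k + 1) = c₀ * N := by
      rw [hY, ← rpow_natCast, ← rpow_mul (by positivity)]
      push_cast
      rw [one_div_mul_cancel hk1.ne', rpow_one]
    set D := ⌊Y⌋₊
    have hD : 1 ≤ D := Nat.one_le_floor_iff _ |>.2 hY1
    have hD0 : (0 : ℝ) < D := by exact_mod_cast hD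
    have hDY : (D : ℝ) ≤ Y := Nat.floor_le hY0.le
    have hYD : Y / 2 ≤ D := by
      have h3 : Y < D + 1 := Nat.lt_floor_add_one Y
      have h4 : (1 : ℝ) ≤ D := by exact_mod_cast hD
      linarith
    have h := hlev N D hD (hYk ▸ pow_le_pow_left₀ hD0.le hDY _)
    refine le_trans ?_ (rpow_mul_integral_levelIndicator_le k N hp
      (show 0 ≤ (N : ℝ) / (32 * D ^ k) by positivity))
    have hYk' : (N : ℝ) / Y ^ k = c₀ ^ (-(k / (k + 1) : ℝ)) * (N : ℝ) ^ (1 / ((k : ℝ) + 1)) := by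
      rw [hY, ← rpow_natCast, ← rpow_mul (by positivity), mul_rpow h0.le hN0.le, rpow_neg h0.le,
        show 1 / ((k : ℝ) + 1) = 1 - k / (k + 1) by field_simp; ring, rpow_sub hN0, rpow_one,
        show (1 - (k : ℝ) / (k + 1)) * k = k / (k + 1) by field_simp; ring]
      field_simp
    calc _ ≤ A * (N : ℝ) ^ (p / ((k : ℝ) + 1)) := by
          gcongr
          exact min_le_right _ _
      _ = (1 / 32 * (N / Y ^ k)) ^ p * (c₁ * ((Y / 2) ^ (k + 1) / N)) := by
          rw [hYk', div_pow, hYk, ← mul_assoc (1 / 32 : ℝ),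
            mul_rpow (by positivity) (by positivity), ← rpow_mul hN0.le, hA,
            show 1 / ((k : ℝ) + 1) * p = p / (k + 1) by ring]
          field_simp
      _ ≤ (N / (32 * (D : ℝ) ^ k)) ^ p * (c₁ * ((D : ℝ) ^ (k + 1) / N)) := by
          gcongr ?_ ^ p * (c₁ * (?_ ^ (k + 1) / N))
          calc 1 / 32 * (N / Y ^ k) = N / (32 * Y ^ k) := by field_simp
            _ ≤ _ := by gcongr
      _ ≤ _ := by gcongr

/-- The terms up to `y` of a sequence decreasing at least as fast as a geometric progression of
ratio `1 / 2` add up to at most twice the largest of them. -/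
lemma sum_ite_le_two_mul {y : ℝ} (hy : 0 ≤ y) (n : ℕ) : ∀ u : ℕ → ℝ, (∀ j, 0 ≤ u j) →
    (∀ j, u (j + 1) ≤ u j / 2) → ∑ j ∈ range n, (if u j ≤ y then u j else 0) ≤ 2 * y := by
  have hgeom : ∀ n, ∀ u : ℕ → ℝ, (∀ j, 0 ≤ u j) → (∀ j, u (j + 1) ≤ u j / 2) →
      ∑ j ∈ range n, u j ≤ 2 * u 0 := by
    intro n
    induction n with
    | zero =>
      intro u h0 _
      simpa using h0 0
    | succ n ih =>
      intro u h0 h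
      rw [sum_range_succ']
      have h1 := ih (fun j => u (j + 1)) (fun j => h0 _) fun j => h _
      have h2 := h 0
      linarith
  induction n with
  | zero =>
    intro u _ _
    simpa using hy
  | succ n ih =>
    intro u h0 h
    by_cases h1 : u 0 ≤ y
    · calc _ ≤ ∑ j ∈ range (n + 1), u j := by
            refine sum_le_sum fun j _ => ?_
            split_ifs
            · exact le_rfl
            · exact h0 j
        _ ≤ 2 * u 0 := hgeom _ u h0 h
        _ ≤ 2 * y := by linarith
    · rw [sum_range_succ', if_neg h1, add_zero]
      exact ih (fun j => u (j + 1)) (fun j => h0 _) fun j => h _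

/-- A layer-cake bound: level sets at heights decreasing geometrically can be added up. -/
lemma sum_rpow_mul_integral_levelIndicator_le (k N : ℕ) {p : ℝ} (hp : 1 ≤ p) {t : ℕ → ℝ}
    (ht0 : ∀ j, 0 ≤ t j) (ht : ∀ j, t (j + 1) ≤ t j / 2) (n : ℕ) :
    ∑ j ∈ range n, t j ^ p * ∫ α in (0 : ℝ)..1, levelIndicator (kFreeExpSum k N) (t j) α ≤
      2 * kFreeMoment k N p := by
  have hc := continuous_kFreeExpSum k N
  have hp0 : 0 ≤ p := by linarith
  have hi : ∀ j, IntervalIntegrable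
      (fun α => t j ^ p * levelIndicator (kFreeExpSum k N) (t j) α) volume 0 1 := fun j =>
    (intervalIntegrable_levelIndicator hc (t j) 0 1).const_mul _
  rw [kFreeMoment, ← intervalIntegral.integral_const_mul]
  simp only [← intervalIntegral.integral_const_mul]
  rw [← intervalIntegral.integral_finsetSum fun j _ => hi j]
  refine intervalIntegral.integral_mono_on zero_le_one
    (by simpa only [sum_fn] using IntervalIntegrable.sum (range n) fun j _ => hi j)
    (((hc.norm.rpow_const fun _ => Or.inr hp0).const_smul (2 : ℝ)).intervalIntegrable _ _)
    fun α _ => ?_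
  have h := sum_ite_le_two_mul (y := ‖kFreeExpSum k N α‖ ^ p) (by positivity) n
    (fun j => t j ^ p) (fun j => rpow_nonneg (ht0 j) p) fun j => by
      calc t (j + 1) ^ p ≤ (t j / 2) ^ p := rpow_le_rpow (ht0 _) (ht j) hp0
        _ = t j ^ p / 2 ^ p := div_rpow (ht0 j) (by norm_num) p
        _ ≤ t j ^ p / 2 := by
            have := rpow_nonneg (ht0 j) p
            gcongr
            simpa using rpow_le_rpow_of_exponent_le (show (1 : ℝ) ≤ 2 by norm_num) hp
  refine le_trans (sum_le_sum fun j _ => ?_) h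
  unfold levelIndicator
  split_ifs with h1 h2 h2
  · rw [mul_one]
  · exact absurd (rpow_le_rpow (ht0 j) h1 hp0) h2
  · rw [mul_zero]
    exact rpow_nonneg (ht0 j) p
  · rw [mul_zero]

/-- At the critical exponent the level sets at the heights `N / 2 ^ (j k)`, for about `log N`
values of `j`, contribute equally. -/
lemma kFreeMoment_ge_of_eq {k : ℕ} (hk : 2 ≤ k) {p : ℝ} (hp : p = 1 + 1 / (k : ℝ)) :
    ∃ c : ℝ, 0 < c ∧ ∀ N : ℕ, 1 ≤ N →
      c * ((N : ℝ) ^ (1 / (k : ℝ)) * Real.log N) ≤ kFreeMoment k N p := by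
  have hk0 : (0 : ℝ) < k := by exact_mod_cast (by omega : 0 < k)
  have hp1 : 1 ≤ p := by
    rw [hp]
    have : 0 < 1 / (k : ℝ) := by positivity
    linarith
  have hp' : p - 1 = 1 / k := by rw [hp]; ring
  obtain ⟨c, c₁, h0', h1, hlev⟩ := exists_integral_levelIndicator_ge hk
  obtain ⟨c₂, h2, htriv⟩ := kFreeMoment_ge hk (show 0 ≤ p by linarith)
  set c₀ := min c 1
  have h0 : 0 < c₀ := by positivity
  have h01 : c₀ ≤ 1 := min_le_right _ _
  have hl2 : 0 < Real.log 2 := Real.log_pos (by norm_num)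
  set A : ℝ := 1 / 2 * (c₁ * (1 / 32) ^ p) * (1 / (2 * ((k + 1) * Real.log 2))) with hA
  have hA0 : 0 < A := by positivity
  refine ⟨min (c₂ * c₀ ^ 2) A, by positivity, fun N hN => ?_⟩
  have hN1 : (1 : ℝ) ≤ N := by exact_mod_cast hN
  have hN0 : (0 : ℝ) < N := by linarith
  have hlog0 : 0 ≤ Real.log N := Real.log_nonneg hN1
  rcases lt_or_ge (c₀ ^ 2 * N) 1 with hsmall | hlarge
  · calc _ ≤ c₂ * c₀ ^ 2 * ((N : ℝ) ^ (1 / (k : ℝ)) * N) := by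
          gcongr
          · exact min_le_left _ _
          · exact Real.log_le_self hN0.le
      _ = c₂ * (N : ℝ) ^ (p - 1) * (c₀ ^ 2 * N) := by
          rw [hp']
          ring
      _ ≤ c₂ * (N : ℝ) ^ (p - 1) * 1 := by gcongr
      _ ≤ _ := by
          rw [mul_one]
          exact htriv N hN
  · have hlarge1 : 1 ≤ c₀ * N := by
      refine hlarge.trans ?_
      gcongr
      exact pow_le_of_le_one h0.le h01 (by norm_num)
    set J := ⌊Real.log (c₀ * N) / ((k + 1) * Real.log 2)⌋₊
    have hJ : Real.log N / (2 * ((k + 1) * Real.log 2)) ≤ (J + 1 : ℕ) := by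
      have h3 : Real.log (c₀ * N) / ((k + 1) * Real.log 2) < J + 1 := Nat.lt_floor_add_one _
      have h4 : Real.log N ≤ 2 * Real.log (c₀ * N) := by
        have h5 : Real.log (c₀ ^ 2 * N * N) = 2 * Real.log (c₀ * N) := by
          rw [show c₀ ^ 2 * N * N = (c₀ * N) ^ 2 by ring, Real.log_pow]
          push_cast
          ring
        rw [← h5]
        refine Real.log_le_log hN0 (le_mul_of_one_le_left hN0.le hlarge)
      push_cast
      calc Real.log N / (2 * ((k + 1) * Real.log 2))
          ≤ 2 * Real.log (c₀ * N) / (2 * ((k + 1) * Real.log 2)) := by gcongr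
        _ = Real.log (c₀ * N) / ((k + 1) * Real.log 2) := by
            rw [mul_div_mul_left _ _ (by norm_num)]
        _ ≤ _ := h3.le
    have hpow : ∀ j ≤ J, (((2 ^ j : ℕ) : ℝ)) ^ (k + 1) ≤ c * N := by
      intro j hj
      have h3 : (j : ℝ) ≤ Real.log (c₀ * N) / ((k + 1) * Real.log 2) :=
        (Nat.cast_le.2 hj).trans (Nat.floor_le (div_nonneg (Real.log_nonneg hlarge1)
          (by positivity)))
      rw [le_div_iff₀ (by positivity)] at h3
      have h4 : (((2 ^ j : ℕ) : ℝ)) ^ (k + 1) ≤ c₀ * N := by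
        rw [← Real.log_le_log_iff (by positivity) (by linarith), Real.log_pow]
        push_cast
        rw [Real.log_pow]
        linarith
      refine h4.trans ?_
      gcongr
      exact min_le_left _ _
    set t : ℕ → ℝ := fun j => N / (32 * ((2 ^ j : ℕ) : ℝ) ^ k) with ht
    have ht0 : ∀ j, 0 ≤ t j := fun j => by positivity
    have hthalf : ∀ j, t (j + 1) ≤ t j / 2 := by
      intro j
      simp only [ht]
      have h3 : (2 : ℝ) ≤ 2 ^ k := le_self_pow₀ (by norm_num) (by omega)
      push_cast
      rw [div_div, pow_succ, mul_pow]
      refine div_le_div_of_nonneg_left hN0.le (by positivity) ?_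
      calc 32 * ((2 : ℝ) ^ j) ^ k * 2 ≤ 32 * ((2 : ℝ) ^ j) ^ k * 2 ^ k := by gcongr
        _ = _ := by ring
    have hterm : ∀ j ∈ range (J + 1), c₁ * (1 / 32) ^ p * (N : ℝ) ^ (1 / (k : ℝ)) ≤
        t j ^ p * ∫ α in (0 : ℝ)..1, levelIndicator (kFreeExpSum k N) (t j) α := by
      intro j hj
      rw [mem_range] at hj
      have h3 := hlev N (2 ^ j) Nat.one_le_two_pow (hpow j (by omega))
      set B : ℝ := ((2 ^ j : ℕ) : ℝ) with hB
      have hB0 : 0 < B := by positivity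
      have hBp : (B ^ k) ^ p = B ^ (k + 1) := by
        rw [← rpow_natCast, ← rpow_natCast, ← rpow_mul hB0.le, hp]
        congr 1
        push_cast
        field_simp
      calc c₁ * (1 / 32) ^ p * (N : ℝ) ^ (1 / (k : ℝ)) =
            t j ^ p * (c₁ * (B ^ (k + 1) / N)) := by
            simp only [ht]
            rw [← hB, div_rpow hN0.le (by positivity), mul_rpow (by norm_num) (by positivity), hBp,
              div_rpow (by norm_num) (by norm_num), one_rpow, ← hp', rpow_sub_one hN0.ne']
            field_simp
        _ ≤ _ := mul_le_mul_of_nonneg_left h3 (rpow_nonneg (ht0 j) p)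
    have hsum := (sum_le_sum hterm).trans
      (sum_rpow_mul_integral_levelIndicator_le k N hp1 ht0 hthalf (J + 1))
    rw [sum_const, card_range, nsmul_eq_mul] at hsum
    calc _ ≤ A * ((N : ℝ) ^ (1 / (k : ℝ)) * Real.log N) := by
          gcongr
          exact min_le_right _ _
      _ = 1 / 2 * (Real.log N / (2 * ((k + 1) * Real.log 2)) *
            (c₁ * (1 / 32) ^ p * (N : ℝ) ^ (1 / (k : ℝ)))) := by
          rw [hA]
          ring
      _ ≤ 1 / 2 * ((J + 1 : ℕ) * (c₁ * (1 / 32) ^ p * (N : ℝ) ^ (1 / (k : ℝ)))) := by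
          gcongr
      _ ≤ _ := by linarith

end KFree

theorem theorem2 (k : ℕ) (hk : 2 ≤ k) (p : ℝ) (hp : 0 ≤ p) :
    (1 + 1 / (k : ℝ) < p →
      ∃ c C : ℝ, 0 < c ∧ 0 < C ∧ ∀ N : ℕ, 2 ≤ N →
        c * (N : ℝ) ^ (p - 1) ≤ kFreeMoment k N p ∧
        kFreeMoment k N p ≤ C * (N : ℝ) ^ (p - 1)) ∧
    (p = 1 + 1 / (k : ℝ) →
      ∃ c C : ℝ, 0 < c ∧ 0 < C ∧ ∀ N : ℕ, 2 ≤ N →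
        c * ((N : ℝ) ^ (1 / (k : ℝ)) * Real.log (N : ℝ)) ≤ kFreeMoment k N p ∧
        kFreeMoment k N p ≤ C * ((N : ℝ) ^ (1 / (k : ℝ)) * Real.log (N : ℝ) ^ 2)) ∧
    (p < 1 + 1 / (k : ℝ) →
      ∃ c C : ℝ, 0 < c ∧ 0 < C ∧ ∀ N : ℕ, 2 ≤ N →
        c * (N : ℝ) ^ (p / ((k : ℝ) + 1)) ≤ kFreeMoment k N p ∧
        kFreeMoment k N p ≤ C * (N : ℝ) ^ (p / ((k : ℝ) + 1))) := by
  refine ⟨fun h => ?_, fun h => ?_, fun h => ?_⟩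
  · obtain ⟨c, hc, hlow⟩ := KFree.kFreeMoment_ge hk hp
    obtain ⟨C, hC, hup⟩ := KFree.kFreeMoment_le_of_gt hk h
    exact ⟨c, C, hc, hC, fun N hN => ⟨hlow N (by omega), hup N (by omega)⟩⟩
  · obtain ⟨c, hc, hlow⟩ := KFree.kFreeMoment_ge_of_eq hk h
    obtain ⟨C, hC, hup⟩ := KFree.kFreeMoment_le_of_eq hk h
    exact ⟨c, C, hc, hC, fun N hN => ⟨hlow N (by omega), hup N hN⟩⟩
  · obtain ⟨c, hc, hlow⟩ := KFree.kFreeMoment_ge_rpow_div hk hp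
    obtain ⟨C, hC, hup⟩ := KFree.kFreeMoment_le_of_lt hk hp h
    exact ⟨c, C, hc, hC, fun N hN => ⟨hlow N (by omega), hup N (by omega)⟩⟩
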